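/- Let $M$ be a connected smooth ($C^\infty$) surface with a smooth pseudo-Riemannian metric $g$ of arbitrary signature (positive definite, negative definite or indefinite), and let $H=\tfrac12 g^{ij}p_ip_j\colon T^*M\to\mathbb R$ be its kinetic energy. Let $F\colon T^*M\to\mathbb R$ be a function which in the canonical coordinates $(x,y,p_x,p_y)$ of every local coordinate system $(x,y)$ of $M$ has the form $a(x,y)p_x^2+b(x,y)p_xp_y+c(x,y)p_y^2$ with smooth $a,b,c$. Suppose that $F$ is an integral of the geodesic flow of $g$, i.e. $\{H,F\}=0$ for the standard Poisson bracket on $T^*M$, and that $F$ is nontrivial, i.e. $F\neq k\cdot H$ for every constant $k\in\mathbb R$. Then there is an open dense subset $U\subseteq M$ such that in a neighbourhood of every point of $U$ there exist smooth coordinates $(x,y)$ in which $g$ and $F$ have one of the following forms: - (Liouville) $g=(X(x)-Y(y))(dx^2\pm dy^2)$ and $F=\dfrac{X(x)p_y^2\pm Y(y)p_x^2}{X(x)-Y(y)}$, with smooth functions $X,Y$ of one variable and the same sign $\pm$ in both formulas; if this sign is $-$, the formula holds for $F$ or for $-F$. - (Complex-Liouville) $g=\operatorname{Im}(h)\,dx\,dy$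 and $F=p_x^2-p_y^2+2\,\dfrac{\operatorname{Re}(h)}{\operatorname{Im}(h)}\,p_xp_y$, where $h$ is a holomorphic function of $z=x+iy$. - (Jordan-block) $g=(1+xY'(y))\,dx\,dy$ and, for $F$ or for $-F$, the formula $p_x^2-2\,\dfrac{Y(y)}{1+xY'(y)}\,p_xp_y$, with a smooth function $Y$ of one variable. The denominators $X(x)-Y(y)$, $\operatorname{Im}(h)$, $1+xY'(y)$ do not vanish in these neighbourhoods. -/

import Mathlib

open Set Topology
open scoped Manifold ContDiff

namespace Dini

/-- The coordinate plane. -/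
abbrev Plane : Type := EuclideanSpace ℝ (Fin 2)

noncomputable section

section Manifold

variable {M : Type*} [TopologicalSpace M] [ChartedSpace Plane M]

/-- For a chart `φ = (x, y)` and a point with coordinates `q`, the tangent vector
`v₀ ∂/∂x + v₁ ∂/∂y` at that point. -/
def tangentVec (φ : OpenPartialHomeomorph M Plane) (q v : Plane) :
    TangentSpace (𝓡 2) (φ.symm q) :=
  mfderiv (𝓡 2) (𝓡 2) φ.symm q v

/-- For a chart `φ = (x, y)` and a point with coordinates `q`, the covector
`P₀ dx + P₁ dy` at that point. -/
def covec (φ : OpenPartialHomeomorph M Plane) (q P : Plane) :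
    Module.Dual ℝ (TangentSpace (𝓡 2) (φ.symm q)) :=
  ∑ i : Fin 2, P i •
    ((EuclideanSpace.proj i : Plane →L[ℝ] ℝ).toLinearMap ∘ₗ
      (mfderiv (𝓡 2) (𝓡 2) φ (φ.symm q)).toLinearMap :
        TangentSpace (𝓡 2) (φ.symm q) →ₗ[ℝ] ℝ)

/-- A real function on the cotangent bundle of `M`. -/
abbrev CotangentFunction (M : Type*) [TopologicalSpace M] [ChartedSpace Plane M] : Type _ :=
  ∀ p : M, Module.Dual ℝ (TangentSpace (𝓡 2) p) → ℝ

/-- The expression of a function on the cotangent bundle in the canonical coordinates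
`(x, y, p_x, p_y) = (q 0, q 1, P 0, P 1)` induced by the chart `φ = (x, y)`. -/
def inCoords (F : CotangentFunction M) (φ : OpenPartialHomeomorph M Plane) (q P : Plane) : ℝ :=
  F (φ.symm q) (covec φ q P)

/-- The canonical Poisson bracket of two functions of `(q, P)`. -/
def poissonBracket (A B : Plane → Plane → ℝ) (q P : Plane) : ℝ :=
  ∑ i : Fin 2,
    (fderiv ℝ (fun q' => A q' P) q (EuclideanSpace.single i 1) *
        fderiv ℝ (fun P' => B q P') P (EuclideanSpace.single i 1) -
      fderiv ℝ (fun P' => A q P') P (EuclideanSpace.single i 1) *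
        fderiv ℝ (fun q' => B q' P) q (EuclideanSpace.single i 1))

/-- `F` is (smooth and) quadratic in momenta: in the canonical coordinates of every smooth chart it
is `a(x,y) p_x² + b(x,y) p_x p_y + c(x,y) p_y²` with smooth coefficients. -/
def IsQuadraticInMomenta (F : CotangentFunction M) : Prop :=
  ∀ φ ∈ IsManifold.maximalAtlas (𝓡 2) ∞ M, ∃ a b c : Plane → ℝ,
    ContDiffOn ℝ ∞ a φ.target ∧ ContDiffOn ℝ ∞ b φ.target ∧ ContDiffOn ℝ ∞ c φ.target ∧
    ∀ q ∈ φ.target, ∀ P : Plane,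
      inCoords F φ q P = a q * P 0 ^ 2 + b q * (P 0 * P 1) + c q * P 1 ^ 2

/-- A smooth metric of arbitrary signature on a surface. -/
structure PseudoRiemannianMetric (M : Type*) [TopologicalSpace M] [ChartedSpace Plane M] where
  /-- The bilinear form on every tangent space. -/
  form : ∀ p : M, LinearMap.BilinForm ℝ (TangentSpace (𝓡 2) p)
  symm : ∀ p, (form p).IsSymm
  nondegenerate : ∀ p, (form p).Nondegenerate
  smooth : ∀ φ ∈ IsManifold.maximalAtlas (𝓡 2) ∞ M, ∀ i j : Fin 2,
    ContDiffOn ℝ ∞ (fun q => form (φ.symm q)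
      (tangentVec φ q (EuclideanSpace.single i 1))
      (tangentVec φ q (EuclideanSpace.single j 1))) φ.target

instance (p : M) : FiniteDimensional ℝ (TangentSpace (𝓡 2) p) :=
  inferInstanceAs (FiniteDimensional ℝ Plane)

namespace PseudoRiemannianMetric

/-- The line element `ds²` in the chart `φ = (x, y)` at the point with coordinates `q`, as a
quadratic form in `(dx, dy) = (v 0, v 1)`. -/
def lineElement (g : PseudoRiemannianMetric M) (φ : OpenPartialHomeomorph M Plane)
    (q v : Plane) : ℝ :=
  g.form (φ.symm q) (tangentVec φ q v) (tangentVec φ q v)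

/-- The kinetic energy `H = ½ g^{ij} p_i p_j`, i.e. `½ ξ(ξ♯)` where `g(ξ♯, ·) = ξ`. -/
def hamiltonian (g : PseudoRiemannianMetric M) : CotangentFunction M := fun p ξ =>
  1 / 2 * ξ (((g.form p).toDual (g.nondegenerate p)).symm ξ)

/-- `F` is an integral of the geodesic flow of `g`: `{H, F} = 0`. -/
def IsIntegral (g : PseudoRiemannianMetric M) (F : CotangentFunction M) : Prop :=
  ∀ φ ∈ IsManifold.maximalAtlas (𝓡 2) ∞ M, ∀ q ∈ φ.target, ∀ P : Plane,
    poissonBracket (inCoords g.hamiltonian φ) (inCoords F φ) q P = 0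

/-- `F` is nontrivial: it is not a constant multiple of `H`. -/
def IsNontrivial (g : PseudoRiemannianMetric M) (F : CotangentFunction M) : Prop :=
  ∀ k : ℝ, F ≠ fun p ξ => k * g.hamiltonian p ξ

end PseudoRiemannianMetric

end Manifold

/-! The normal forms: `ds q v` is a line element and `F q P` a function of `(x, y, p_x, p_y)`, for
`q = (x, y)` in the coordinate domain `D`, `v = (dx, dy)` and `P = (p_x, p_y)`. -/

/-- `ds² = (X(x) - Y(y)) (dx² + s dy²)` and `F = (X(x) p_y² + s Y(y) p_x²) / (X(x) - Y(y))`, where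
`s` stands for the sign `±1`. -/
def IsLiouville (s : ℝ) (D : Set Plane) (ds F : Plane → Plane → ℝ) : Prop :=
  ∃ X Y : ℝ → ℝ,
    ContDiffOn ℝ ∞ X ((fun q : Plane => q 0) '' D) ∧
    ContDiffOn ℝ ∞ Y ((fun q : Plane => q 1) '' D) ∧
    ∀ q ∈ D, X (q 0) - Y (q 1) ≠ 0 ∧
      (∀ v : Plane, ds q v = (X (q 0) - Y (q 1)) * (v 0 ^ 2 + s * v 1 ^ 2)) ∧
      (∀ P : Plane, F q P =
        (X (q 0) * P 1 ^ 2 + s * Y (q 1) * P 0 ^ 2) / (X (q 0) - Y (q 1)))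

/-- `ds² = Im(h) dx dy` and `F = p_x² - p_y² + 2 (Re h / Im h) p_x p_y` with `h` holomorphic in
`x + i y`. -/
def IsComplexLiouville (D : Set Plane) (ds F : Plane → Plane → ℝ) : Prop :=
  ∃ h : ℂ → ℂ,
    DifferentiableOn ℂ h ((fun q : Plane => (⟨q 0, q 1⟩ : ℂ)) '' D) ∧
    ∀ q ∈ D, (h ⟨q 0, q 1⟩).im ≠ 0 ∧
      (∀ v : Plane, ds q v = (h ⟨q 0, q 1⟩).im * (v 0 * v 1)) ∧
      (∀ P : Plane, F q P = P 0 ^ 2 - P 1 ^ 2 +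
        2 * ((h ⟨q 0, q 1⟩).re / (h ⟨q 0, q 1⟩).im) * (P 0 * P 1))

/-- `ds² = (1 + x Y'(y)) dx dy` and `F = p_x² - 2 (Y(y) / (1 + x Y'(y))) p_x p_y`. -/
def IsJordanBlock (D : Set Plane) (ds F : Plane → Plane → ℝ) : Prop :=
  ∃ Y : ℝ → ℝ,
    ContDiffOn ℝ ∞ Y ((fun q : Plane => q 1) '' D) ∧
    ∀ q ∈ D, 1 + q 0 * deriv Y (q 1) ≠ 0 ∧
      (∀ v : Plane, ds q v = (1 + q 0 * deriv Y (q 1)) * (v 0 * v 1)) ∧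
      (∀ P : Plane, F q P = P 0 ^ 2 -
        2 * (Y (q 1) / (1 + q 0 * deriv Y (q 1))) * (P 0 * P 1))

end

end Dini

/-!
Where `F` is not proportional to `H`, the coordinates come from isotropic covectors. Let `η` be a
covector field, possibly complex, with `H(η) = 0` and `F(η)` a nonzero constant. Its graph lies in a
common level set of the commuting functions `H` and `F`, so it is Lagrangian, i.e. `η` is closed.
A covector field with `H(η) = 0` and `F(η) ≠ 0` is scaled to have `F(η) = ±1` and integrated to a
null coordinate.

* If `H` is indefinite and `F` vanishes on neither isotropic line, then both lines give null
  coordinates. In these `F = ± p_x² + b p_x p_y ± p_y²`, and the Killing equations become a wave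
  equation (equal signs, Liouville form in `x ± y`) or the Cauchy-Riemann equations (opposite signs,
  complex-Liouville form).
* If `F` vanishes on exactly one of the two lines, the null coordinate of the other line and a
  suitable second coordinate give the Jordan block.
* If `H` is definite, then the isotropic lines are complex conjugate, and the real and imaginary
  parts of a complex null coordinate give the Liouville form.

If `F` vanishes on both lines, it is proportional to `H` there, with a constant factor because it
commutes with `H`. This cannot happen on an open set: the Killing equations of the plane, prolonged
to a closed first order linear system, give unique continuation, and `M` is connected.
-/

namespace Dini

/-! ### Partial derivatives -/

section PartialDerivatives

variable {n : ℕ} {E : Type*} [NormedAddCommGroup E] [NormedSpace ℝ E]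
  {Ω : Set (EuclideanSpace ℝ (Fin n))} {q : EuclideanSpace ℝ (Fin n)} {i j : Fin n}

/-- The partial derivative with respect to the `i`-th coordinate. -/
noncomputable def pd (i : Fin n) (f : EuclideanSpace ℝ (Fin n) → E)
    (q : EuclideanSpace ℝ (Fin n)) : E :=
  fderiv ℝ f q (EuclideanSpace.single i 1)

/-- The differential of a function, as the family of its partial derivatives. -/
noncomputable def differential (f : EuclideanSpace ℝ (Fin n) → E)
    (q : EuclideanSpace ℝ (Fin n)) : Fin n → E :=
  fun i => pd i f q

lemma differentiableAt_of_contDiffOn {V : Type*} [NormedAddCommGroup V] [NormedSpace ℝ V]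
    {f : V → E} {U : Set V} {x : V} (hf : ContDiffOn ℝ ∞ f U) (hU : IsOpen U) (hx : x ∈ U) :
    DifferentiableAt ℝ f x :=
  (hf.contDiffAt (hU.mem_nhds hx)).differentiableAt (by simp)

lemma contDiffOn_vec2 {V : Type*} [NormedAddCommGroup V] [NormedSpace ℝ V] {f g : V → E} {U : Set V}
    (hf : ContDiffOn ℝ ∞ f U) (hg : ContDiffOn ℝ ∞ g U) :
    ContDiffOn ℝ ∞ (fun x => ![f x, g x]) U :=
  contDiffOn_pi.2 (Fin.forall_fin_two.2 ⟨hf, hg⟩)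

lemma contDiffOn_pd {f : EuclideanSpace ℝ (Fin n) → E} (hf : ContDiffOn ℝ ∞ f Ω) (hΩ : IsOpen Ω)
    (i : Fin n) : ContDiffOn ℝ ∞ (pd i f) Ω :=
  (hf.fderiv_of_isOpen hΩ (by simp)).clm_apply contDiffOn_const

lemma contDiffOn_differential {f : EuclideanSpace ℝ (Fin n) → E} (hf : ContDiffOn ℝ ∞ f Ω)
    (hΩ : IsOpen Ω) : ContDiffOn ℝ ∞ (differential f) Ω :=
  contDiffOn_pi.2 fun i => contDiffOn_pd hf hΩ i

lemma pd_congr {f g : EuclideanSpace ℝ (Fin n) → E} (h : EqOn f g Ω) (hΩ : IsOpen Ω) (hq : q ∈ Ω)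
    (i : Fin n) : pd i f q = pd i g q := by
  rw [pd, pd, (h.eventuallyEq_of_mem (hΩ.mem_nhds hq)).fderiv_eq]

lemma pd_const (c : E) : pd i (fun _ : EuclideanSpace ℝ (Fin n) => c) q = 0 := by simp [pd]

lemma differential_sub_const (f : EuclideanSpace ℝ (Fin n) → E) (c : E) :
    differential (fun x => f x - c) = differential f :=
  funext₂ fun _ i => DFunLike.congr_fun (fderiv_sub_const (𝕜 := ℝ) c)
    (EuclideanSpace.single i 1)

lemma pd_coordinate :
    pd i (fun x : EuclideanSpace ℝ (Fin n) => x j) q = if i = j then 1 else 0 := by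
  have h : HasFDerivAt (fun x : EuclideanSpace ℝ (Fin n) => x j)
      (EuclideanSpace.proj j : EuclideanSpace ℝ (Fin n) →L[ℝ] ℝ) q :=
    (EuclideanSpace.proj j : EuclideanSpace ℝ (Fin n) →L[ℝ] ℝ).hasFDerivAt
  simp [pd, h.fderiv, eq_comm]

lemma pd_add {f g : EuclideanSpace ℝ (Fin n) → E} (hf : DifferentiableAt ℝ f q)
    (hg : DifferentiableAt ℝ g q) : pd i (fun x => f x + g x) q = pd i f q + pd i g q := by
  simp [pd, fderiv_fun_add hf hg]

lemma pd_const_smul {f : EuclideanSpace ℝ (Fin n) → E} (hf : DifferentiableAt ℝ f q) (k : ℝ) :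
    pd i (fun x => k • f x) q = k • pd i f q := by
  simp [pd, fderiv_fun_const_smul hf]

lemma pd_const_mul {f : EuclideanSpace ℝ (Fin n) → ℝ} (hf : DifferentiableAt ℝ f q) (k : ℝ) :
    pd i (fun x => k * f x) q = k * pd i f q :=
  pd_const_smul hf k

lemma pd_smul {f : EuclideanSpace ℝ (Fin n) → ℝ} {g : EuclideanSpace ℝ (Fin n) → E}
    (hf : DifferentiableAt ℝ f q) (hg : DifferentiableAt ℝ g q) :
    pd i (fun x => f x • g x) q = pd i f q • g q + f q • pd i g q := by
  simp [pd, fderiv_fun_smul hf hg, add_comm]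

lemma pd_mul {A : Type*} [NormedCommRing A] [NormedAlgebra ℝ A]
    {f g : EuclideanSpace ℝ (Fin n) → A} (hf : DifferentiableAt ℝ f q)
    (hg : DifferentiableAt ℝ g q) :
    pd i (fun x => f x * g x) q = pd i f q * g q + f q * pd i g q := by
  simp [pd, fderiv_fun_mul hf hg, mul_comm, add_comm]

lemma pd_div {f g : EuclideanSpace ℝ (Fin n) → ℝ} (hf : DifferentiableAt ℝ f q)
    (hg : DifferentiableAt ℝ g q) (hg₀ : g q ≠ 0) :
    pd i (fun x => f x / g x) q = (pd i f q * g q - f q * pd i g q) / g q ^ 2 := by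
  have h := hf.hasFDerivAt.mul ((hasDerivAt_inv hg₀).comp_hasFDerivAt q hg.hasFDerivAt)
  have e : (fun x => f x / g x) = f * (fun y => y⁻¹) ∘ g := by
    funext x
    exact div_eq_mul_inv _ _
  rw [pd, e, h.fderiv]
  simp only [add_apply, smul_apply, smul_eq_mul, pd,
    Function.comp_apply]
  field_simp
  ring

lemma differential_linear_combination {x y : EuclideanSpace ℝ (Fin n) → ℝ}
    (hx : DifferentiableAt ℝ x q) (hy : DifferentiableAt ℝ y q) (s t : ℝ) :
    differential (fun q => s * x q + t * y q) q = s • differential x q + t • differential y q := by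
  funext i
  simp only [differential, Pi.add_apply, Pi.smul_apply, smul_eq_mul]
  rw [pd_add (hx.const_mul s) (hy.const_mul t), pd_const_mul hx, pd_const_mul hy]

lemma pd_clm {E' : Type*} [NormedAddCommGroup E'] [NormedSpace ℝ E'] (L : E →L[ℝ] E')
    {f : EuclideanSpace ℝ (Fin n) → E} (hf : DifferentiableAt ℝ f q) :
    pd i (fun x => L (f x)) q = L (pd i f q) := by
  have h := (L.hasFDerivAt.comp q hf.hasFDerivAt).fderiv
  simp only [Function.comp_def] at h
  simp [pd, h]

lemma pd_comm {f : EuclideanSpace ℝ (Fin n) → E} (hf : ContDiffOn ℝ ∞ f Ω) (hΩ : IsOpen Ω)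
    (hq : q ∈ Ω) (i j : Fin n) : pd i (pd j f) q = pd j (pd i f) q := by
  have hd : DifferentiableAt ℝ (fderiv ℝ f) q :=
    differentiableAt_of_contDiffOn (hf.fderiv_of_isOpen hΩ (by simp)) hΩ hq
  have hs : IsSymmSndFDerivAt ℝ f q :=
    (hf.contDiffAt (hΩ.mem_nhds hq)).isSymmSndFDerivAt
      (by simpa using ENat.LEInfty.out (m := 2))
  have pd_pd (k l : Fin n) : pd k (pd l f) q =
      fderiv ℝ (fderiv ℝ f) q (EuclideanSpace.single k 1) (EuclideanSpace.single l 1) :=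
    pd_clm (ContinuousLinearMap.apply ℝ E (EuclideanSpace.single l (1 : ℝ))) hd
  rw [pd_pd, pd_pd, hs]

lemma fderiv_apply_eq_sum_pd (f : EuclideanSpace ℝ (Fin n) → E) (q v : EuclideanSpace ℝ (Fin n)) :
    fderiv ℝ f q v = ∑ i, v i • pd i f q := by
  conv_lhs => rw [← (EuclideanSpace.basisFun (Fin n) ℝ).sum_repr v]
  simp [pd]

theorem exists_primitive (hΩ : IsOpen Ω) (hconv : Convex ℝ Ω)
    {α : EuclideanSpace ℝ (Fin n) → Fin n → ℝ} (hα : ContDiffOn ℝ ∞ α Ω)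
    (hclosed : ∀ q ∈ Ω, ∀ i j, pd i (fun x => α x j) q = pd j (fun x => α x i) q) :
    ∃ W : EuclideanSpace ℝ (Fin n) → ℝ, ContDiffOn ℝ ∞ W Ω ∧ EqOn (differential W) α Ω := by
  set θ : EuclideanSpace ℝ (Fin n) → EuclideanSpace ℝ (Fin n) →L[ℝ] ℝ := fun q =>
    ∑ i, α q i • (EuclideanSpace.proj i : EuclideanSpace ℝ (Fin n) →L[ℝ] ℝ) with hθ
  have hαi (i : Fin n) : ContDiffOn ℝ ∞ (fun q => α q i) Ω := contDiffOn_pi.1 hα i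
  have hθs : ContDiffOn ℝ ∞ θ Ω := ContDiffOn.sum fun i _ => (hαi i).smul contDiffOn_const
  have hθ' (q) (hq : q ∈ Ω) (x y : EuclideanSpace ℝ (Fin n)) :
      fderiv ℝ θ q x y = ∑ j, ∑ i, x i * y j * pd i (fun x => α x j) q := by
    have : fderiv ℝ θ q = ∑ j, (fderiv ℝ (fun x => α x j) q).smulRight
        (EuclideanSpace.proj j : EuclideanSpace ℝ (Fin n) →L[ℝ] ℝ) :=
      (HasFDerivAt.fun_sum fun j _ => (differentiableAt_of_contDiffOn (hαi j) hΩ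
        hq).hasFDerivAt.smul_const _).fderiv
    simp [this, fderiv_apply_eq_sum_pd (fun x => α x _), Finset.sum_mul, mul_right_comm]
  obtain ⟨W, hW⟩ := hconv.exists_forall_hasFDerivAt_of_fderiv_symmetric hΩ
    (hθs.differentiableOn (by simp)) fun q hq x y => by
      rw [hθ' q hq, hθ' q hq, Finset.sum_comm]
      refine Finset.sum_congr rfl fun i _ => Finset.sum_congr rfl fun j _ => ?_
      rw [hclosed q hq i j, mul_comm (x i)]
  have hdW : EqOn (fderiv ℝ W) θ Ω := fun q hq => (hW q hq).fderiv
  refine ⟨W, ?_, fun q hq => funext fun i => ?_⟩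
  · rw [contDiffOn_infty_iff_fderiv_of_isOpen hΩ]
    exact ⟨fun q hq => (hW q hq).differentiableAt.differentiableWithinAt, hθs.congr hdW⟩
  · simp [differential, pd, hdW hq, hθ]

end PartialDerivatives

/-! ### Functions controlled by their derivatives -/

section Segment

variable {V W : Type*} [NormedAddCommGroup V] [NormedSpace ℝ V] [NormedAddCommGroup W]
  [NormedSpace ℝ W]

/- Grönwall's inequality along the segment. -/
theorem eq_zero_of_norm_fderiv_le {f : V → W} {p q : V} {C : ℝ}
    (hf : ∀ x ∈ segment ℝ p q, DifferentiableAt ℝ f x)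
    (hC : ∀ x ∈ segment ℝ p q, ‖fderiv ℝ f x (q - p)‖ ≤ C * ‖f x‖) (hp : f p = 0) : f q = 0 := by
  have hmem (t : ℝ) (ht : t ∈ Icc (0 : ℝ) 1) : AffineMap.lineMap p q t ∈ segment ℝ p q :=
    segment_eq_image_lineMap ℝ p q ▸ mem_image_of_mem _ ht
  have hder (t : ℝ) (ht : t ∈ Icc (0 : ℝ) 1) :
      HasDerivAt (fun t => f (AffineMap.lineMap p q t))
        (fderiv ℝ f (AffineMap.lineMap p q t) (q - p)) t :=
    (hf _ (hmem t ht)).hasFDerivAt.comp_hasDerivAt t AffineMap.hasDerivAt_lineMap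
  have := eq_zero_of_abs_deriv_le_mul_abs_self_of_eq_zero_right
    (fun t ht => (hder t ht).continuousAt.continuousWithinAt)
    (fun t ht => (hder t (Ico_subset_Icc_self ht)).hasDerivWithinAt)
    (by simpa using hp) (fun t ht => hC _ (hmem t (Ico_subset_Icc_self ht))) 1 (by simp)
  simpa using this

theorem eq_of_pd_eq_zero {n : ℕ} {Ω : Set (EuclideanSpace ℝ (Fin n))}
    (hΩ : IsOpen Ω) (hconv : Convex ℝ Ω) {f : EuclideanSpace ℝ (Fin n) → W}
    (hf : DifferentiableOn ℝ f Ω) {p q : EuclideanSpace ℝ (Fin n)} (hp : p ∈ Ω) (hq : q ∈ Ω)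
    (hd : ∀ i, q i ≠ p i → ∀ x ∈ Ω, pd i f x = 0) : f q = f p := by
  have hsub : segment ℝ p q ⊆ Ω := hconv.segment_subset hp hq
  have hd' (x) (hx : x ∈ segment ℝ p q) : fderiv ℝ f x (q - p) = 0 := by
    rw [fderiv_apply_eq_sum_pd]
    refine Finset.sum_eq_zero fun j _ => ?_
    rcases eq_or_ne (q j) (p j) with hj | hj
    · simp [hj]
    · rw [hd j hj x (hsub hx), smul_zero]
  refine sub_eq_zero.1 (eq_zero_of_norm_fderiv_le (f := fun x => f x - f p) (p := p) (C := 0)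
    (fun x hx => (hf.differentiableAt (hΩ.mem_nhds (hsub hx))).sub_const _) (fun x hx => ?_)
    (sub_self _))
  simp [fderiv_sub_const, hd' x hx]

end Segment

section Ball

variable {n : ℕ} {p q : EuclideanSpace ℝ (Fin n)} {r : ℝ}

lemma add_single_mem_ball (hq : q ∈ Metric.ball p r) (i : Fin n) :
    p + (q i - p i) • EuclideanSpace.single i (1 : ℝ) ∈ Metric.ball p r := by
  rw [mem_ball_iff_norm] at hq ⊢
  rw [add_sub_cancel_left, norm_smul, PiLp.norm_single, norm_one, mul_one]
  exact (PiLp.norm_apply_le (q - p) i).trans_lt hq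

theorem exists_eq_comp_coordinate {f : EuclideanSpace ℝ (Fin n) → ℝ}
    (hf : ContDiffOn ℝ ∞ f (Metric.ball p r)) {i : Fin n}
    (hd : ∀ j ≠ i, ∀ x ∈ Metric.ball p r, pd j f x = 0) :
    ∃ X : ℝ → ℝ, ContDiffOn ℝ ∞ X ((fun x : EuclideanSpace ℝ (Fin n) => x i) '' Metric.ball p r) ∧
      ∀ q ∈ Metric.ball p r, f q = X (q i) := by
  have hline : ContDiff ℝ ∞ fun t : ℝ => p + (t - p i) • EuclideanSpace.single i (1 : ℝ) := by
    fun_prop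
  refine ⟨fun t => f (p + (t - p i) • EuclideanSpace.single i (1 : ℝ)), hf.comp hline.contDiffOn ?_,
    fun q hq => ?_⟩
  · rintro _ ⟨q, hq, rfl⟩
    exact add_single_mem_ball hq i
  · refine eq_of_pd_eq_zero Metric.isOpen_ball (convex_ball p r) (hf.differentiableOn (by simp))
      (add_single_mem_ball hq i) hq fun j hj => hd j ?_
    rintro rfl
    simp at hj

lemma pd_comp_coordinate {X : ℝ → ℝ} {Ω : Set (EuclideanSpace ℝ (Fin n))} (hΩ : IsOpen Ω)
    {i : Fin n} (hX : ContDiffOn ℝ ∞ X ((fun x : EuclideanSpace ℝ (Fin n) => x i) '' Ω))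
    (hq : q ∈ Ω) : pd i (fun x => X (x i)) q = deriv X (q i) := by
  let proj : EuclideanSpace ℝ (Fin n) →L[ℝ] ℝ := EuclideanSpace.proj i
  have hopen : IsOpen ((fun x : EuclideanSpace ℝ (Fin n) => x i) '' Ω) :=
    proj.isOpenMap (fun t => ⟨EuclideanSpace.single i t, by simp [proj]⟩) Ω hΩ
  have hXq := (differentiableAt_of_contDiffOn hX hopen (mem_image_of_mem _ hq)).hasDerivAt
  have h := hXq.comp_hasFDerivAt q proj.hasFDerivAt
  rw [pd, show (fun x : EuclideanSpace ℝ (Fin n) => X (x i)) = X ∘ proj from rfl, h.fderiv]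
  simp [proj]

end Ball

/-- The combinations of members of `S` with coefficients smooth on `Ω`, up to equality on `Ω`. -/
inductive SmoothSpan {V : Type*} [NormedAddCommGroup V] [NormedSpace ℝ V] (Ω : Set V)
    (S : Set (V → ℝ)) : (V → ℝ) → Prop
  | mem {f} (hf : f ∈ S) : SmoothSpan Ω S f
  | add {f g} (hf : SmoothSpan Ω S f) (hg : SmoothSpan Ω S g) :
      SmoothSpan Ω S (fun q => f q + g q)
  | mul {f k} (hf : SmoothSpan Ω S f) (hk : ContDiffOn ℝ ∞ k Ω) :
      SmoothSpan Ω S (fun q => f q * k q)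
  | congr {f g} (hf : SmoothSpan Ω S f) (hfg : EqOn g f Ω) : SmoothSpan Ω S g

namespace SmoothSpan

variable {V : Type*} [NormedAddCommGroup V] [NormedSpace ℝ V] {Ω : Set V} {S T : Set (V → ℝ)}
  {f g : V → ℝ}

lemma contDiffOn (hf : SmoothSpan Ω S f) (hS : ∀ u ∈ S, ContDiffOn ℝ ∞ u Ω) :
    ContDiffOn ℝ ∞ f Ω := by
  induction hf with
  | mem h => exact hS _ h
  | add _ _ h1 h2 => exact h1.add h2
  | mul _ hk h => exact h.mul hk
  | congr _ hfg h => exact ContDiffOn.congr h hfg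

lemma trans (hf : SmoothSpan Ω S f) (hST : ∀ u ∈ S, SmoothSpan Ω T u) : SmoothSpan Ω T f := by
  induction hf with
  | mem h => exact hST _ h
  | add _ _ h1 h2 => exact h1.add h2
  | mul _ hk h => exact h.mul hk
  | congr _ hfg h => exact h.congr hfg

lemma mono (hf : SmoothSpan Ω S f) (hST : S ⊆ T) : SmoothSpan Ω T f :=
  hf.trans fun _ hu => .mem (hST hu)

lemma eqOn_zero (hf : SmoothSpan Ω S f) (hS : ∀ u ∈ S, EqOn u 0 Ω) : EqOn f 0 Ω := by
  induction hf with
  | mem h => exact hS _ h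
  | add _ _ h₁ h₂ => exact fun q hq => by simp [h₁ hq, h₂ hq]
  | mul _ _ h => exact fun q hq => by simp [h hq]
  | congr _ hfg h => exact hfg.trans h

lemma const_mul (hf : SmoothSpan Ω S f) (k : ℝ) : SmoothSpan Ω S (fun q => k * f q) :=
  (hf.mul (contDiffOn_const (c := k))).congr fun _ _ => mul_comm _ _

protected lemma pd {n : ℕ} {Ω : Set (EuclideanSpace ℝ (Fin n))}
    {S T : Set (EuclideanSpace ℝ (Fin n) → ℝ)} {f : EuclideanSpace ℝ (Fin n) → ℝ}
    (hf : SmoothSpan Ω S f) (hΩ : IsOpen Ω) (hS : ∀ u ∈ S, ContDiffOn ℝ ∞ u Ω) (hST : S ⊆ T)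
    {i : Fin n} (hd : ∀ u ∈ S, SmoothSpan Ω T (pd i u)) : SmoothSpan Ω T (pd i f) := by
  induction hf with
  | mem h => exact hd _ h
  | add hf hg h1 h2 =>
    exact (h1.add h2).congr fun q hq =>
      pd_add (differentiableAt_of_contDiffOn (hf.contDiffOn hS) hΩ hq)
        (differentiableAt_of_contDiffOn (hg.contDiffOn hS) hΩ hq)
  | mul hf hk h =>
    exact ((h.mul hk).add ((hf.mono hST).mul (contDiffOn_pd hk hΩ i))).congr fun q hq =>
      pd_mul (differentiableAt_of_contDiffOn (hf.contDiffOn hS) hΩ hq)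
        (differentiableAt_of_contDiffOn hk hΩ hq)
  | congr _ hfg h => exact h.congr fun q hq => pd_congr hfg hΩ hq i

lemma exists_bound (hf : SmoothSpan Ω S f) {K : Set V} (hK : IsCompact K) (hKΩ : K ⊆ Ω)
    {N : V → ℝ} (hN : ∀ u ∈ S, ∀ q ∈ K, |u q| ≤ N q) :
    ∃ c : ℝ, 0 ≤ c ∧ ∀ q ∈ K, |f q| ≤ c * N q := by
  induction hf with
  | mem h => exact ⟨1, zero_le_one, fun q hq => by simpa using hN _ h q hq⟩
  | add _ _ h1 h2 =>
    obtain ⟨c, hc0, hc⟩ := h1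
    obtain ⟨d, hd0, hd⟩ := h2
    refine ⟨c + d, add_nonneg hc0 hd0, fun q hq => (abs_add_le _ _).trans ?_⟩
    linarith [hc q hq, hd q hq]
  | @mul f k _ hk h =>
    obtain ⟨c, hc0, hc⟩ := h
    obtain ⟨d, hd⟩ := hK.exists_bound_of_continuousOn (hk.continuousOn.mono hKΩ)
    refine ⟨c * |d|, by positivity, fun q hq => ?_⟩
    have hkd : |k q| ≤ |d| := (hd q hq).trans (le_abs_self d)
    calc |f q * k q| = |f q| * |k q| := abs_mul _ _
      _ ≤ c * N q * |d| := mul_le_mul (hc q hq) hkd (abs_nonneg _) ((abs_nonneg _).trans (hc q hq))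
      _ = _ := mul_right_comm _ _ _
  | congr _ hfg h =>
    obtain ⟨c, hc0, hc⟩ := h
    exact ⟨c, hc0, fun q hq => hfg (hKΩ hq) ▸ hc q hq⟩

theorem eqOn_zero_of_fderiv (hΩ : IsOpen Ω) (hconv : Convex ℝ Ω) (hfin : S.Finite)
    (hS : ∀ u ∈ S, ContDiffOn ℝ ∞ u Ω)
    (hd : ∀ u ∈ S, ∀ v, SmoothSpan Ω S (fun x => fderiv ℝ u x v)) {p : V} (hp : p ∈ Ω)
    (h0 : ∀ u ∈ S, u p = 0) : ∀ u ∈ S, EqOn u 0 Ω := by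
  intro u hu q hq
  have := hfin.fintype
  set f : V → S → ℝ := fun x w => w.1 x
  have hsub : segment ℝ p q ⊆ Ω := hconv.segment_subset hp hq
  have hder (x) (hx : x ∈ segment ℝ p q) :
      HasFDerivAt f (.pi fun w : S => fderiv ℝ w.1 x) x :=
    hasFDerivAt_pi.2 fun w =>
      (differentiableAt_of_contDiffOn (hS _ w.2) hΩ (hsub hx)).hasFDerivAt
  have hcompact : IsCompact (segment ℝ p q) :=
    segment_eq_image_lineMap ℝ p q ▸ isCompact_Icc.image AffineMap.lineMap_continuous
  choose c hc0 hc using fun w : S => (hd w.1 w.2 (q - p)).exists_bound hcompact hsub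
    (N := fun x => ‖f x‖) fun w hw x _ => norm_le_pi_norm (f x) ⟨w, hw⟩
  refine congrFun (eq_zero_of_norm_fderiv_le (f := f) (C := ∑ w, c w)
    (fun x hx => (hder x hx).differentiableAt) (fun x hx => ?_)
    (funext fun w => h0 _ w.2)) ⟨u, hu⟩
  rw [(hder x hx).fderiv]
  have hsum : 0 ≤ ∑ w, c w := Finset.sum_nonneg fun w _ => hc0 w
  refine (pi_norm_le_iff_of_nonneg (by positivity)).2 fun w => (hc w x hx).trans ?_
  gcongr
  exact Finset.single_le_sum (fun w _ => hc0 w) (Finset.mem_univ w)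

end SmoothSpan

/-! ### Quadratic functions of the momenta -/

/-- A function `a p_x² + b p_x p_y + c p_y²` on the cotangent bundle of the plane. -/
@[ext]
structure MomentumForm where
  /-- The coefficient of `p_x²`. -/
  a : Plane → ℝ
  /-- The coefficient of `p_x p_y`. -/
  b : Plane → ℝ
  /-- The coefficient of `p_y²`. -/
  c : Plane → ℝ

/-- The value of the area form on two covectors. -/
def wedge {R : Type*} [CommRing R] (η ζ : Fin 2 → R) : R := η 0 * ζ 1 - η 1 * ζ 0

lemma wedge_smul_add_wedge_smul {R : Type*} [CommRing R] (η ζ θ : Fin 2 → R) :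
    wedge ζ θ • η + wedge η ζ • θ = wedge η θ • ζ := by
  refine funext (Fin.forall_fin_two.2 ⟨?_, ?_⟩) <;>
    simp only [wedge, Pi.add_apply, Pi.smul_apply, smul_eq_mul] <;> ring

lemma wedge_linear_combination {R : Type*} [CommRing R] (s t u v : R) (η ζ : Fin 2 → R) :
    wedge (s • η + t • ζ) (u • η + v • ζ) = (s * v - t * u) * wedge η ζ := by
  simp only [wedge, Pi.add_apply, Pi.smul_apply, smul_eq_mul]
  ring

lemma exists_wedge_differential_coordinate_ne_zero {η : Fin 2 → ℝ} (hη : η ≠ 0) (q : Plane) :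
    ∃ i, wedge η (differential (fun x : Plane => x i) q) ≠ 0 := by
  by_contra! h
  refine hη (funext (Fin.forall_fin_two.2 ⟨?_, ?_⟩))
  · simpa [wedge, differential, pd_coordinate] using h 1
  · simpa [wedge, differential, pd_coordinate] using h 0

namespace MomentumForm

/-- Smoothness of the coefficients. -/
structure SmoothOn (K : MomentumForm) (Ω : Set Plane) : Prop where
  a : ContDiffOn ℝ ∞ K.a Ω
  b : ContDiffOn ℝ ∞ K.b Ω
  c : ContDiffOn ℝ ∞ K.c Ω

instance : Add MomentumForm :=
  ⟨fun K L => ⟨fun q => K.a q + L.a q, fun q => K.b q + L.b q, fun q => K.c q + L.c q⟩⟩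

instance : SMul ℝ MomentumForm :=
  ⟨fun k K => ⟨fun q => k * K.a q, fun q => k * K.b q, fun q => k * K.c q⟩⟩

@[simp] lemma add_a (K L : MomentumForm) : (K + L).a = fun q => K.a q + L.a q := rfl

@[simp] lemma add_b (K L : MomentumForm) : (K + L).b = fun q => K.b q + L.b q := rfl

@[simp] lemma add_c (K L : MomentumForm) : (K + L).c = fun q => K.c q + L.c q := rfl

@[simp] lemma smul_a (k : ℝ) (K : MomentumForm) : (k • K).a = fun q => k * K.a q := rfl

@[simp] lemma smul_b (k : ℝ) (K : MomentumForm) : (k • K).b = fun q => k * K.b q := rfl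

@[simp] lemma smul_c (k : ℝ) (K : MomentumForm) : (k • K).c = fun q => k * K.c q := rfl

/-- The discriminant; `K` is nondegenerate at `q` if it does not vanish. -/
def discr (K : MomentumForm) (q : Plane) : ℝ := K.b q ^ 2 - 4 * K.a q * K.c q

/-- The form whose coefficients are the `i`-th partial derivatives of those of `K`. -/
noncomputable def pdForm (i : Fin 2) (K : MomentumForm) : MomentumForm :=
  ⟨pd i K.a, pd i K.b, pd i K.c⟩

section Algebra

variable {R : Type*} [CommRing R] [Algebra ℝ R]

/-- The value on a covector, with coefficients extended to an `ℝ`-algebra because covectors of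
definite metrics are isotropic only over `ℂ`. -/
def eval (K : MomentumForm) (q : Plane) (η : Fin 2 → R) : R :=
  K.a q • η 0 ^ 2 + K.b q • (η 0 * η 1) + K.c q • η 1 ^ 2

/-- The derivatives of `K` with respect to the momenta. -/
def grad (K : MomentumForm) (q : Plane) (η : Fin 2 → R) : Fin 2 → R :=
  ![(2 * K.a q) • η 0 + K.b q • η 1, K.b q • η 0 + (2 * K.c q) • η 1]

/-- The polar form: `K (η + ζ) = K η + polar K η ζ + K ζ`. -/
def polar (K : MomentumForm) (q : Plane) (η ζ : Fin 2 → R) : R :=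
  K.grad q η 0 * ζ 0 + K.grad q η 1 * ζ 1

/-- The Poisson bracket of two quadratic functions, evaluated at a covector. -/
noncomputable def bracket (H F : MomentumForm) (q : Plane) (η : Fin 2 → R) : R :=
  ∑ i, ((H.pdForm i).eval q η * F.grad q η i - H.grad q η i * (F.pdForm i).eval q η)

lemma polar_self (K : MomentumForm) (q : Plane) (η : Fin 2 → R) :
    K.polar q η η = 2 * K.eval q η := by
  simp only [polar, grad, eval, Algebra.smul_def, Matrix.cons_val_zero, Matrix.cons_val_one,
    map_mul, map_ofNat]
  ring

lemma eval_smul (K : MomentumForm) (q : Plane) (r : R) (η : Fin 2 → R) :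
    K.eval q (r • η) = r ^ 2 * K.eval q η := by
  simp only [eval, Pi.smul_apply, smul_eq_mul]
  simp only [Algebra.smul_def]
  ring

lemma eval_smul_add_smul (K : MomentumForm) (q : Plane) (s t : R) (η ζ : Fin 2 → R) :
    K.eval q (s • η + t • ζ) =
      s ^ 2 * K.eval q η + s * t * K.polar q η ζ + t ^ 2 * K.eval q ζ := by
  simp only [eval, polar, grad, Pi.add_apply, Pi.smul_apply, smul_eq_mul, Matrix.cons_val_zero,
    Matrix.cons_val_one]
  simp only [Algebra.smul_def, map_mul, map_ofNat]
  ring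

lemma polar_linear_combination (K : MomentumForm) (q : Plane) (s t u v : R) (η ζ : Fin 2 → R) :
    K.polar q (s • η + t • ζ) (u • η + v • ζ) = 2 * (s * u) * K.eval q η +
      (s * v + t * u) * K.polar q η ζ + 2 * (t * v) * K.eval q ζ := by
  simp only [eval, polar, grad, Pi.add_apply, Pi.smul_apply, smul_eq_mul, Matrix.cons_val_zero,
    Matrix.cons_val_one]
  simp only [Algebra.smul_def, map_mul, map_ofNat]
  ring

lemma smul_eval (k : ℝ) (K : MomentumForm) (q : Plane) (η : Fin 2 → R) :
    (k • K).eval q η = k • K.eval q η := by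
  simp only [eval, smul_a, smul_b, smul_c, smul_add, mul_smul]

lemma add_eval (K L : MomentumForm) (q : Plane) (η : Fin 2 → R) :
    (K + L).eval q η = K.eval q η + L.eval q η := by
  simp only [eval, add_a, add_b, add_c, add_smul]
  abel

end Algebra

lemma eval_injective {K L : MomentumForm} {q : Plane}
    (h : ∀ P : Fin 2 → ℝ, K.eval q P = L.eval q P) :
    K.a q = L.a q ∧ K.b q = L.b q ∧ K.c q = L.c q := by
  have ha : K.a q = L.a q := by simpa [eval] using h ![1, 0]
  have hc : K.c q = L.c q := by simpa [eval] using h ![0, 1]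
  refine ⟨ha, ?_, hc⟩
  simpa [eval, ha, hc] using h ![1, 1]

lemma polar_sq_sub (K : MomentumForm) (q : Plane) (P Q : Fin 2 → ℝ) :
    K.polar q P Q ^ 2 - 4 * K.eval q P * K.eval q Q = K.discr q * wedge P Q ^ 2 := by
  simp only [polar, eval, grad, discr, wedge, smul_eq_mul, Matrix.cons_val_zero,
    Matrix.cons_val_one]
  ring

lemma eq_zero_of_eval_eq_zero {K : MomentumForm} {q : Plane} (hneg : K.discr q < 0)
    {P : Fin 2 → ℝ} (hP : K.eval q P = 0) : P = 0 := by
  rw [discr] at hneg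
  have ha : K.a q ≠ 0 := fun ha => by
    rw [ha] at hneg
    linarith [sq_nonneg (K.b q)]
  have hsquares : (2 * K.a q * P 0 + K.b q * P 1) ^ 2 +
      -(K.b q ^ 2 - 4 * K.a q * K.c q) * P 1 ^ 2 = 0 := by
    simp only [eval, smul_eq_mul] at hP
    linear_combination 4 * K.a q * hP
  have h₁ : P 1 = 0 := by
    by_contra h₁
    nlinarith [sq_nonneg (2 * K.a q * P 0 + K.b q * P 1), sq_pos_of_ne_zero h₁]
  have h₀ : P 0 = 0 := by simpa [h₁, ha] using hsquares
  exact funext (Fin.forall_fin_two.2 ⟨h₀, h₁⟩)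

lemma eval_complex (K : MomentumForm) (q : Plane) (θ : Fin 2 → ℂ) :
    K.eval q θ = ⟨K.eval q (fun i => (θ i).re) - K.eval q (fun i => (θ i).im),
      K.polar q (fun i => (θ i).im) (fun i => (θ i).re)⟩ := by
  apply Complex.ext <;>
    simp only [eval, polar, grad, pow_two, Complex.add_re, Complex.add_im, Complex.mul_re,
      Complex.mul_im, Complex.real_smul, Complex.ofReal_re, Complex.ofReal_im, smul_eq_mul,
      Matrix.cons_val_zero, Matrix.cons_val_one] <;>
    ring

section Smooth

variable {K L : MomentumForm} {Ω : Set Plane}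

lemma SmoothOn.mono (hK : K.SmoothOn Ω) {Ω' : Set Plane} (h : Ω' ⊆ Ω) : K.SmoothOn Ω' :=
  ⟨hK.a.mono h, hK.b.mono h, hK.c.mono h⟩

lemma SmoothOn.add (hK : K.SmoothOn Ω) (hL : L.SmoothOn Ω) : (K + L).SmoothOn Ω :=
  ⟨hK.a.add hL.a, hK.b.add hL.b, hK.c.add hL.c⟩

lemma SmoothOn.smul (hK : K.SmoothOn Ω) (k : ℝ) : (k • K).SmoothOn Ω :=
  ⟨contDiffOn_const.mul hK.a, contDiffOn_const.mul hK.b, contDiffOn_const.mul hK.c⟩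

lemma SmoothOn.pdForm (hK : K.SmoothOn Ω) (hΩ : IsOpen Ω) (i : Fin 2) :
    (K.pdForm i).SmoothOn Ω :=
  ⟨contDiffOn_pd hK.a hΩ i, contDiffOn_pd hK.b hΩ i, contDiffOn_pd hK.c hΩ i⟩

lemma SmoothOn.discr (hK : K.SmoothOn Ω) : ContDiffOn ℝ ∞ K.discr Ω :=
  (hK.b.pow 2).sub ((contDiffOn_const.mul hK.a).mul hK.c)

variable {A : Type*} [NormedCommRing A] [NormedAlgebra ℝ A] {η ζ : Plane → Fin 2 → A}

lemma SmoothOn.eval (hK : K.SmoothOn Ω) (hη : ContDiffOn ℝ ∞ η Ω) :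
    ContDiffOn ℝ ∞ (fun q => K.eval q (η q)) Ω := by
  have := hK.a; have := hK.b; have := hK.c
  have := contDiffOn_pi.1 hη
  unfold MomentumForm.eval
  fun_prop

lemma SmoothOn.polar (hK : K.SmoothOn Ω) (hη : ContDiffOn ℝ ∞ η Ω) (hζ : ContDiffOn ℝ ∞ ζ Ω) :
    ContDiffOn ℝ ∞ (fun q => K.polar q (η q) (ζ q)) Ω := by
  have := hK.a; have := hK.b; have := hK.c
  have := contDiffOn_pi.1 hη; have := contDiffOn_pi.1 hζ
  simp only [MomentumForm.polar, grad, Matrix.cons_val_zero, Matrix.cons_val_one]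
  fun_prop

lemma pd_apply {η : Plane → Fin 2 → A} {q : Plane} (hη : DifferentiableAt ℝ η q) (i j : Fin 2) :
    pd i (fun x => η x j) q = pd i η q j :=
  pd_clm (ContinuousLinearMap.proj j : (Fin 2 → A) →L[ℝ] A) hη

lemma pd_eval (hK : K.SmoothOn Ω) (hΩ : IsOpen Ω) {q : Plane} (hq : q ∈ Ω)
    (hη : DifferentiableAt ℝ η q) (i : Fin 2) :
    pd i (fun x => K.eval x (η x)) q =
      (K.pdForm i).eval q (η q) + K.polar q (η q) (pd i η q) := by
  have ha := differentiableAt_of_contDiffOn hK.a hΩ hq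
  have hb := differentiableAt_of_contDiffOn hK.b hΩ hq
  have hc := differentiableAt_of_contDiffOn hK.c hΩ hq
  have h (j : Fin 2) : DifferentiableAt ℝ (fun x => η x j) q := differentiableAt_pi.1 hη j
  simp only [MomentumForm.eval, pow_two]
  rw [pd_add (by fun_prop) (by fun_prop), pd_add (by fun_prop) (by fun_prop),
    pd_smul ha (by fun_prop), pd_smul hb (by fun_prop), pd_smul hc (by fun_prop),
    pd_mul (h 0) (h 0), pd_mul (h 0) (h 1), pd_mul (h 1) (h 1)]
  simp only [pd_apply hη, MomentumForm.pdForm, MomentumForm.polar, grad, Algebra.smul_def,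
    Matrix.cons_val_zero, Matrix.cons_val_one, map_mul, map_ofNat]
  ring

end Smooth

end MomentumForm

/-! ### Commuting quadratic functions -/

/-- The Poisson bracket of two quadratic functions vanishes at all covectors over the point `q`;
the four equations are the coefficients of the bracket as a cubic form in the momenta. -/
structure PoissonCommute (H F : MomentumForm) (q : Plane) : Prop where
  xxx : 2 * F.a q * pd 0 H.a q + F.b q * pd 1 H.a q - 2 * H.a q * pd 0 F.a q
    - H.b q * pd 1 F.a q = 0
  xxy : 2 * F.a q * pd 0 H.b q + F.b q * pd 0 H.a q + F.b q * pd 1 H.b q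
    + 2 * F.c q * pd 1 H.a q - 2 * H.a q * pd 0 F.b q - H.b q * pd 0 F.a q
    - H.b q * pd 1 F.b q - 2 * H.c q * pd 1 F.a q = 0
  xyy : 2 * F.a q * pd 0 H.c q + F.b q * pd 0 H.b q + F.b q * pd 1 H.c q
    + 2 * F.c q * pd 1 H.b q - 2 * H.a q * pd 0 F.c q - H.b q * pd 0 F.b q
    - H.b q * pd 1 F.c q - 2 * H.c q * pd 1 F.b q = 0
  yyy : F.b q * pd 0 H.c q + 2 * F.c q * pd 1 H.c q - H.b q * pd 0 F.c q
    - 2 * H.c q * pd 1 F.c q = 0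

namespace PoissonCommute

variable {H F G : MomentumForm} {q : Plane} {Ω : Set Plane}

lemma bracket_eq_zero {R : Type*} [CommRing R] [Algebra ℝ R] (h : PoissonCommute H F q)
    (η : Fin 2 → R) : MomentumForm.bracket H F q η = 0 := by
  have h₁ := congrArg (algebraMap ℝ R) h.xxx
  have h₂ := congrArg (algebraMap ℝ R) h.xxy
  have h₃ := congrArg (algebraMap ℝ R) h.xyy
  have h₄ := congrArg (algebraMap ℝ R) h.yyy
  simp only [map_sub, map_add, map_mul, map_ofNat, map_zero] at h₁ h₂ h₃ h₄
  simp only [MomentumForm.bracket, MomentumForm.eval, MomentumForm.grad, MomentumForm.pdForm,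
    Algebra.smul_def, Matrix.cons_val_zero, Matrix.cons_val_one, map_mul, map_ofNat,
    Fin.sum_univ_two]
  linear_combination η 0 ^ 3 * h₁ + η 0 ^ 2 * η 1 * h₂ + η 0 * η 1 ^ 2 * h₃ + η 1 ^ 3 * h₄

lemma of_bracket_eq_zero (h : ∀ η : Fin 2 → ℝ, MomentumForm.bracket H F q η = 0) :
    PoissonCommute H F q := by
  have at_covector (x y : ℝ) := h ![x, y]
  simp only [MomentumForm.bracket, MomentumForm.eval, MomentumForm.grad, MomentumForm.pdForm,
    smul_eq_mul, Matrix.cons_val_zero, Matrix.cons_val_one, Fin.sum_univ_two] at at_covector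
  have h₁₀ := at_covector 1 0
  have h₀₁ := at_covector 0 1
  have h₁₁ := at_covector 1 1
  have h₁₂ := at_covector 1 (-1)
  constructor
  · linear_combination h₁₀
  · linear_combination (h₁₁ - h₁₂) / 2 - h₀₁
  · linear_combination (h₁₁ + h₁₂) / 2 - h₁₀
  · linear_combination h₀₁

lemma smul (h : PoissonCommute H F q) (hF : F.SmoothOn Ω) (hΩ : IsOpen Ω) (hq : q ∈ Ω) (k : ℝ) :
    PoissonCommute H (k • F) q := by
  have pd_smul {f : Plane → ℝ} (hf : ContDiffOn ℝ ∞ f Ω) (i : Fin 2) :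
      pd i (fun x => k * f x) q = k * pd i f q :=
    pd_const_mul (differentiableAt_of_contDiffOn hf hΩ hq) k
  constructor <;> simp only [MomentumForm.smul_a, MomentumForm.smul_b, MomentumForm.smul_c,
    pd_smul hF.a, pd_smul hF.b, pd_smul hF.c]
  · linear_combination k * h.xxx
  · linear_combination k * h.xxy
  · linear_combination k * h.xyy
  · linear_combination k * h.yyy

lemma add (h : PoissonCommute H F q) (h' : PoissonCommute H G q) (hF : F.SmoothOn Ω)
    (hG : G.SmoothOn Ω) (hΩ : IsOpen Ω) (hq : q ∈ Ω) : PoissonCommute H (F + G) q := by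
  have pd_add {f g : Plane → ℝ} (hf : ContDiffOn ℝ ∞ f Ω) (hg : ContDiffOn ℝ ∞ g Ω) (i : Fin 2) :
      pd i (fun x => f x + g x) q = pd i f q + pd i g q :=
    pd_add (differentiableAt_of_contDiffOn hf hΩ hq) (differentiableAt_of_contDiffOn hg hΩ hq)
  constructor <;>
    simp only [MomentumForm.add_a, MomentumForm.add_b, MomentumForm.add_c, pd_add hF.a hG.a,
      pd_add hF.b hG.b, pd_add hF.c hG.c]
  · linear_combination h.xxx + h'.xxx
  · linear_combination h.xxy + h'.xxy
  · linear_combination h.xyy + h'.xyy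
  · linear_combination h.yyy + h'.yyy

lemma refl (H : MomentumForm) (q : Plane) : PoissonCommute H H q := by
  constructor <;> ring

end PoissonCommute

namespace MomentumForm

variable {H F K : MomentumForm} {Ω : Set Plane}

lemma fderiv_momenta (K : MomentumForm) (q P : Plane) (i : Fin 2) :
    fderiv ℝ (fun P : Plane => K.eval q P.ofLp) P (EuclideanSpace.single i 1) =
      K.grad q P.ofLp i := by
  have h (j : Fin 2) : DifferentiableAt ℝ (fun P : Plane => P.ofLp j) P := by fun_prop
  change pd i _ P = _
  simp only [MomentumForm.eval, pow_two]
  rw [pd_add (by fun_prop) (by fun_prop), pd_add (by fun_prop) (by fun_prop),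
    pd_const_smul (by fun_prop), pd_const_smul (by fun_prop), pd_const_smul (by fun_prop),
    pd_mul (h 0) (h 0), pd_mul (h 0) (h 1), pd_mul (h 1) (h 1)]
  simp only [pd_coordinate, grad, smul_eq_mul]
  fin_cases i <;> simp <;> ring

lemma poissonBracket_eval (hΩ : IsOpen Ω) (hH : H.SmoothOn Ω) (hF : F.SmoothOn Ω) {q : Plane}
    (hq : q ∈ Ω) (P : Plane) :
    poissonBracket (fun x P => H.eval x P.ofLp) (fun x P => F.eval x P.ofLp) q P =
      H.bracket F q P.ofLp := by
  have fderiv_position {K : MomentumForm} (hK : K.SmoothOn Ω) (i : Fin 2) :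
      fderiv ℝ (fun x => K.eval x P.ofLp) q (EuclideanSpace.single i 1) =
        (K.pdForm i).eval q P.ofLp := by
    refine (pd_eval hK hΩ hq (differentiableAt_const P.ofLp) i).trans ?_
    simp [pd_const, polar]
  simp only [poissonBracket, fderiv_position hH, fderiv_position hF, fderiv_momenta, bracket]

end MomentumForm

/-- A smooth nondegenerate quadratic function `H` and a smooth quadratic function `F` on an open
subset of the plane whose Poisson bracket vanishes. -/
structure IsKillingPair (Ω : Set Plane) (H F : MomentumForm) : Prop where
  isOpen : IsOpen Ω
  smooth_left : H.SmoothOn Ω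
  smooth_right : F.SmoothOn Ω
  discr_ne : ∀ q ∈ Ω, H.discr q ≠ 0
  commute : ∀ q ∈ Ω, PoissonCommute H F q

namespace IsKillingPair

variable {Ω : Set Plane} {H F G : MomentumForm}

lemma mono (h : IsKillingPair Ω H F) {Ω' : Set Plane} (ho : IsOpen Ω') (hs : Ω' ⊆ Ω) :
    IsKillingPair Ω' H F :=
  ⟨ho, h.smooth_left.mono hs, h.smooth_right.mono hs, fun q hq => h.discr_ne q (hs hq),
    fun q hq => h.commute q (hs hq)⟩

lemma smul (h : IsKillingPair Ω H F) (k : ℝ) : IsKillingPair Ω H (k • F) :=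
  ⟨h.isOpen, h.smooth_left, h.smooth_right.smul k, h.discr_ne,
    fun q hq => (h.commute q hq).smul h.smooth_right h.isOpen hq k⟩

lemma add (h : IsKillingPair Ω H F) (h' : IsKillingPair Ω H G) : IsKillingPair Ω H (F + G) :=
  ⟨h.isOpen, h.smooth_left, h.smooth_right.add h'.smooth_right, h.discr_ne,
    fun q hq => (h.commute q hq).add (h'.commute q hq) h.smooth_right h'.smooth_right h.isOpen hq⟩

lemma self (h : IsKillingPair Ω H F) : IsKillingPair Ω H H :=
  ⟨h.isOpen, h.smooth_left, h.smooth_left, h.discr_ne, fun q _ => .refl H q⟩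

end IsKillingPair

/-! ### Unique continuation for integrals -/

/-- The equation `v^i ∂_i (K v₀² + J v₀ v₁ + L v₁²) = 0` for all constant `v`, up to combinations
of `K`, `L` and `J`, split into the coefficients of this cubic form in `v`. -/
structure IsKillingSystem (Ω : Set Plane) (K L J : Plane → ℝ) : Prop where
  isOpen : IsOpen Ω
  smooth : ∀ u ∈ ({K, L, J} : Set (Plane → ℝ)), ContDiffOn ℝ ∞ u Ω
  pd_zero_left : SmoothSpan Ω {K, L, J} (pd 0 K)
  pd_one_middle : SmoothSpan Ω {K, L, J} (pd 1 L)
  pd_one_left : SmoothSpan Ω {K, L, J} (fun q => pd 1 K q + pd 0 J q)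
  pd_zero_middle : SmoothSpan Ω {K, L, J} (fun q => pd 0 L q + pd 1 J q)

namespace IsKillingSystem

variable {Ω : Set Plane} {K L J : Plane → ℝ}

/-- The unknowns of a Killing system together with its free first derivatives. -/
def firstJet (K L J : Plane → ℝ) : Set (Plane → ℝ) := {K, L, J, pd 0 J, pd 1 J}

/-- The unknowns of a Killing system together with its free derivatives of all orders. -/
def secondJet (K L J : Plane → ℝ) : Set (Plane → ℝ) := insert (pd 1 (pd 0 J)) (firstJet K L J)

lemma unknowns_subset_firstJet : {K, L, J} ⊆ firstJet K L J := by
  rintro f (rfl | rfl | rfl) <;> simp [firstJet]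

lemma firstJet_subset_secondJet : firstJet K L J ⊆ secondJet K L J := subset_insert _ _

lemma smooth_firstJet (h : IsKillingSystem Ω K L J) :
    ∀ u ∈ firstJet K L J, ContDiffOn ℝ ∞ u Ω := by
  have hJ := h.smooth J (by simp)
  rintro f (rfl | rfl | rfl | rfl | rfl)
  exacts [h.smooth _ (by simp), h.smooth _ (by simp), hJ, contDiffOn_pd hJ h.isOpen 0,
    contDiffOn_pd hJ h.isOpen 1]

lemma smooth_secondJet (h : IsKillingSystem Ω K L J) :
    ∀ u ∈ secondJet K L J, ContDiffOn ℝ ∞ u Ω := by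
  rintro f (rfl | hf)
  · exact contDiffOn_pd (contDiffOn_pd (h.smooth J (by simp)) h.isOpen 0) h.isOpen 1
  · exact h.smooth_firstJet f hf

lemma pd_unknown_mem (h : IsKillingSystem Ω K L J) (i : Fin 2) :
    ∀ u ∈ ({K, L, J} : Set (Plane → ℝ)), SmoothSpan Ω (firstJet K L J) (pd i u) := by
  have hJ (i : Fin 2) : SmoothSpan Ω (firstJet K L J) (pd i J) :=
    .mem (by fin_cases i <;> simp [firstJet])
  have hsub {f : Plane → ℝ} (hf : SmoothSpan Ω {K, L, J} f) := hf.mono unknowns_subset_firstJet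
  rintro f (rfl | rfl | rfl) <;> fin_cases i
  · exact hsub h.pd_zero_left
  · exact ((hsub h.pd_one_left).add ((hJ 0).const_mul (-1))).congr fun q _ => by simp
  · exact ((hsub h.pd_zero_middle).add ((hJ 1).const_mul (-1))).congr fun q _ => by simp
  · exact hsub h.pd_one_middle
  · exact hJ 0
  · exact hJ 1

lemma pd_mem_firstJet (h : IsKillingSystem Ω K L J) {f : Plane → ℝ}
    (hf : SmoothSpan Ω {K, L, J} f) (i : Fin 2) : SmoothSpan Ω (firstJet K L J) (pd i f) :=
  hf.pd h.isOpen h.smooth unknowns_subset_firstJet (h.pd_unknown_mem i)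

/- `∂₀∂₀J` is determined because `∂₀K` and `∂₁K + ∂₀J` are and `∂₁∂₀K = ∂₀∂₁K`. -/
lemma pd_pd_zero_mem_firstJet (h : IsKillingSystem Ω K L J) :
    SmoothSpan Ω (firstJet K L J) (pd 0 (pd 0 J)) := by
  have hK := h.smooth K (by simp)
  have hJ := h.smooth J (by simp)
  refine ((h.pd_mem_firstJet h.pd_one_left 0).add
    ((h.pd_mem_firstJet h.pd_zero_left 1).const_mul (-1))).congr fun q hq => ?_
  have hdiff {f : Plane → ℝ} (hf : ContDiffOn ℝ ∞ f Ω) (i : Fin 2) :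
      DifferentiableAt ℝ (pd i f) q :=
    differentiableAt_of_contDiffOn (contDiffOn_pd hf h.isOpen i) h.isOpen hq
  beta_reduce
  rw [pd_add (hdiff hK 1) (hdiff hJ 0), pd_comm hK h.isOpen hq 1 0]
  ring

lemma pd_pd_one_mem_firstJet (h : IsKillingSystem Ω K L J) :
    SmoothSpan Ω (firstJet K L J) (pd 1 (pd 1 J)) := by
  have hL := h.smooth L (by simp)
  have hJ := h.smooth J (by simp)
  refine ((h.pd_mem_firstJet h.pd_zero_middle 1).add
    ((h.pd_mem_firstJet h.pd_one_middle 0).const_mul (-1))).congr fun q hq => ?_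
  have hdiff {f : Plane → ℝ} (hf : ContDiffOn ℝ ∞ f Ω) (i : Fin 2) :
      DifferentiableAt ℝ (pd i f) q :=
    differentiableAt_of_contDiffOn (contDiffOn_pd hf h.isOpen i) h.isOpen hq
  beta_reduce
  rw [pd_add (hdiff hL 0) (hdiff hJ 1), pd_comm hL h.isOpen hq 1 0]
  ring

lemma pd_firstJet_mem (h : IsKillingSystem Ω K L J) (i : Fin 2) :
    ∀ u ∈ firstJet K L J, SmoothSpan Ω (secondJet K L J) (pd i u) := by
  have hsub {f : Plane → ℝ} (hf : SmoothSpan Ω (firstJet K L J) f) :=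
    hf.mono firstJet_subset_secondJet
  have hmixed : SmoothSpan Ω (secondJet K L J) (pd 1 (pd 0 J)) := .mem (mem_insert _ _)
  rintro f (rfl | rfl | rfl | rfl | rfl)
  iterate 3 exact hsub (h.pd_unknown_mem i _ (by simp))
  · fin_cases i
    exacts [hsub h.pd_pd_zero_mem_firstJet, hmixed]
  · fin_cases i
    exacts [hmixed.congr fun q hq => pd_comm (h.smooth _ (by simp)) h.isOpen hq 0 1,
      hsub h.pd_pd_one_mem_firstJet]

lemma pd_secondJet_mem (h : IsKillingSystem Ω K L J) (i : Fin 2) :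
    ∀ u ∈ secondJet K L J, SmoothSpan Ω (secondJet K L J) (pd i u) := by
  have pd_mem {f : Plane → ℝ} (hf : SmoothSpan Ω (firstJet K L J) f) (i : Fin 2) :
      SmoothSpan Ω (secondJet K L J) (pd i f) :=
    hf.pd h.isOpen h.smooth_firstJet firstJet_subset_secondJet (h.pd_firstJet_mem i)
  have hJ := h.smooth J (by simp)
  rintro f (rfl | hf)
  · fin_cases i
    · exact (pd_mem h.pd_pd_zero_mem_firstJet 1).congr fun q hq =>
        pd_comm (contDiffOn_pd hJ h.isOpen 0) h.isOpen hq 0 1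
    · refine (pd_mem h.pd_pd_one_mem_firstJet 0).congr fun q hq => ?_
      have hcomm : EqOn (pd 1 (pd 0 J)) (pd 0 (pd 1 J)) Ω := fun x hx =>
        pd_comm hJ h.isOpen hx 1 0
      exact (pd_congr hcomm h.isOpen hq 1).trans
        (pd_comm (contDiffOn_pd hJ h.isOpen 1) h.isOpen hq 1 0)
  · exact h.pd_firstJet_mem i f hf

theorem eqOn_zero (h : IsKillingSystem Ω K L J) (hconv : Convex ℝ Ω) {O : Set Plane}
    (hO : IsOpen O) (hOΩ : O ⊆ Ω) (hne : O.Nonempty)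
    (h0 : ∀ u ∈ ({K, L, J} : Set (Plane → ℝ)), EqOn u 0 O) :
    ∀ u ∈ ({K, L, J} : Set (Plane → ℝ)), EqOn u 0 Ω := by
  obtain ⟨p, hp⟩ := hne
  have pd_zero {f : Plane → ℝ} (hf : EqOn f 0 O) (i : Fin 2) : EqOn (pd i f) 0 O := fun q hq =>
    (pd_congr hf hO hq i).trans (pd_const 0)
  have hJ : EqOn J 0 O := h0 J (by simp)
  have hvanish : ∀ u ∈ secondJet K L J, u p = 0 := by
    rintro f (rfl | rfl | rfl | rfl | rfl | rfl)
    exacts [pd_zero (pd_zero hJ 0) 1 hp, h0 _ (by simp) hp, h0 _ (by simp) hp, hJ hp,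
      pd_zero hJ 0 hp, pd_zero hJ 1 hp]
  have hd : ∀ u ∈ secondJet K L J, ∀ v,
      SmoothSpan Ω (secondJet K L J) (fun x => fderiv ℝ u x v) := fun u hu v =>
    (((h.pd_secondJet_mem 0 u hu).const_mul (v 0)).add
      ((h.pd_secondJet_mem 1 u hu).const_mul (v 1))).congr fun x _ => by
        simp [fderiv_apply_eq_sum_pd]
  have := SmoothSpan.eqOn_zero_of_fderiv h.isOpen hconv (by simp [secondJet, firstJet])
    h.smooth_secondJet hd (hOΩ hp) hvanish
  exact fun u hu => this u (firstJet_subset_secondJet (unknowns_subset_firstJet hu))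

end IsKillingSystem

namespace MomentumForm

/-- The inverse of the Legendre transformation `H.grad q`, up to the factor `-H.discr q`. -/
def legendreInv (H : MomentumForm) (v : Fin 2 → ℝ) (q : Plane) : Fin 2 → ℝ :=
  ![2 * H.c q * v 0 - H.b q * v 1, 2 * H.a q * v 1 - H.b q * v 0]

lemma SmoothOn.legendreInv {H : MomentumForm} {Ω : Set Plane} (hH : H.SmoothOn Ω)
    (v : Fin 2 → ℝ) : ContDiffOn ℝ ∞ (H.legendreInv v) Ω := by
  have := hH.a; have := hH.b; have := hH.c
  exact contDiffOn_vec2 (by fun_prop) (by fun_prop)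

lemma grad_legendreInv (H : MomentumForm) (v : Fin 2 → ℝ) (q : Plane) (i : Fin 2) :
    H.grad q (H.legendreInv v q) i = -H.discr q * v i := by
  fin_cases i <;> simp [grad, legendreInv, discr] <;> ring

/-- The quadratic function of velocities corresponding to `F` under `H.legendreInv`. -/
def lower (H F : MomentumForm) : MomentumForm where
  a q := F.eval q (H.legendreInv ![1, 0] q)
  b q := F.polar q (H.legendreInv ![1, 0] q) (H.legendreInv ![0, 1] q)
  c q := F.eval q (H.legendreInv ![0, 1] q)

lemma eval_legendreInv (H F : MomentumForm) (v : Fin 2 → ℝ) (q : Plane) :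
    F.eval q (H.legendreInv v q) = (H.lower F).eval q v := by
  simp only [eval, polar, grad, lower, legendreInv, smul_eq_mul, Matrix.cons_val_zero,
    Matrix.cons_val_one]
  ring

lemma SmoothOn.lower {H F : MomentumForm} {Ω : Set Plane} (hH : H.SmoothOn Ω)
    (hF : F.SmoothOn Ω) : (H.lower F).SmoothOn Ω :=
  ⟨hF.eval (hH.legendreInv _), hF.polar (hH.legendreInv _) (hH.legendreInv _),
    hF.eval (hH.legendreInv _)⟩

lemma discr_sq_mul_a (H F : MomentumForm) (q : Plane) : H.discr q ^ 2 * F.a q =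
    (H.lower F).a q * (4 * H.a q ^ 2) + (H.lower F).b q * (2 * H.a q * H.b q) +
      (H.lower F).c q * H.b q ^ 2 := by
  simp only [discr, eval, polar, grad, lower, legendreInv, smul_eq_mul, Matrix.cons_val_zero,
    Matrix.cons_val_one]
  ring

lemma discr_sq_mul_b (H F : MomentumForm) (q : Plane) : H.discr q ^ 2 * F.b q =
    (H.lower F).a q * (4 * H.a q * H.b q) +
      (H.lower F).b q * (4 * H.a q * H.c q + H.b q ^ 2) +
      (H.lower F).c q * (4 * H.b q * H.c q) := by
  simp only [discr, eval, polar, grad, lower, legendreInv, smul_eq_mul, Matrix.cons_val_zero,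
    Matrix.cons_val_one]
  ring

lemma discr_sq_mul_c (H F : MomentumForm) (q : Plane) : H.discr q ^ 2 * F.c q =
    (H.lower F).a q * H.b q ^ 2 + (H.lower F).b q * (2 * H.b q * H.c q) +
      (H.lower F).c q * (4 * H.c q ^ 2) := by
  simp only [discr, eval, polar, grad, lower, legendreInv, smul_eq_mul, Matrix.cons_val_zero,
    Matrix.cons_val_one]
  ring

end MomentumForm

namespace IsKillingPair

variable {Ω : Set Plane} {H F : MomentumForm}

lemma polar_mem_smoothSpan (F : MomentumForm) {η ζ : Plane → Fin 2 → ℝ}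
    (hη : ContDiffOn ℝ ∞ η Ω) (hζ : ContDiffOn ℝ ∞ ζ Ω) :
    SmoothSpan Ω {F.a, F.b, F.c} (fun q => F.polar q (η q) (ζ q)) := by
  have := contDiffOn_pi.1 hη
  have := contDiffOn_pi.1 hζ
  have ha : SmoothSpan Ω {F.a, F.b, F.c} F.a := .mem (by simp)
  have hb : SmoothSpan Ω {F.a, F.b, F.c} F.b := .mem (by simp)
  have hc : SmoothSpan Ω {F.a, F.b, F.c} F.c := .mem (by simp)
  refine (((ha.mul (k := fun q => 2 * η q 0 * ζ q 0) (by fun_prop)).add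
    (hb.mul (k := fun q => η q 0 * ζ q 1 + η q 1 * ζ q 0) (by fun_prop))).add
    (hc.mul (k := fun q => 2 * η q 1 * ζ q 1) (by fun_prop))).congr fun q _ => ?_
  simp only [MomentumForm.polar, MomentumForm.grad, smul_eq_mul, Matrix.cons_val_zero,
    Matrix.cons_val_one]
  ring

/- The bracket turns `v^i (∂_i F)(η)`, where `v` is proportional to `H.grad q η`, into
`(∂_i H)(η) ∂F/∂p_i`, which contains no derivatives of `F`. -/
lemma derivative_eval_legendreInv (h : IsKillingPair Ω H F) (v : Fin 2 → ℝ) :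
    SmoothSpan Ω {F.a, F.b, F.c} (fun q =>
      v 0 * pd 0 (fun x => F.eval x (H.legendreInv v x)) q +
        v 1 * pd 1 (fun x => F.eval x (H.legendreInv v x)) q) := by
  set η : Plane → Fin 2 → ℝ := H.legendreInv v
  have hη : ContDiffOn ℝ ∞ η Ω := h.smooth_left.legendreInv v
  have hH (i : Fin 2) : ContDiffOn ℝ ∞ (fun q => (H.pdForm i).eval q (η q)) Ω :=
    (h.smooth_left.pdForm h.isOpen i).eval hη
  set w : Plane → Fin 2 → ℝ := fun q i =>
    v 0 * pd 0 η q i + v 1 * pd 1 η q i - (H.pdForm i).eval q (η q) / H.discr q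
  have hw : ContDiffOn ℝ ∞ w Ω := contDiffOn_pi.2 fun i =>
    ((contDiffOn_const.mul (contDiffOn_pi.1 (contDiffOn_pd hη h.isOpen 0) i)).add
      (contDiffOn_const.mul (contDiffOn_pi.1 (contDiffOn_pd hη h.isOpen 1) i))).sub
      ((hH i).div h.smooth_left.discr h.discr_ne)
  refine (polar_mem_smoothSpan F hη hw).congr fun q hq => ?_
  have hD := h.discr_ne q hq
  have hηd := differentiableAt_of_contDiffOn hη h.isOpen hq
  have hbracket := (h.commute q hq).bracket_eq_zero (η q)
  simp only [MomentumForm.bracket, Fin.sum_univ_two, η, H.grad_legendreInv] at hbracket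
  simp only [MomentumForm.pd_eval h.smooth_right h.isOpen hq hηd, MomentumForm.polar, w]
  field_simp
  linear_combination hbracket

lemma mem_smoothSpan_lower (h : IsKillingPair Ω H F) :
    ∀ u ∈ ({F.a, F.b, F.c} : Set (Plane → ℝ)),
      SmoothSpan Ω {(H.lower F).a, (H.lower F).c, (H.lower F).b} u := by
  have := h.smooth_left.a; have := h.smooth_left.b; have := h.smooth_left.c
  have hD : ContDiffOn ℝ ∞ (fun q => (H.discr q ^ 2)⁻¹) Ω :=
    (h.smooth_left.discr.pow 2).inv fun q hq => pow_ne_zero 2 (h.discr_ne q hq)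
  have span {u k l m : Plane → ℝ} (hk : ContDiffOn ℝ ∞ k Ω) (hl : ContDiffOn ℝ ∞ l Ω)
      (hm : ContDiffOn ℝ ∞ m Ω) (hu : ∀ q, H.discr q ^ 2 * u q = (H.lower F).a q * k q +
        (H.lower F).b q * l q + (H.lower F).c q * m q) :
      SmoothSpan Ω {(H.lower F).a, (H.lower F).c, (H.lower F).b} u := by
    have ha : SmoothSpan Ω {(H.lower F).a, (H.lower F).c, (H.lower F).b} (H.lower F).a :=
      .mem (by simp)
    have hb : SmoothSpan Ω {(H.lower F).a, (H.lower F).c, (H.lower F).b} (H.lower F).b :=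
      .mem (by simp)
    have hc : SmoothSpan Ω {(H.lower F).a, (H.lower F).c, (H.lower F).b} (H.lower F).c :=
      .mem (by simp)
    refine ((((ha.mul hk).add (hb.mul hl)).add (hc.mul hm)).mul hD).congr fun q hq => ?_
    exact (eq_div_iff (pow_ne_zero 2 (h.discr_ne q hq))).2 ((mul_comm _ _).trans (hu q))
  rintro u (rfl | rfl | rfl)
  · exact span (by fun_prop) (by fun_prop) (by fun_prop) (H.discr_sq_mul_a F)
  · exact span (by fun_prop) (by fun_prop) (by fun_prop) (H.discr_sq_mul_b F)
  · exact span (by fun_prop) (by fun_prop) (by fun_prop) (H.discr_sq_mul_c F)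

lemma isKillingSystem (h : IsKillingPair Ω H F) :
    IsKillingSystem Ω (H.lower F).a (H.lower F).c (H.lower F).b := by
  have hsmooth := h.smooth_left.lower h.smooth_right
  have derivative (v : Fin 2 → ℝ) :
      SmoothSpan Ω {(H.lower F).a, (H.lower F).c, (H.lower F).b} (fun q =>
        v 0 * ((H.lower F).pdForm 0).eval q v + v 1 * ((H.lower F).pdForm 1).eval q v) := by
    refine ((h.derivative_eval_legendreInv v).trans h.mem_smoothSpan_lower).congr fun q hq => ?_
    simp only [MomentumForm.eval_legendreInv,
      MomentumForm.pd_eval hsmooth h.isOpen hq (differentiableAt_const v), pd_const,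
      MomentumForm.polar, Pi.zero_apply, mul_zero, add_zero]
  simp only [MomentumForm.eval, MomentumForm.pdForm, smul_eq_mul] at derivative
  refine ⟨h.isOpen, ?_, (derivative ![1, 0]).congr ?_, (derivative ![0, 1]).congr ?_,
    (((derivative ![1, 1]).add ((derivative ![1, -1]).const_mul (-1))).const_mul (1 / 2)).add
      ((derivative ![0, 1]).const_mul (-1)) |>.congr ?_,
    (((derivative ![1, 1]).add (derivative ![1, -1])).const_mul (1 / 2)).add
      ((derivative ![1, 0]).const_mul (-1)) |>.congr ?_⟩
  · rintro u (rfl | rfl | rfl)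
    exacts [hsmooth.a, hsmooth.c, hsmooth.b]
  all_goals
    intro q _
    simp only [Matrix.cons_val_zero, Matrix.cons_val_one]
    ring

theorem eqOn_zero (h : IsKillingPair Ω H F) (hconv : Convex ℝ Ω) {O : Set Plane}
    (hO : IsOpen O) (hOΩ : O ⊆ Ω) (hne : O.Nonempty)
    (h0 : ∀ q ∈ O, ∀ P : Fin 2 → ℝ, F.eval q P = 0) :
    ∀ q ∈ Ω, ∀ P : Fin 2 → ℝ, F.eval q P = 0 := by
  have hlower : ∀ q ∈ O, ∀ v : Fin 2 → ℝ, (H.lower F).eval q v = 0 := fun q hq v =>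
    (H.eval_legendreInv F v q).symm.trans (h0 q hq _)
  have hz (q) (hq : q ∈ O) := MomentumForm.eval_injective (L := (0 : ℝ) • F) fun v =>
    (hlower q hq v).trans (by simp [MomentumForm.smul_eval])
  have hzero := h.isKillingSystem.eqOn_zero hconv hO hOΩ hne (by
    rintro u (rfl | rfl | rfl) q hq
    exacts [(hz q hq).1.trans (zero_mul _), (hz q hq).2.2.trans (zero_mul _),
      (hz q hq).2.1.trans (zero_mul _)])
  intro q hq P
  have hcoeff (u) (hu : u ∈ ({F.a, F.b, F.c} : Set (Plane → ℝ))) : u q = 0 :=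
    (h.mem_smoothSpan_lower u hu).eqOn_zero hzero hq
  simp [MomentumForm.eval, hcoeff]

end IsKillingPair

/-! ### Isotropic covector fields -/

namespace MomentumForm

section Field

variable {R : Type*} [Field R] [Algebra ℝ R] {H F : MomentumForm} {q : Plane} {η ζ : Fin 2 → R}

lemma eq_zero_of_grad_eq_zero (hH : H.discr q ≠ 0) (h : H.grad q η = 0) : η = 0 := by
  have h₀ := congrFun h 0
  have h₁ := congrFun h 1
  simp only [grad, Algebra.smul_def, Matrix.cons_val_zero, Matrix.cons_val_one, map_mul, map_ofNat,
    Pi.zero_apply] at h₀ h₁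
  have hD : algebraMap ℝ R (H.discr q) ≠ 0 := by simpa using hH
  simp only [discr, map_sub, map_mul, map_pow, map_ofNat] at hD
  refine funext (Fin.forall_fin_two.2 ⟨?_, ?_⟩) <;> refine (mul_eq_zero.1 ?_).resolve_left hD
  · linear_combination algebraMap ℝ R (H.b q) * h₁ - 2 * algebraMap ℝ R (H.c q) * h₀
  · linear_combination algebraMap ℝ R (H.b q) * h₀ - 2 * algebraMap ℝ R (H.a q) * h₁

lemma wedge_grad_ne_zero (hH : H.discr q ≠ 0) (hη : H.eval q η = 0) (hF : F.eval q η ≠ 0) :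
    wedge (H.grad q η) (F.grad q η) ≠ 0 := by
  have : CharZero R := charZero_of_injective_algebraMap (algebraMap ℝ R).injective
  intro h
  have eulerH := H.polar_self q η
  have eulerF := F.polar_self q η
  simp only [polar, wedge] at h eulerH eulerF
  have hF₂ : 2 * F.eval q η ≠ 0 := by simpa using hF
  refine hF ?_
  have hgrad : H.grad q η = 0 := by
    refine funext (Fin.forall_fin_two.2 ⟨?_, ?_⟩) <;> refine (mul_eq_zero.1 ?_).resolve_left hF₂
    · linear_combination η 1 * h - H.grad q η 0 * eulerF + F.grad q η 0 * (eulerH + 2 * hη)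
    · linear_combination -η 0 * h - H.grad q η 1 * eulerF + F.grad q η 1 * (eulerH + 2 * hη)
  simp [eq_zero_of_grad_eq_zero hH hgrad, eval]

lemma eval_mul_wedge_sq (hη : F.eval q η = 0) (hζ : F.eval q ζ = 0) (P : Fin 2 → R) :
    F.eval q P * wedge η ζ ^ 2 = F.polar q η ζ * (wedge P ζ * wedge η P) := by
  simp only [eval, polar, grad, wedge, Algebra.smul_def, Matrix.cons_val_zero, Matrix.cons_val_one,
    map_mul, map_ofNat] at hη hζ ⊢
  linear_combination (P 0 * ζ 1 - P 1 * ζ 0) ^ 2 * hη + (η 0 * P 1 - η 1 * P 0) ^ 2 * hζ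

lemma eval_algebraMap (K : MomentumForm) (q : Plane) (P : Fin 2 → ℝ) :
    K.eval q (fun i => algebraMap ℝ R (P i)) = algebraMap ℝ R (K.eval q P) := by
  simp only [eval, Algebra.smul_def, map_add, map_mul, map_pow, Algebra.algebraMap_self,
    RingHom.id_apply]

lemma proportional_of_isotropic (hw : wedge η ζ ≠ 0) (hHη : H.eval q η = 0) (hHζ : H.eval q ζ = 0)
    (hFη : F.eval q η = 0) (hFζ : F.eval q ζ = 0) (P Q : Fin 2 → ℝ) :
    F.eval q P * H.eval q Q = F.eval q Q * H.eval q P := by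
  refine (algebraMap ℝ R).injective (mul_right_cancel₀ (pow_ne_zero 4 hw) ?_)
  simp only [map_mul, ← eval_algebraMap]
  set P' : Fin 2 → R := fun i => algebraMap ℝ R (P i)
  set Q' : Fin 2 → R := fun i => algebraMap ℝ R (Q i)
  linear_combination
    H.eval q Q' * wedge η ζ ^ 2 * eval_mul_wedge_sq hFη hFζ P' +
    F.polar q η ζ * (wedge P' ζ * wedge η P') * eval_mul_wedge_sq hHη hHζ Q' -
    H.eval q P' * wedge η ζ ^ 2 * eval_mul_wedge_sq hFη hFζ Q' -
    F.polar q η ζ * (wedge Q' ζ * wedge η Q') * eval_mul_wedge_sq hHη hHζ P'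

end Field

/-- The factor `l` in `F = l H` when `F` and `H` are proportional at `q`. -/
noncomputable def ratio (H F : MomentumForm) (q : Plane) : ℝ :=
  (F.b q * H.b q - 2 * F.a q * H.c q - 2 * F.c q * H.a q) / H.discr q

variable {H F : MomentumForm} {q : Plane}

lemma coefficients_eq_ratio_mul (hH : H.discr q ≠ 0)
    (h : ∀ P Q : Fin 2 → ℝ, F.eval q P * H.eval q Q = F.eval q Q * H.eval q P) :
    F.a q = ratio H F q * H.a q ∧ F.b q = ratio H F q * H.b q ∧ F.c q = ratio H F q * H.c q := by
  have hac := h ![1, 0] ![0, 1]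
  have hab := h ![1, 0] ![1, 1]
  have hbc := h ![0, 1] ![1, 1]
  simp only [eval, smul_eq_mul, Matrix.cons_val_zero, Matrix.cons_val_one] at hac hab hbc
  unfold ratio
  refine ⟨?_, ?_, ?_⟩ <;> rw [div_mul_eq_mul_div, eq_div_iff hH, discr]
  · linear_combination H.b q * (hab - hac) - 2 * H.a q * hac
  · linear_combination 2 * H.c q * (hab - hac) + 2 * H.a q * (hbc + hac)
  · linear_combination 2 * H.c q * hac + H.b q * (hbc + hac)

lemma eq_zero_of_eval_mul_polar_eq_zero (hH : H.discr q ≠ 0) {d : Fin 2 → ℝ}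
    (h : ∀ P : Fin 2 → ℝ, H.eval q P * H.polar q P d = 0) : d = 0 := by
  have h₁₀ := h ![1, 0]
  have h₀₁ := h ![0, 1]
  have h₁₁ := h ![1, 1]
  have h₁₂ := h ![1, -1]
  simp only [eval, polar, grad, smul_eq_mul, Matrix.cons_val_zero, Matrix.cons_val_one]
    at h₁₀ h₀₁ h₁₁ h₁₂
  set x := H.grad q d 0 with hx
  set y := H.grad q d 1 with hy
  simp only [grad, smul_eq_mul, Matrix.cons_val_zero, Matrix.cons_val_one] at hx hy
  have hax : H.a q * x = 0 := by rw [hx]; linear_combination h₁₀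
  have hcy : H.c q * y = 0 := by rw [hy]; linear_combination h₀₁
  have hxy : H.b q * x + H.a q * y = 0 := by
    rw [hx, hy]; linear_combination (h₁₁ - h₁₂) / 2 - h₀₁
  have hyx : H.c q * x + H.b q * y = 0 := by
    rw [hx, hy]; linear_combination (h₁₁ + h₁₂) / 2 - h₁₀
  refine eq_zero_of_grad_eq_zero hH (funext (Fin.forall_fin_two.2 ⟨?_, ?_⟩)) <;>
    refine pow_eq_zero_iff two_ne_zero |>.1 ((mul_eq_zero.1 ?_).resolve_left hH) <;>
    rw [discr]
  · change _ * x ^ 2 = 0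
    linear_combination H.b q * x * hxy - (H.b q * y + 4 * H.c q * x) * hax
  · change _ * y ^ 2 = 0
    linear_combination H.b q * y * hyx - (H.b q * x + 4 * H.a q * y) * hcy

end MomentumForm

namespace IsKillingPair

variable {Ω : Set Plane} {H F : MomentumForm}

section Closed

variable {𝕜 : Type*} [NormedField 𝕜] [NormedAlgebra ℝ 𝕜] {η : Plane → Fin 2 → 𝕜}

/-- The graph of `η` is a level set of the commuting functions `H` and `F`, hence Lagrangian. -/
theorem pd_symm_of_isotropic (h : IsKillingPair Ω H F) (hη : ContDiffOn ℝ ∞ η Ω)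
    (hH : ∀ q ∈ Ω, H.eval q (η q) = 0) {n : 𝕜} (hn : n ≠ 0) (hF : ∀ q ∈ Ω, F.eval q (η q) = n)
    {q : Plane} (hq : q ∈ Ω) (i j : Fin 2) :
    pd i (fun x => η x j) q = pd j (fun x => η x i) q := by
  have hηq := differentiableAt_of_contDiffOn hη h.isOpen hq
  have derivH (i : Fin 2) : (H.pdForm i).eval q (η q) + H.polar q (η q) (pd i η q) = 0 := by
    rw [← MomentumForm.pd_eval h.smooth_left h.isOpen hq hηq, pd_congr hH h.isOpen hq, pd_const]
  have derivF (i : Fin 2) : (F.pdForm i).eval q (η q) + F.polar q (η q) (pd i η q) = 0 := by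
    rw [← MomentumForm.pd_eval h.smooth_right h.isOpen hq hηq, pd_congr hF h.isOpen hq, pd_const]
  have hbracket := (h.commute q hq).bracket_eq_zero (η q)
  have hindep := MomentumForm.wedge_grad_ne_zero (h.discr_ne q hq) (hH q hq)
    (by rwa [hF q hq] : F.eval q (η q) ≠ 0)
  have hclosed : pd 0 η q 1 = pd 1 η q 0 := by
    refine sub_eq_zero.1 ((mul_eq_zero.1 ?_).resolve_left hindep)
    simp only [MomentumForm.polar] at derivH derivF
    simp only [MomentumForm.bracket, Fin.sum_univ_two] at hbracket
    simp only [wedge]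
    linear_combination hbracket - F.grad q (η q) 0 * derivH 0 - F.grad q (η q) 1 * derivH 1 +
      H.grad q (η q) 0 * derivF 0 + H.grad q (η q) 1 * derivF 1
  simp only [MomentumForm.pd_apply hηq]
  fin_cases i <;> fin_cases j
  exacts [rfl, hclosed, hclosed.symm, rfl]

end Closed

lemma polar_differential_eq_zero (h : IsKillingPair Ω H F) {l : Plane → ℝ}
    (hl : ContDiffOn ℝ ∞ l Ω)
    (hF : ∀ q ∈ Ω, F.a q = l q * H.a q ∧ F.b q = l q * H.b q ∧ F.c q = l q * H.c q)
    {q : Plane} (hq : q ∈ Ω) (P : Fin 2 → ℝ) :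
    H.eval q P * H.polar q P (differential l q) = 0 := by
  have hlq := differentiableAt_of_contDiffOn hl h.isOpen hq
  have pd_coefficient {f g : Plane → ℝ} (hf : ContDiffOn ℝ ∞ f Ω)
      (hg : EqOn g (fun x => l x * f x) Ω) (i : Fin 2) :
      pd i g q = pd i l q * f q + l q * pd i f q := by
    rw [pd_congr hg h.isOpen hq, pd_mul hlq (differentiableAt_of_contDiffOn hf h.isOpen hq)]
  have da := pd_coefficient h.smooth_left.a fun x hx => (hF x hx).1
  have db := pd_coefficient h.smooth_left.b fun x hx => (hF x hx).2.1
  have dc := pd_coefficient h.smooth_left.c fun x hx => (hF x hx).2.2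
  have hbracket := (h.commute q hq).bracket_eq_zero P
  obtain ⟨ea, eb, ec⟩ := hF q hq
  simp only [MomentumForm.bracket, MomentumForm.eval, MomentumForm.grad, MomentumForm.pdForm,
    smul_eq_mul, Matrix.cons_val_zero, Matrix.cons_val_one, Fin.sum_univ_two, da, db, dc,
    ea, eb, ec] at hbracket
  simp only [MomentumForm.polar, MomentumForm.eval, MomentumForm.grad, differential, smul_eq_mul,
    Matrix.cons_val_zero, Matrix.cons_val_one]
  linear_combination -hbracket

lemma contDiffOn_ratio (h : IsKillingPair Ω H F) : ContDiffOn ℝ ∞ (MomentumForm.ratio H F) Ω :=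
  (((h.smooth_right.b.mul h.smooth_left.b).sub
    ((contDiffOn_const.mul h.smooth_right.a).mul h.smooth_left.c)).sub
    ((contDiffOn_const.mul h.smooth_right.c).mul h.smooth_left.a)).div
    h.smooth_left.discr h.discr_ne

theorem exists_eq_smul_of_proportional (h : IsKillingPair Ω H F) (hconv : Convex ℝ Ω)
    (hprop : ∀ q ∈ Ω, ∀ P Q : Fin 2 → ℝ, F.eval q P * H.eval q Q = F.eval q Q * H.eval q P) :
    ∃ k : ℝ, ∀ q ∈ Ω, ∀ P : Fin 2 → ℝ, F.eval q P = k * H.eval q P := by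
  rcases Ω.eq_empty_or_nonempty with rfl | ⟨p, hp⟩
  · exact ⟨0, by simp⟩
  have hF q (hq : q ∈ Ω) := MomentumForm.coefficients_eq_ratio_mul (h.discr_ne q hq) (hprop q hq)
  have hratio := h.contDiffOn_ratio
  have hconst (q : Plane) (hq : q ∈ Ω) : MomentumForm.ratio H F q = MomentumForm.ratio H F p := by
    refine h.isOpen.is_const_of_fderiv_eq_zero (𝕜 := ℝ) hconv.isPreconnected
      (hratio.differentiableOn (by simp)) (fun x hx => ?_) hq hp
    have hd : differential (MomentumForm.ratio H F) x = 0 :=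
      MomentumForm.eq_zero_of_eval_mul_polar_eq_zero (h.discr_ne x hx)
        (h.polar_differential_eq_zero hratio hF hx)
    ext v
    rw [fderiv_apply_eq_sum_pd]
    simp [fun i => show pd i (MomentumForm.ratio H F) x = 0 from congrFun hd i]
  refine ⟨MomentumForm.ratio H F p, fun q hq P => ?_⟩
  obtain ⟨ea, eb, ec⟩ := hF q hq
  simp only [MomentumForm.eval, smul_eq_mul, ea, eb, ec, hconst q hq]
  ring

end IsKillingPair

/-- A smooth coframe, over `ℝ` or `ℂ`, of covectors that are isotropic for `H`. -/
structure IsNullCoframe {𝕜 : Type*} [NormedField 𝕜] [NormedAlgebra ℝ 𝕜] (Ω : Set Plane)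
    (H : MomentumForm) (η ζ : Plane → Fin 2 → 𝕜) : Prop where
  smooth_left : ContDiffOn ℝ ∞ η Ω
  smooth_right : ContDiffOn ℝ ∞ ζ Ω
  null_left : ∀ q ∈ Ω, H.eval q (η q) = 0
  null_right : ∀ q ∈ Ω, H.eval q (ζ q) = 0
  wedge_ne : ∀ q ∈ Ω, wedge (η q) (ζ q) ≠ 0

namespace IsNullCoframe

variable {𝕜 : Type*} [NormedField 𝕜] [NormedAlgebra ℝ 𝕜] {Ω : Set Plane} {H : MomentumForm}
  {η ζ : Plane → Fin 2 → 𝕜}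

lemma mono (h : IsNullCoframe Ω H η ζ) {Ω' : Set Plane} (hs : Ω' ⊆ Ω) : IsNullCoframe Ω' H η ζ :=
  ⟨h.smooth_left.mono hs, h.smooth_right.mono hs, fun q hq => h.null_left q (hs hq),
    fun q hq => h.null_right q (hs hq), fun q hq => h.wedge_ne q (hs hq)⟩

lemma symm (h : IsNullCoframe Ω H η ζ) : IsNullCoframe Ω H ζ η := by
  refine ⟨h.smooth_right, h.smooth_left, h.null_right, h.null_left, fun q hq hw => ?_⟩
  refine h.wedge_ne q hq ?_
  simp only [wedge] at hw ⊢
  linear_combination -hw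

lemma smul_left (h : IsNullCoframe Ω H η ζ) {r : Plane → 𝕜} (hr : ContDiffOn ℝ ∞ r Ω)
    (hr₀ : ∀ q ∈ Ω, r q ≠ 0) : IsNullCoframe Ω H (fun q => r q • η q) ζ := by
  refine ⟨hr.smul h.smooth_left, h.smooth_right, fun q hq => ?_, h.null_right, fun q hq => ?_⟩
  · rw [MomentumForm.eval_smul, h.null_left q hq, mul_zero]
  · have : wedge (r q • η q) (ζ q) = r q * wedge (η q) (ζ q) := by
      simp only [wedge, Pi.smul_apply, smul_eq_mul]
      ring
    rw [this]
    exact mul_ne_zero (hr₀ q hq) (h.wedge_ne q hq)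

/-- The isotropic directions given by the quadratic formula, for a square root `s` of the
discriminant. -/
lemma of_sqrt_discr {s : Plane → 𝕜} (hH : H.SmoothOn Ω) (hs : ContDiffOn ℝ ∞ s Ω)
    (hs₀ : ∀ q ∈ Ω, s q ≠ 0) (hs₂ : ∀ q ∈ Ω, s q ^ 2 = algebraMap ℝ 𝕜 (H.discr q))
    (ht : ∀ q ∈ Ω, algebraMap ℝ 𝕜 (H.b q) + s q ≠ 0) :
    IsNullCoframe Ω H
      (fun q => ![-(algebraMap ℝ 𝕜 (H.b q) + s q), 2 * algebraMap ℝ 𝕜 (H.a q)])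
      (fun q => ![2 * algebraMap ℝ 𝕜 (H.c q), -(algebraMap ℝ 𝕜 (H.b q) + s q)]) := by
  have : CharZero 𝕜 := charZero_of_injective_algebraMap (algebraMap ℝ 𝕜).injective
  have smooth {f : Plane → ℝ} (hf : ContDiffOn ℝ ∞ f Ω) :
      ContDiffOn ℝ ∞ (fun q => algebraMap ℝ 𝕜 (f q)) Ω :=
    (algebraMapCLM ℝ 𝕜).contDiff.comp_contDiffOn hf
  simp only [MomentumForm.discr, map_sub, map_mul, map_pow, map_ofNat] at hs₂
  have ht' := ((smooth hH.b).add hs).neg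
  refine ⟨contDiffOn_vec2 ht' (contDiffOn_const.mul (smooth hH.a)),
    contDiffOn_vec2 (contDiffOn_const.mul (smooth hH.c)) ht', fun q hq => ?_, fun q hq => ?_,
    fun q hq => ?_⟩
  · simp only [MomentumForm.eval, Algebra.smul_def, Matrix.cons_val_zero, Matrix.cons_val_one]
    linear_combination algebraMap ℝ 𝕜 (H.a q) * hs₂ q hq
  · simp only [MomentumForm.eval, Algebra.smul_def, Matrix.cons_val_zero, Matrix.cons_val_one]
    linear_combination algebraMap ℝ 𝕜 (H.c q) * hs₂ q hq
  · have hw : wedge ![-(algebraMap ℝ 𝕜 (H.b q) + s q), 2 * algebraMap ℝ 𝕜 (H.a q)]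
        ![2 * algebraMap ℝ 𝕜 (H.c q), -(algebraMap ℝ 𝕜 (H.b q) + s q)] =
        2 * s q * (algebraMap ℝ 𝕜 (H.b q) + s q) := by
      simp only [wedge, Matrix.cons_val_zero, Matrix.cons_val_one]
      linear_combination -hs₂ q hq
    rw [hw]
    exact mul_ne_zero (mul_ne_zero two_ne_zero (hs₀ q hq)) (ht q hq)

lemma exists_eval_ne_zero (h : IsNullCoframe Ω H η ζ) {F : MomentumForm}
    (hpair : IsKillingPair Ω H F) (hconv : Convex ℝ Ω)
    (hF : ¬ ∃ k : ℝ, ∀ q ∈ Ω, ∀ P : Fin 2 → ℝ, F.eval q P = k * H.eval q P) :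
    ∃ η ζ : Plane → Fin 2 → 𝕜, IsNullCoframe Ω H η ζ ∧ ∃ q ∈ Ω, F.eval q (η q) ≠ 0 := by
  by_cases hη : ∃ q ∈ Ω, F.eval q (η q) ≠ 0
  · exact ⟨η, ζ, h, hη⟩
  by_cases hζ : ∃ q ∈ Ω, F.eval q (ζ q) ≠ 0
  · exact ⟨ζ, η, h.symm, hζ⟩
  push Not at hη hζ
  exact (hF (hpair.exists_eq_smul_of_proportional hconv fun q hq =>
    MomentumForm.proportional_of_isotropic (h.wedge_ne q hq) (h.null_left q hq) (h.null_right q hq)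
      (hη q hq) (hζ q hq))).elim

end IsNullCoframe

lemma exists_ball_subset_preimage {E : Type*} [TopologicalSpace E] {Ω : Set Plane}
    (hΩ : IsOpen Ω) {f : Plane → E} (hf : ContinuousOn f Ω) {T : Set E} (hT : IsOpen T) {p : Plane}
    (hp : p ∈ Ω) (hpT : f p ∈ T) :
    ∃ r > 0, Metric.ball p r ⊆ Ω ∧ ∀ q ∈ Metric.ball p r, f q ∈ T := by
  obtain ⟨r, hr, h⟩ := Metric.isOpen_iff.1 (hf.isOpen_inter_preimage hΩ hT) p ⟨hp, hpT⟩
  exact ⟨r, hr, fun q hq => (h hq).1, fun q hq => (h hq).2⟩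

section LocalCoframes

variable {Ω : Set Plane} {H : MomentumForm} {p : Plane}

lemma exists_real_isNullCoframe (hH : H.SmoothOn Ω) (hΩ : IsOpen Ω) (hp : p ∈ Ω)
    (hpos : 0 < H.discr p) :
    ∃ r > 0, Metric.ball p r ⊆ Ω ∧
      ∃ η ζ : Plane → Fin 2 → ℝ, IsNullCoframe (Metric.ball p r) H η ζ := by
  obtain ⟨σ, hσ, hσp⟩ : ∃ σ : ℝ, σ ^ 2 = 1 ∧ H.b p + σ * √(H.discr p) ≠ 0 := by
    have := Real.sqrt_pos.2 hpos
    rcases le_or_gt 0 (H.b p) with hb | hb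
    · exact ⟨1, by norm_num, by positivity⟩
    · exact ⟨-1, by norm_num, by linarith⟩
  have := hH.b.continuousOn
  have := hH.discr.continuousOn
  obtain ⟨r, hr, hsub, hT⟩ := exists_ball_subset_preimage hΩ
    (f := fun q => (H.discr q, H.b q + σ * √(H.discr q))) (by fun_prop)
    (isOpen_Ioi.prod isOpen_ne) hp (show _ ∈ Ioi (0 : ℝ) ×ˢ {y : ℝ | y ≠ 0} from ⟨hpos, hσp⟩)
  have hdiscr (q) (hq : q ∈ Metric.ball p r) : 0 < H.discr q := (hT q hq).1
  have hσ₀ : σ ≠ 0 := by rintro rfl; norm_num at hσ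
  refine ⟨r, hr, hsub, _, _, .of_sqrt_discr (hH.mono hsub) (s := fun q => σ * √(H.discr q)) ?_
    (fun q hq => mul_ne_zero hσ₀ (Real.sqrt_pos.2 (hdiscr q hq)).ne') (fun q hq => ?_)
    (fun q hq => (hT q hq).2)⟩
  · exact contDiffOn_const.mul ((hH.discr.mono hsub).sqrt fun q hq => (hdiscr q hq).ne')
  · rw [mul_pow, hσ, one_mul, Real.sq_sqrt (hdiscr q hq).le]
    rfl

lemma exists_complex_isNullCoframe (hH : H.SmoothOn Ω) (hΩ : IsOpen Ω) (hp : p ∈ Ω)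
    (hneg : H.discr p < 0) :
    ∃ r > 0, Metric.ball p r ⊆ Ω ∧
      ∃ η ζ : Plane → Fin 2 → ℂ, IsNullCoframe (Metric.ball p r) H η ζ := by
  obtain ⟨r, hr, hsub, hT⟩ :=
    exists_ball_subset_preimage hΩ hH.discr.continuousOn isOpen_Iio hp hneg
  have hsqrt (q) (hq : q ∈ Metric.ball p r) : 0 < √(-H.discr q) :=
    Real.sqrt_pos.2 (neg_pos.2 (hT q hq))
  refine ⟨r, hr, hsub, _, _, .of_sqrt_discr (hH.mono hsub)
    (s := fun q => Complex.I * (√(-H.discr q) : ℝ)) ?_ (fun q hq => ?_) (fun q hq => ?_)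
    (fun q hq h₀ => ?_)⟩
  · exact contDiffOn_const.mul (Complex.ofRealCLM.contDiff.comp_contDiffOn
      ((hH.discr.mono hsub).neg.sqrt fun q hq => (neg_pos.2 (hT q hq)).ne'))
  · exact mul_ne_zero Complex.I_ne_zero (Complex.ofReal_ne_zero.2 (hsqrt q hq).ne')
  · rw [mul_pow, Complex.I_sq, ← Complex.ofReal_pow, Real.sq_sqrt (neg_pos.2 (hT q hq)).le]
    simp
  · exact (hsqrt q hq).ne' (by simpa using congrArg Complex.im h₀)

lemma exists_contDiffOn_sqrt {N : Plane → ℂ} (hΩ : IsOpen Ω) (hN : ContDiffOn ℝ ∞ N Ω) (hp : p ∈ Ω)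
    (hNp : N p ≠ 0) :
    ∃ r > 0, Metric.ball p r ⊆ Ω ∧ ∃ w : Plane → ℂ, ContDiffOn ℝ ∞ w (Metric.ball p r) ∧
      ∀ q ∈ Metric.ball p r, w q ≠ 0 ∧ w q ^ 2 = N q := by
  obtain ⟨r, hr, hsub, hslit⟩ := exists_ball_subset_preimage hΩ (f := fun q => N q / N p)
    (hN.continuousOn.div_const _) Complex.isOpen_slitPlane hp
    (by rw [div_self hNp]; exact Complex.one_mem_slitPlane)
  obtain ⟨c, hc⟩ := IsAlgClosed.exists_pow_nat_eq (N p) two_pos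
  have hc₀ : c ≠ 0 := by rintro rfl; exact hNp (by rw [← hc]; simp)
  refine ⟨r, hr, hsub, fun q => c * Complex.exp (Complex.log (N q / N p) / 2), ?_,
    fun q hq => ⟨mul_ne_zero hc₀ (Complex.exp_ne_zero _), ?_⟩⟩
  · have hlog : ContDiffOn ℝ ∞ (fun q => Complex.log (N q / N p)) (Metric.ball p r) :=
      fun q hq => ContDiffAt.comp_contDiffWithinAt (g := Complex.log) q
        ((Complex.contDiffAt_log (hslit q hq)).restrict_scalars ℝ)
        (((hN.mono hsub).div_const _) q hq)
    exact contDiffOn_const.mul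
      ((Complex.contDiff_exp (𝕜 := ℝ)).comp_contDiffOn (hlog.div_const 2))
  · rw [mul_pow, hc, ← Complex.exp_nat_mul, Nat.cast_ofNat, mul_div_cancel₀ _ two_ne_zero,
      Complex.exp_log (Complex.slitPlane_ne_zero (hslit q hq)), mul_div_cancel₀ _ hNp]

end LocalCoframes

/-! ### Local coordinates -/

section LocalCoordinates

variable {x y : Plane → ℝ} {Ω : Set Plane} {p q : Plane}

/-- The map of the plane with components `x` and `y`. -/
noncomputable def pairMap (x y : Plane → ℝ) (q : Plane) : Plane := !₂[x q, y q]

lemma contDiffOn_pairMap (hx : ContDiffOn ℝ ∞ x Ω) (hy : ContDiffOn ℝ ∞ y Ω) :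
    ContDiffOn ℝ ∞ (pairMap x y) Ω :=
  contDiffOn_euclidean.2 (Fin.forall_fin_two.2 ⟨hx, hy⟩)

lemma differentiableAt_pairMap (hx : DifferentiableAt ℝ x q) (hy : DifferentiableAt ℝ y q) :
    DifferentiableAt ℝ (pairMap x y) q :=
  differentiableAt_euclidean.2 (Fin.forall_fin_two.2 ⟨hx, hy⟩)

lemma fderiv_pairMap (hx : DifferentiableAt ℝ x q) (hy : DifferentiableAt ℝ y q) (v : Plane) :
    fderiv ℝ (pairMap x y) q v = !₂[fderiv ℝ x q v, fderiv ℝ y q v] := by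
  have component (i : Fin 2) : fderiv ℝ (fun q => pairMap x y q i) q v =
      fderiv ℝ (pairMap x y) q v i :=
    congrArg (fun L => L v) ((EuclideanSpace.proj i : Plane →L[ℝ] ℝ).hasFDerivAt.comp q
      (differentiableAt_pairMap hx hy).hasFDerivAt).fderiv
  ext i
  fin_cases i
  exacts [(component 0).symm, (component 1).symm]

lemma exists_equiv_hasFDerivAt_pairMap (hx : DifferentiableAt ℝ x q) (hy : DifferentiableAt ℝ y q)
    (hw : wedge (differential x q) (differential y q) ≠ 0) :
    ∃ L : Plane ≃L[ℝ] Plane, HasFDerivAt (pairMap x y) (L : Plane →L[ℝ] Plane) q := by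
  have hinj : Function.Injective (fderiv ℝ (pairMap x y) q : Plane →ₗ[ℝ] Plane) := by
    refine (injective_iff_map_eq_zero _).2 fun v (hv : fderiv ℝ (pairMap x y) q v = 0) => ?_
    rw [fderiv_pairMap hx hy] at hv
    have hxv : fderiv ℝ x q v = 0 := congrArg (fun w : Plane => w 0) hv
    have hyv : fderiv ℝ y q v = 0 := congrArg (fun w : Plane => w 1) hv
    rw [fderiv_apply_eq_sum_pd, Fin.sum_univ_two, smul_eq_mul, smul_eq_mul] at hxv hyv
    simp only [wedge, differential] at hw
    ext i
    refine (mul_eq_zero.1 ?_).resolve_left hw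
    fin_cases i
    · change _ * v 0 = 0
      linear_combination pd 1 y q * hxv - pd 1 x q * hyv
    · change _ * v 1 = 0
      linear_combination pd 0 x q * hyv - pd 0 y q * hxv
  exact ⟨(LinearEquiv.ofInjectiveEndo _ hinj).toContinuousLinearEquiv,
    (differentiableAt_pairMap hx hy).hasFDerivAt⟩

lemma exists_restrict_target_ball {E F : Type*} [TopologicalSpace E] [PseudoMetricSpace F]
    (e : OpenPartialHomeomorph E F) {p : E} (hp : p ∈ e.source) :
    ∃ e' : OpenPartialHomeomorph E F, ∃ r > 0, e'.source ⊆ e.source ∧ p ∈ e'.source ∧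
      ⇑e' = e ∧ e'.target = Metric.ball (e p) r := by
  obtain ⟨r, hr, hball⟩ := Metric.isOpen_iff.1 e.open_target _ (e.map_source hp)
  refine ⟨e.restrOpen (e.source ∩ e ⁻¹' Metric.ball (e p) r)
    (e.isOpen_inter_preimage Metric.isOpen_ball), r, hr, inter_subset_left,
    ⟨hp, hp, Metric.mem_ball_self hr⟩, rfl, ?_⟩
  refine Subset.antisymm (fun z hz => ?_) fun z hz => ⟨hball hz, e.map_target (hball hz), ?_⟩
  · have : e (e.symm z) ∈ Metric.ball (e p) r := hz.2.2
    rwa [e.right_inv hz.1] at this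
  · rwa [mem_preimage, e.right_inv (hball hz)]

theorem exists_openPartialHomeomorph_pairMap (hΩ : IsOpen Ω) (hx : ContDiffOn ℝ ∞ x Ω)
    (hy : ContDiffOn ℝ ∞ y Ω) (hp : p ∈ Ω)
    (hw : wedge (differential x p) (differential y p) ≠ 0) :
    ∃ e : OpenPartialHomeomorph Plane Plane, ∃ r > 0, e.source ⊆ Ω ∧ p ∈ e.source ∧
      ⇑e = pairMap x y ∧ e.target = Metric.ball (pairMap x y p) r ∧
      ContDiffOn ℝ ∞ e.symm e.target := by
  set Ω' : Set Plane := {q ∈ Ω | wedge (differential x q) (differential y q) ≠ 0}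
  have hΩ' : IsOpen Ω' := by
    have := continuousOn_pi.1 (contDiffOn_differential hx hΩ).continuousOn
    have := continuousOn_pi.1 (contDiffOn_differential hy hΩ).continuousOn
    have hwedge : ContinuousOn (fun q => wedge (differential x q) (differential y q)) Ω := by
      unfold wedge
      fun_prop
    exact hwedge.isOpen_inter_preimage hΩ isOpen_compl_singleton
  have smoothAt {q} (hq : q ∈ Ω') : ContDiffAt ℝ ∞ (pairMap x y) q :=
    (contDiffOn_pairMap hx hy).contDiffAt (hΩ.mem_nhds hq.1)
  have invertible {q} (hq : q ∈ Ω') := exists_equiv_hasFDerivAt_pairMap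
    (differentiableAt_of_contDiffOn hx hΩ hq.1) (differentiableAt_of_contDiffOn hy hΩ hq.1) hq.2
  have hp' : p ∈ Ω' := ⟨hp, hw⟩
  obtain ⟨L, hL⟩ := invertible hp'
  have hne : (∞ : WithTop ℕ∞) ≠ 0 := by simp
  obtain ⟨e, r, hr, hsource, hpe, he, htarget⟩ := exists_restrict_target_ball
    (((smoothAt hp').toOpenPartialHomeomorph (pairMap x y) hL hne).restrOpen Ω' hΩ')
    ⟨(smoothAt hp').mem_toOpenPartialHomeomorph_source hL hne, hp'⟩
  have hsub : e.source ⊆ Ω' := hsource.trans inter_subset_right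
  refine ⟨e, r, hr, fun q hq => (hsub hq).1, hpe, he, htarget, fun q hq => ?_⟩
  have hq' := hsub (e.map_target hq)
  obtain ⟨L', hL'⟩ := invertible hq'
  rw [← show ⇑e = pairMap x y from he] at hL'
  exact (e.contDiffAt_symm hq hL' (he ▸ smoothAt hq')).contDiffWithinAt

end LocalCoordinates

section Charts

variable {M : Type*} [TopologicalSpace M] [ChartedSpace Plane M]
  {φ : OpenPartialHomeomorph M Plane} {q : Plane}

/-- The derivative at `p` of the chart `φ`, read as a vector of the plane. -/
noncomputable def chartDeriv (φ : OpenPartialHomeomorph M Plane) (p : M) :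
    TangentSpace (𝓡 2) p →L[ℝ] Plane :=
  mfderiv (𝓡 2) (𝓡 2) φ p

lemma mdifferentiable_of_mem_maximalAtlas (hφ : φ ∈ IsManifold.maximalAtlas (𝓡 2) ∞ M) :
    φ.MDifferentiable (𝓡 2) (𝓡 2) :=
  ⟨(contMDiffOn_of_mem_maximalAtlas hφ).mdifferentiableOn (by simp),
    (contMDiffOn_symm_of_mem_maximalAtlas hφ).mdifferentiableOn (by simp)⟩

lemma covec_apply (φ : OpenPartialHomeomorph M Plane) (q P : Plane)
    (w : TangentSpace (𝓡 2) (φ.symm q)) : covec φ q P w =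
      P 0 * chartDeriv φ (φ.symm q) w 0 + P 1 * chartDeriv φ (φ.symm q) w 1 := by
  simp only [covec, Fin.sum_univ_two, LinearMap.add_apply, LinearMap.smul_apply, smul_eq_mul]
  rfl

lemma chartDeriv_tangentVec (hφ : φ ∈ IsManifold.maximalAtlas (𝓡 2) ∞ M) (hq : q ∈ φ.target)
    (v : Plane) : chartDeriv φ (φ.symm q) (tangentVec φ q v) = v :=
  congrArg (fun L => L v) ((mdifferentiable_of_mem_maximalAtlas hφ).comp_symm_deriv hq)

lemma tangentVec_chartDeriv (hφ : φ ∈ IsManifold.maximalAtlas (𝓡 2) ∞ M) (hq : q ∈ φ.target)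
    (w : TangentSpace (𝓡 2) (φ.symm q)) :
    tangentVec φ q (chartDeriv φ (φ.symm q) w) = w := by
  have h := (mdifferentiable_of_mem_maximalAtlas hφ).symm_comp_deriv (φ.map_target hq)
  rw [φ.right_inv hq] at h
  exact congrArg (fun L => L w) h

lemma covec_tangentVec (hφ : φ ∈ IsManifold.maximalAtlas (𝓡 2) ∞ M) (hq : q ∈ φ.target)
    (P v : Plane) : covec φ q P (tangentVec φ q v) = P 0 * v 0 + P 1 * v 1 := by
  rw [covec_apply, chartDeriv_tangentVec hφ hq]

lemma tangentVec_eq_add (φ : OpenPartialHomeomorph M Plane) (q v : Plane) : tangentVec φ q v =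
    v 0 • tangentVec φ q (EuclideanSpace.single 0 1) +
      v 1 • tangentVec φ q (EuclideanSpace.single 1 1) := by
  have hv : v = v 0 • EuclideanSpace.single 0 1 + v 1 • EuclideanSpace.single 1 1 := by
    ext i
    fin_cases i <;> simp
  let L : Plane →L[ℝ] TangentSpace (𝓡 2) (φ.symm q) := mfderiv (𝓡 2) (𝓡 2) φ.symm q
  change L v = v 0 • L _ + v 1 • L _
  rw [← map_smul, ← map_smul, ← map_add, ← hv]

lemma covec_surjective (hφ : φ ∈ IsManifold.maximalAtlas (𝓡 2) ∞ M) (hq : q ∈ φ.target) :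
    Function.Surjective (covec φ q) := by
  intro ξ
  refine ⟨!₂[ξ (tangentVec φ q (EuclideanSpace.single 0 1)),
    ξ (tangentVec φ q (EuclideanSpace.single 1 1))], LinearMap.ext fun w => ?_⟩
  rw [← tangentVec_chartDeriv hφ hq w]
  set v := chartDeriv φ (φ.symm q) w
  rw [covec_tangentVec hφ hq, tangentVec_eq_add φ q v, map_add, map_smul, map_smul, smul_eq_mul,
    smul_eq_mul, mul_comm (v 0), mul_comm (v 1)]
  rfl

/-! ### Quadratic functions in a chart -/

/-- The expression of a function quadratic in the momenta in the canonical coordinates of `φ`, with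
coefficients recovered from its values at `p_x`, `p_y` and `p_x + p_y`. -/
noncomputable def momentumForm (F : CotangentFunction M) (φ : OpenPartialHomeomorph M Plane) :
    MomentumForm where
  a q := inCoords F φ q !₂[1, 0]
  b q := inCoords F φ q !₂[1, 1] - inCoords F φ q !₂[1, 0] - inCoords F φ q !₂[0, 1]
  c q := inCoords F φ q !₂[0, 1]

namespace IsQuadraticInMomenta

variable {F : CotangentFunction M}

lemma inCoords_eq (hF : IsQuadraticInMomenta F) (hφ : φ ∈ IsManifold.maximalAtlas (𝓡 2) ∞ M)
    (hq : q ∈ φ.target) (P : Plane) :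
    inCoords F φ q P = (momentumForm F φ).eval q P.ofLp := by
  obtain ⟨a, b, c, -, -, -, h⟩ := hF φ hφ
  have h' := h q hq
  simp only [MomentumForm.eval, momentumForm, h', smul_eq_mul, Matrix.cons_val_zero,
    Matrix.cons_val_one]
  ring

lemma smoothOn (hF : IsQuadraticInMomenta F) (hφ : φ ∈ IsManifold.maximalAtlas (𝓡 2) ∞ M) :
    (momentumForm F φ).SmoothOn φ.target := by
  obtain ⟨a, b, c, ha, hb, hc, h⟩ := hF φ hφ
  have smooth (P : Plane) : ContDiffOn ℝ ∞ (fun q => inCoords F φ q P) φ.target :=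
    (((ha.mul contDiffOn_const).add (hb.mul contDiffOn_const)).add
      (hc.mul contDiffOn_const)).congr fun q hq => h q hq P
  exact ⟨smooth _, ((smooth _).sub (smooth _)).sub (smooth _), smooth _⟩

end IsQuadraticInMomenta

namespace PseudoRiemannianMetric

variable (g : PseudoRiemannianMetric M)

/-- The coefficients `g_{ij}` of the metric in the chart `φ`. -/
noncomputable def gram (φ : OpenPartialHomeomorph M Plane) (i j : Fin 2) (q : Plane) : ℝ :=
  g.form (φ.symm q) (tangentVec φ q (EuclideanSpace.single i 1))
    (tangentVec φ q (EuclideanSpace.single j 1))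

/-- The determinant of the metric in the chart `φ`. -/
noncomputable def gramDet (φ : OpenPartialHomeomorph M Plane) (q : Plane) : ℝ :=
  g.gram φ 0 0 q * g.gram φ 1 1 q - g.gram φ 0 1 q ^ 2

lemma form_tangentVec (φ : OpenPartialHomeomorph M Plane) (q v w : Plane) :
    g.form (φ.symm q) (tangentVec φ q v) (tangentVec φ q w) = v 0 * w 0 * g.gram φ 0 0 q +
      (v 0 * w 1 + v 1 * w 0) * g.gram φ 0 1 q + v 1 * w 1 * g.gram φ 1 1 q := by
  have hsymm : g.gram φ 1 0 q = g.gram φ 0 1 q := (g.symm (φ.symm q)).eq _ _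
  rw [tangentVec_eq_add φ q v, tangentVec_eq_add φ q w]
  simp only [map_add, map_smul, LinearMap.add_apply, LinearMap.smul_apply, smul_eq_mul]
  simp only [gram] at hsymm ⊢
  rw [hsymm]
  ring

lemma gramDet_ne_zero (hφ : φ ∈ IsManifold.maximalAtlas (𝓡 2) ∞ M) (hq : q ∈ φ.target) :
    g.gramDet φ q ≠ 0 := by
  intro h₀
  rw [gramDet] at h₀
  have eq_zero_of_orthogonal (v : Plane) (hv : ∀ w : Plane, v 0 * w 0 * g.gram φ 0 0 q +
      (v 0 * w 1 + v 1 * w 0) * g.gram φ 0 1 q + v 1 * w 1 * g.gram φ 1 1 q = 0) : v = 0 := by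
    have hker : tangentVec φ q v = 0 := by
      refine (g.nondegenerate (φ.symm q)).1 _ fun w => ?_
      rw [← tangentVec_chartDeriv hφ hq w, form_tangentVec]
      exact hv _
    rw [← chartDeriv_tangentVec hφ hq v, hker, map_zero]
  have h₁ := eq_zero_of_orthogonal !₂[g.gram φ 1 1 q, -g.gram φ 0 1 q] fun w => by
    simp only [Matrix.cons_val_zero, Matrix.cons_val_one]
    linear_combination w 0 * h₀
  have h₂ := eq_zero_of_orthogonal !₂[-g.gram φ 0 1 q, g.gram φ 0 0 q] fun w => by
    simp only [Matrix.cons_val_zero, Matrix.cons_val_one]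
    linear_combination w 1 * h₀
  have h₁₁ : g.gram φ 1 1 q = 0 := congrArg (fun v : Plane => v 0) h₁
  have h₀₁ : -g.gram φ 0 1 q = 0 := congrArg (fun v : Plane => v 1) h₁
  have h₀₀ : g.gram φ 0 0 q = 0 := congrArg (fun v : Plane => v 1) h₂
  have h := eq_zero_of_orthogonal !₂[1, 0] fun w => by simp [h₀₀, neg_eq_zero.1 h₀₁, h₁₁]
  exact one_ne_zero (congrArg (fun v : Plane => v 0) h)

lemma inCoords_hamiltonian (hφ : φ ∈ IsManifold.maximalAtlas (𝓡 2) ∞ M) (hq : q ∈ φ.target)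
    (P : Plane) : inCoords g.hamiltonian φ q P =
      g.gram φ 1 1 q / (2 * g.gramDet φ q) * P 0 ^ 2 +
        -g.gram φ 0 1 q / g.gramDet φ q * (P 0 * P 1) +
        g.gram φ 0 0 q / (2 * g.gramDet φ q) * P 1 ^ 2 := by
  have hdet := g.gramDet_ne_zero hφ hq
  have hdef : g.gramDet φ q = g.gram φ 0 0 q * g.gram φ 1 1 q - g.gram φ 0 1 q ^ 2 := rfl
  set D := g.gramDet φ q
  set w : Plane := !₂[(g.gram φ 1 1 q * P 0 - g.gram φ 0 1 q * P 1) / D,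
    (g.gram φ 0 0 q * P 1 - g.gram φ 0 1 q * P 0) / D]
  have hw₀ : w 0 = (g.gram φ 1 1 q * P 0 - g.gram φ 0 1 q * P 1) / D := rfl
  have hw₁ : w 1 = (g.gram φ 0 0 q * P 1 - g.gram φ 0 1 q * P 0) / D := rfl
  have hflat : (g.form (φ.symm q)).toDual (g.nondegenerate _) (tangentVec φ q w) =
      covec φ q P := by
    refine LinearMap.ext fun u => ?_
    rw [← tangentVec_chartDeriv hφ hq u, LinearMap.BilinForm.toDual_def, form_tangentVec,
      covec_tangentVec hφ hq, hw₀, hw₁]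
    set v := chartDeriv φ (φ.symm q) u
    field_simp
    linear_combination -(P 0 * v 0 + P 1 * v 1) * hdef
  rw [inCoords, hamiltonian, ← hflat, LinearEquiv.symm_apply_apply, hflat, covec_tangentVec hφ hq,
    hw₀, hw₁]
  field_simp
  ring

lemma isQuadraticInMomenta_hamiltonian : IsQuadraticInMomenta g.hamiltonian := by
  intro φ hφ
  have smooth (i j : Fin 2) : ContDiffOn ℝ ∞ (g.gram φ i j) φ.target := g.smooth φ hφ i j
  have hdet : ContDiffOn ℝ ∞ (g.gramDet φ) φ.target :=
    ((smooth 0 0).mul (smooth 1 1)).sub ((smooth 0 1).pow 2)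
  have hne (q) (hq : q ∈ φ.target) := g.gramDet_ne_zero hφ hq
  have hne₂ (q) (hq : q ∈ φ.target) : 2 * g.gramDet φ q ≠ 0 := mul_ne_zero two_ne_zero (hne q hq)
  exact ⟨_, _, _, (smooth 1 1).div (contDiffOn_const.mul hdet) hne₂, (smooth 0 1).neg.div hdet hne,
    (smooth 0 0).div (contDiffOn_const.mul hdet) hne₂,
    fun q hq P => g.inCoords_hamiltonian hφ hq P⟩

end PseudoRiemannianMetric

/-- The quadratic form on tangent vectors with matrix `2⁻¹ H⁻¹`, that is, the metric with kinetic
energy `H`. -/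
noncomputable def MomentumForm.lineElement (H : MomentumForm) (q v : Plane) : ℝ :=
  2 * (H.c q * v 0 ^ 2 - H.b q * (v 0 * v 1) + H.a q * v 1 ^ 2) / -H.discr q

namespace PseudoRiemannianMetric

variable (g : PseudoRiemannianMetric M)

lemma momentumForm_hamiltonian (hφ : φ ∈ IsManifold.maximalAtlas (𝓡 2) ∞ M) (hq : q ∈ φ.target) :
    (momentumForm g.hamiltonian φ).a q = g.gram φ 1 1 q / (2 * g.gramDet φ q) ∧
    (momentumForm g.hamiltonian φ).b q = -g.gram φ 0 1 q / g.gramDet φ q ∧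
    (momentumForm g.hamiltonian φ).c q = g.gram φ 0 0 q / (2 * g.gramDet φ q) := by
  simp only [momentumForm, g.inCoords_hamiltonian hφ hq, Matrix.cons_val_zero, Matrix.cons_val_one]
  refine ⟨?_, ?_, ?_⟩ <;> ring

lemma discr_momentumForm_hamiltonian (hφ : φ ∈ IsManifold.maximalAtlas (𝓡 2) ∞ M)
    (hq : q ∈ φ.target) : (momentumForm g.hamiltonian φ).discr q = -(g.gramDet φ q)⁻¹ := by
  obtain ⟨ha, hb, hc⟩ := g.momentumForm_hamiltonian hφ hq
  have hdet := g.gramDet_ne_zero hφ hq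
  rw [MomentumForm.discr, ha, hb, hc]
  field_simp
  rw [gramDet]
  ring

lemma lineElement_eq (hφ : φ ∈ IsManifold.maximalAtlas (𝓡 2) ∞ M) (hq : q ∈ φ.target) (v : Plane) :
    g.lineElement φ q v = (momentumForm g.hamiltonian φ).lineElement q v := by
  obtain ⟨ha, hb, hc⟩ := g.momentumForm_hamiltonian hφ hq
  have hdet := g.gramDet_ne_zero hφ hq
  rw [MomentumForm.lineElement, g.discr_momentumForm_hamiltonian hφ hq, ha, hb, hc, lineElement,
    form_tangentVec]
  field_simp
  ring

variable {g} in
theorem IsIntegral.isKillingPair {F : CotangentFunction M} (hI : g.IsIntegral F)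
    (hF : IsQuadraticInMomenta F) (hφ : φ ∈ IsManifold.maximalAtlas (𝓡 2) ∞ M) :
    IsKillingPair φ.target (momentumForm g.hamiltonian φ) (momentumForm F φ) := by
  have hH := g.isQuadraticInMomenta_hamiltonian
  refine ⟨φ.open_target, hH.smoothOn hφ, hF.smoothOn hφ, fun q hq => ?_,
    fun q hq => .of_bracket_eq_zero fun P => ?_⟩
  · rw [g.discr_momentumForm_hamiltonian hφ hq]
    exact neg_ne_zero.2 (inv_ne_zero (g.gramDet_ne_zero hφ hq))
  · have hbracket := MomentumForm.poissonBracket_eval φ.open_target (hH.smoothOn hφ)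
      (hF.smoothOn hφ) hq (WithLp.toLp 2 P)
    rw [← hI φ hφ q hq (WithLp.toLp 2 P), ← hbracket]
    have fderiv_eq {G : CotangentFunction M} (hG : IsQuadraticInMomenta G) (P : Plane) :
        fderiv ℝ (fun q => (momentumForm G φ).eval q P.ofLp) q =
          fderiv ℝ (fun q => inCoords G φ q P) q :=
      Filter.EventuallyEq.fderiv_eq (Filter.eventually_of_mem (φ.open_target.mem_nhds hq)
        fun x hx => (hG.inCoords_eq hφ hx P).symm)
    simp only [poissonBracket, fderiv_eq hH, fderiv_eq hF, hH.inCoords_eq hφ hq,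
      hF.inCoords_eq hφ hq]

end PseudoRiemannianMetric

/-! ### Change of coordinates -/

/-- `φ'` is a smooth chart whose coordinates are `x` and `y`, given as functions of the coordinates
of `φ`; `τ` is the transition map from `φ'` to `φ`. -/
structure IsCoordinateChange (φ φ' : OpenPartialHomeomorph M Plane) (Ω : Set Plane)
    (x y : Plane → ℝ) (τ : Plane → Plane) : Prop where
  mem_maximalAtlas : φ' ∈ IsManifold.maximalAtlas (𝓡 2) ∞ M
  mapsTo : MapsTo τ φ'.target Ω
  fst_eq : ∀ q ∈ φ'.target, x (τ q) = q 0
  symm_eq : ∀ q ∈ φ'.target, φ'.symm q = φ.symm (τ q)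
  inCoords_eq : ∀ q ∈ φ'.target, ∀ (F : CotangentFunction M) (P : Plane), inCoords F φ' q P =
    inCoords F φ (τ q) (WithLp.toLp 2 (P 0 • differential x (τ q) + P 1 • differential y (τ q)))

lemma trans_mem_maximalAtlas [IsManifold (𝓡 2) ∞ M]
    (hφ : φ ∈ IsManifold.maximalAtlas (𝓡 2) ∞ M) {e : OpenPartialHomeomorph Plane Plane}
    (he : ContDiffOn ℝ ∞ e e.source) (he' : ContDiffOn ℝ ∞ e.symm e.target) :
    φ.trans e ∈ IsManifold.maximalAtlas (𝓡 2) ∞ M := by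
  refine (IsManifold.mem_maximalAtlas_iff_contMDiffOn _).2 ⟨?_, ?_⟩
  · exact (contMDiffOn_iff_contDiffOn.2 he).comp
      ((contMDiffOn_of_mem_maximalAtlas hφ).mono inter_subset_left) inter_subset_right
  · exact (contMDiffOn_symm_of_mem_maximalAtlas hφ).comp
      ((contMDiffOn_iff_contDiffOn.2 he').mono inter_subset_left) inter_subset_right

lemma chartDeriv_trans (hφ : φ ∈ IsManifold.maximalAtlas (𝓡 2) ∞ M)
    {e : OpenPartialHomeomorph Plane Plane} (hq : q ∈ φ.target) (he : DifferentiableAt ℝ e q)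
    (w : TangentSpace (𝓡 2) (φ.symm q)) : chartDeriv (φ.trans e) (φ.symm q) w =
      fderiv ℝ e q (chartDeriv φ (φ.symm q) w) := by
  rw [← φ.right_inv hq] at he
  have h := mfderiv_comp (φ.symm q) he.mdifferentiableAt
    ((mdifferentiable_of_mem_maximalAtlas hφ).mdifferentiableAt (φ.map_target hq))
  rw [mfderiv_eq_fderiv, φ.right_inv hq] at h
  exact congrArg (fun L => L w) h

lemma inCoords_trans (hφ : φ ∈ IsManifold.maximalAtlas (𝓡 2) ∞ M)
    {e : OpenPartialHomeomorph Plane Plane} {x y : Plane → ℝ} (he : ⇑e = pairMap x y)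
    (hq : e.symm q ∈ φ.target) (hx : DifferentiableAt ℝ x (e.symm q))
    (hy : DifferentiableAt ℝ y (e.symm q)) (F : CotangentFunction M) (P : Plane) :
    inCoords F (φ.trans e) q P = inCoords F φ (e.symm q)
      (WithLp.toLp 2 (P 0 • differential x (e.symm q) + P 1 • differential y (e.symm q))) := by
  refine congrArg (F (φ.symm (e.symm q))) (LinearMap.ext fun w => ?_)
  have hderiv := chartDeriv_trans hφ hq (he ▸ differentiableAt_pairMap hx hy) w
  rw [he, fderiv_pairMap hx hy] at hderiv
  refine (covec_apply (φ.trans e) q P w).trans (Eq.trans ?_ (covec_apply φ (e.symm q) _ w).symm)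
  refine (congrArg (fun v : Plane => P 0 * v 0 + P 1 * v 1) hderiv).trans ?_
  simp only [fderiv_apply_eq_sum_pd, Fin.sum_univ_two, smul_eq_mul, differential,
    Matrix.cons_val_zero, Matrix.cons_val_one, Pi.add_apply, Pi.smul_apply]
  ring

theorem exists_isCoordinateChange [IsManifold (𝓡 2) ∞ M]
    (hφ : φ ∈ IsManifold.maximalAtlas (𝓡 2) ∞ M) {Ω : Set Plane} (hΩ : IsOpen Ω)
    (hΩφ : Ω ⊆ φ.target) {x y : Plane → ℝ} (hx : ContDiffOn ℝ ∞ x Ω) (hy : ContDiffOn ℝ ∞ y Ω)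
    {p : Plane} (hp : p ∈ Ω) (hw : wedge (differential x p) (differential y p) ≠ 0) :
    ∃ φ' τ, IsCoordinateChange φ φ' Ω x y τ ∧ φ.symm p ∈ φ'.source ∧
      ∃ r > 0, φ'.target = Metric.ball (pairMap x y p) r := by
  obtain ⟨e, r, hr, hsource, hpe, he, htarget, hsymm⟩ :=
    exists_openPartialHomeomorph_pairMap hΩ hx hy hp hw
  have hmap : e.target ⊆ e.symm ⁻¹' φ.target := fun q hq => hΩφ (hsource (e.map_target hq))
  have htrans : (φ.trans e).target = e.target := inter_eq_left.2 hmap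
  have hright {q} (hq : q ∈ e.target) : pairMap x y (e.symm q) = q := he ▸ e.right_inv hq
  have hsmooth : ContDiffOn ℝ ∞ e e.source := he ▸ (contDiffOn_pairMap hx hy).mono hsource
  refine ⟨φ.trans e, e.symm, ⟨trans_mem_maximalAtlas hφ hsmooth hsymm, ?_, ?_, ?_, ?_⟩,
    ⟨φ.map_target (hΩφ hp), ?_⟩, r, hr, htrans.trans htarget⟩
  · exact fun q hq => hsource (e.map_target (htrans ▸ hq))
  · exact fun q hq => congrArg (fun v : Plane => v 0) (hright (htrans ▸ hq))
  · exact fun q _ => rfl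
  · intro q hq
    have hq' := hsource (e.map_target (htrans ▸ hq))
    exact inCoords_trans hφ he (hΩφ hq') (differentiableAt_of_contDiffOn hx hΩ hq')
      (differentiableAt_of_contDiffOn hy hΩ hq')
  · change φ (φ.symm p) ∈ e.source
    rwa [φ.right_inv (hΩφ hp)]

namespace IsCoordinateChange

variable {φ' : OpenPartialHomeomorph M Plane} {Ω : Set Plane} {x y : Plane → ℝ} {τ : Plane → Plane}

lemma left_inv (h : IsCoordinateChange φ φ' Ω x y τ) (hΩφ : Ω ⊆ φ.target) (hq : q ∈ Ω)
    (hqs : φ.symm q ∈ φ'.source) : τ (φ' (φ.symm q)) = q := by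
  have ht := φ'.map_source hqs
  exact φ.symm.injOn (hΩφ (h.mapsTo ht)) (hΩφ hq)
    ((h.symm_eq _ ht).symm.trans (φ'.left_inv hqs))

lemma momentumForm_eq (h : IsCoordinateChange φ φ' Ω x y τ)
    (hφ : φ ∈ IsManifold.maximalAtlas (𝓡 2) ∞ M) (hΩφ : Ω ⊆ φ.target) {F : CotangentFunction M}
    (hF : IsQuadraticInMomenta F) (hq : q ∈ φ'.target) :
    (momentumForm F φ').a q = (momentumForm F φ).eval (τ q) (differential x (τ q)) ∧
    (momentumForm F φ').b q =
      (momentumForm F φ).polar (τ q) (differential x (τ q)) (differential y (τ q)) ∧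
    (momentumForm F φ').c q = (momentumForm F φ).eval (τ q) (differential y (τ q)) := by
  have hP (P : Plane) := (h.inCoords_eq q hq F P).trans (hF.inCoords_eq hφ (hΩφ (h.mapsTo hq)) _)
  simp only [momentumForm] at hP ⊢
  simp only [hP, MomentumForm.eval, MomentumForm.polar, MomentumForm.grad, smul_eq_mul,
    Matrix.cons_val_zero, Matrix.cons_val_one, Pi.add_apply, Pi.smul_apply, zero_mul, one_mul,
    add_zero, zero_add, true_and, and_true]
  ring

lemma eval_momentumForm (h : IsCoordinateChange φ φ' Ω x y τ)
    (hφ : φ ∈ IsManifold.maximalAtlas (𝓡 2) ∞ M) (hΩφ : Ω ⊆ φ.target) {F : CotangentFunction M}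
    (hF : IsQuadraticInMomenta F) (hq : q ∈ φ'.target) (P : Fin 2 → ℝ) :
    (momentumForm F φ').eval q P = (momentumForm F φ).eval (τ q)
      (P 0 • differential x (τ q) + P 1 • differential y (τ q)) := by
  obtain ⟨ha, hb, hc⟩ := h.momentumForm_eq hφ hΩφ hF hq
  rw [MomentumForm.eval_smul_add_smul, ← ha, ← hb, ← hc]
  simp only [MomentumForm.eval, smul_eq_mul]
  ring

end IsCoordinateChange

end Charts

/-! ### Recognising the normal forms -/

namespace IsKillingPair

variable {Ω : Set Plane} {H F : MomentumForm} {p : Plane} {r : ℝ}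

section Liouville

variable {s : ℝ}

lemma left_a_ne_zero (h : IsKillingPair Ω H F) (hHb : ∀ q ∈ Ω, H.b q = 0)
    (hHc : ∀ q ∈ Ω, H.c q = s * H.a q) {q : Plane} (hq : q ∈ Ω) : H.a q ≠ 0 := fun h₀ =>
  h.discr_ne q hq (by rw [MomentumForm.discr, hHb q hq, hHc q hq, h₀]; ring)

lemma liouville_equations (h : IsKillingPair Ω H F) (hHb : ∀ q ∈ Ω, H.b q = 0)
    (hHc : ∀ q ∈ Ω, H.c q = s * H.a q) (hFb : ∀ q ∈ Ω, F.b q = 0)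
    (hFc : ∀ q ∈ Ω, F.c q = 1 + s * F.a q) {q : Plane} (hq : q ∈ Ω) :
    pd 1 (fun x => F.c x / (2 * H.a x)) q = 0 ∧
      pd 0 (fun x => s * F.a x / (2 * H.a x)) q = 0 := by
  have hA := mul_ne_zero two_ne_zero (h.left_a_ne_zero hHb hHc hq)
  have dA := differentiableAt_of_contDiffOn h.smooth_left.a h.isOpen hq
  have da := differentiableAt_of_contDiffOn h.smooth_right.a h.isOpen hq
  have dc := differentiableAt_of_contDiffOn h.smooth_right.c h.isOpen hq
  have e₁ : pd 1 F.c q = s * pd 1 F.a q := by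
    rw [pd_congr hFc h.isOpen hq, pd_add (by fun_prop) (by fun_prop), pd_const, zero_add,
      pd_const_mul da]
  have eB (i) : pd i H.b q = 0 := (pd_congr hHb h.isOpen hq i).trans (pd_const 0)
  have eb (i) : pd i F.b q = 0 := (pd_congr hFb h.isOpen hq i).trans (pd_const 0)
  obtain ⟨hxxx, hxxy, -, -⟩ := h.commute q hq
  rw [hHb q hq, hFb q hq] at hxxx
  rw [eB, eB, eb, eb, hHb q hq, hFb q hq, hFc q hq, hHc q hq] at hxxy
  constructor
  · rw [pd_div dc (by fun_prop) hA, pd_const_mul dA, e₁, hFc q hq, div_eq_zero_iff]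
    left
    linear_combination -hxxy
  · rw [pd_div (by fun_prop) (by fun_prop) hA, pd_const_mul dA, pd_const_mul da, div_eq_zero_iff]
    left
    linear_combination -s * hxxx

theorem isLiouville (h : IsKillingPair (Metric.ball p r) H F) (hs : s ^ 2 = 1)
    (hHb : ∀ q ∈ Metric.ball p r, H.b q = 0) (hHc : ∀ q ∈ Metric.ball p r, H.c q = s * H.a q)
    (hFb : ∀ q ∈ Metric.ball p r, F.b q = 0)
    (hFc : ∀ q ∈ Metric.ball p r, F.c q = 1 + s * F.a q) :
    IsLiouville s (Metric.ball p r) H.lineElement fun q P => F.eval q P.ofLp := by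
  have hA := fun {q : Plane} (hq : q ∈ Metric.ball p r) => h.left_a_ne_zero hHb hHc hq
  have h2A : ∀ q ∈ Metric.ball p r, 2 * H.a q ≠ 0 := fun q hq => mul_ne_zero two_ne_zero (hA hq)
  have hpd := fun {q : Plane} (hq : q ∈ Metric.ball p r) =>
    h.liouville_equations hHb hHc hFb hFc hq
  have smooth_den := (contDiffOn_const (c := (2 : ℝ))).mul h.smooth_left.a
  obtain ⟨X, hX, hXeq⟩ := exists_eq_comp_coordinate
    (f := fun x => F.c x / (2 * H.a x)) (i := 0) (h.smooth_right.c.div smooth_den h2A)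
    (Fin.forall_fin_two.2 ⟨fun h => absurd rfl h, fun _ x hx => (hpd hx).1⟩)
  obtain ⟨Y, hY, hYeq⟩ := exists_eq_comp_coordinate (i := 1)
    (f := fun x => s * F.a x / (2 * H.a x)) ((contDiffOn_const.mul h.smooth_right.a).div
      smooth_den h2A) (Fin.forall_fin_two.2 ⟨fun _ x hx => (hpd hx).2, fun h => absurd rfl h⟩)
  refine ⟨X, Y, hX, hY, fun q hq => ?_⟩
  have hAq := hA hq
  have hXY : F.c q / (2 * H.a q) - s * F.a q / (2 * H.a q) = 1 / (2 * H.a q) := by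
    rw [hFc q hq]
    ring
  rw [← hXeq q hq, ← hYeq q hq, hXY]
  refine ⟨one_div_ne_zero (h2A q hq), fun v => ?_, fun P => ?_⟩
  · have hs₀ : s ≠ 0 := by
      rintro rfl
      norm_num at hs
    rw [MomentumForm.lineElement, MomentumForm.discr, hHb q hq, hHc q hq]
    field_simp
    linear_combination (4 * H.a q ^ 2 * v 1 ^ 2) * hs
  · beta_reduce
    rw [MomentumForm.eval, hFb q hq, zero_smul, smul_eq_mul, smul_eq_mul]
    field_simp
    linear_combination (-P 0 ^ 2 * F.a q) * hs

end Liouville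

end IsKillingPair

section Null

variable {Ω : Set Plane} {H F : MomentumForm} {p : Plane} {r ε : ℝ}

/-- A Killing pair in coordinates which are null for `H` and on whose differentials `F` takes the
values `1` and `ε`. -/
structure IsNullNormalized (Ω : Set Plane) (H F : MomentumForm) (ε : ℝ) : Prop
    extends IsKillingPair Ω H F where
  left_a : ∀ q ∈ Ω, H.a q = 0
  left_c : ∀ q ∈ Ω, H.c q = 0
  right_a : ∀ q ∈ Ω, F.a q = 1
  right_c : ∀ q ∈ Ω, F.c q = ε

namespace IsNullNormalized

lemma left_b_ne_zero (h : IsNullNormalized Ω H F ε) {q : Plane} (hq : q ∈ Ω) : H.b q ≠ 0 :=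
  fun h₀ => h.discr_ne q hq (by rw [MomentumForm.discr, h.left_a q hq, h₀]; ring)

lemma lineElement_eq (h : IsNullNormalized Ω H F ε) {q : Plane} (hq : q ∈ Ω) (v : Plane) :
    H.lineElement q v = 2 / H.b q * (v 0 * v 1) := by
  have hB := h.left_b_ne_zero hq
  rw [MomentumForm.lineElement, MomentumForm.discr, h.left_a q hq, h.left_c q hq]
  field_simp
  ring

lemma contDiffOn_b_div_b (h : IsNullNormalized Ω H F ε) :
    ContDiffOn ℝ ∞ (fun q => F.b q / H.b q) Ω :=
  h.smooth_right.b.div h.smooth_left.b fun _ => h.left_b_ne_zero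

lemma contDiffOn_conformalFactor (h : IsNullNormalized Ω H F ε) :
    ContDiffOn ℝ ∞ (fun q => 2 / H.b q) Ω :=
  contDiffOn_const.div h.smooth_left.b fun _ => h.left_b_ne_zero

lemma pd_b_div_b (h : IsNullNormalized Ω H F ε) {q : Plane} (hq : q ∈ Ω) :
    pd 1 (fun x => F.b x / H.b x) q = -pd 0 (fun x => 2 / H.b x) q ∧
      pd 0 (fun x => F.b x / H.b x) q = -ε * pd 1 (fun x => 2 / H.b x) q := by
  have hB := h.left_b_ne_zero hq
  have dB := differentiableAt_of_contDiffOn h.smooth_left.b h.isOpen hq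
  have db := differentiableAt_of_contDiffOn h.smooth_right.b h.isOpen hq
  have eA (i) : pd i H.a q = 0 := (pd_congr h.left_a h.isOpen hq i).trans (pd_const 0)
  have eC (i) : pd i H.c q = 0 := (pd_congr h.left_c h.isOpen hq i).trans (pd_const 0)
  have ea (i) : pd i F.a q = 0 := (pd_congr h.right_a h.isOpen hq i).trans (pd_const 1)
  have ec (i) : pd i F.c q = 0 := (pd_congr h.right_c h.isOpen hq i).trans (pd_const ε)
  obtain ⟨-, hxxy, hxyy, -⟩ := h.commute q hq
  rw [eA, eA, ea, ea, h.left_a q hq, h.left_c q hq, h.right_a q hq] at hxxy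
  rw [eC, eC, ec, ec, h.left_a q hq, h.left_c q hq, h.right_c q hq] at hxyy
  simp only [pd_div db dB hB, pd_div (differentiableAt_const (2 : ℝ)) dB hB, pd_const]
  constructor
  · rw [← neg_div]
    congr 1
    linear_combination -hxxy
  · rw [← mul_div_assoc]
    congr 1
    linear_combination -hxyy

end IsNullNormalized

lemma differentiableOn_of_cauchyRiemann {u v : Plane → ℝ} (hΩ : IsOpen Ω)
    (hu : DifferentiableOn ℝ u Ω) (hv : DifferentiableOn ℝ v Ω)
    (h₀ : ∀ q ∈ Ω, pd 0 u q = pd 1 v q) (h₁ : ∀ q ∈ Ω, pd 1 u q = -pd 0 v q) :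
    DifferentiableOn ℂ (fun z => (⟨u !₂[z.re, z.im], v !₂[z.re, z.im]⟩ : ℂ))
      ((fun q : Plane => (⟨q 0, q 1⟩ : ℂ)) '' Ω) := by
  let L : ℂ →L[ℝ] Plane := Complex.reCLM.smulRight (EuclideanSpace.single 0 (1 : ℝ)) +
    Complex.imCLM.smulRight (EuclideanSpace.single 1 (1 : ℝ))
  have hL (z : ℂ) : (!₂[z.re, z.im] : Plane) = L z := by
    ext i
    fin_cases i <;> simp [L]
  have hL_one : L 1 = EuclideanSpace.single 0 1 := by simp [L]
  have hL_I : L Complex.I = EuclideanSpace.single 1 1 := by simp [L]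
  rintro _ ⟨q, hq, rfl⟩
  refine DifferentiableAt.differentiableWithinAt ?_
  have hLq : L ⟨q 0, q 1⟩ = q := by
    rw [← hL]
    ext i
    fin_cases i <;> rfl
  have comp {f : Plane → ℝ} (hf : DifferentiableOn ℝ f Ω) :
      HasFDerivAt (f ∘ L) ((fderiv ℝ f q).comp L) (⟨q 0, q 1⟩ : ℂ) :=
    HasFDerivAt.comp _ (hLq.symm ▸ (hf.differentiableAt (hΩ.mem_nhds hq)).hasFDerivAt)
      L.hasFDerivAt
  have hd := (Complex.ofRealCLM.hasFDerivAt.comp _ (comp hu)).add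
    ((ContinuousLinearMap.toSpanSingleton ℝ Complex.I).hasFDerivAt.comp _ (comp hv))
  have hd' : HasFDerivAt (fun z : ℂ => (⟨u !₂[z.re, z.im], v !₂[z.re, z.im]⟩ : ℂ)) _ _ :=
    hd.congr_of_eventuallyEq (.of_eq (funext fun z => Complex.ext (by simp [hL]) (by simp [hL])))
  rw [differentiableAt_complex_iff_differentiableAt_real]
  refine ⟨hd'.differentiableAt, ?_⟩
  have e₀ := h₀ q hq
  have e₁ := h₁ q hq
  simp only [pd] at e₀ e₁
  rw [hd'.fderiv]
  simp only [add_apply, ContinuousLinearMap.comp_apply, hL_one, hL_I, e₀, e₁]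
  apply Complex.ext <;> simp

namespace IsNullNormalized

theorem isComplexLiouville (h : IsNullNormalized Ω H F (-1)) :
    IsComplexLiouville Ω H.lineElement fun q P => F.eval q P.ofLp := by
  refine ⟨_, differentiableOn_of_cauchyRiemann h.isOpen
    (h.contDiffOn_b_div_b.differentiableOn (by simp))
    (h.contDiffOn_conformalFactor.differentiableOn (by simp))
    (fun q hq => by simpa using (h.pd_b_div_b hq).2) (fun q hq => (h.pd_b_div_b hq).1),
    fun q hq => ?_⟩
  have hB := h.left_b_ne_zero hq
  have hvec : (!₂[q 0, q 1] : Plane) = q := by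
    ext i
    fin_cases i <;> rfl
  simp only [hvec]
  refine ⟨div_ne_zero two_ne_zero hB, h.lineElement_eq hq, fun P => ?_⟩
  beta_reduce
  rw [MomentumForm.eval, h.right_a q hq, h.right_c q hq]
  simp only [smul_eq_mul]
  field_simp
  ring

lemma conformalFactor_add_eq_one (h : IsNullNormalized (Metric.ball p r) H F 0) (hp : p 0 = 0)
    (hB : ∀ q ∈ Metric.ball p r, q 0 = 0 → H.b q = 2) {q : Plane} (hq : q ∈ Metric.ball p r) :
    2 / H.b q + q 0 * pd 1 (fun x => F.b x / H.b x) q = 1 := by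
  have hu₁ := contDiffOn_pd h.contDiffOn_b_div_b h.isOpen 1
  have hu₀ (x) (hx : x ∈ Metric.ball p r) : pd 0 (fun x => F.b x / H.b x) x = 0 := by
    simpa using (h.pd_b_div_b hx).2
  have hX : ContDiff ℝ ∞ fun x : Plane => x 0 := by fun_prop
  have hsum : ContDiffOn ℝ ∞
      (fun x => 2 / H.b x + x 0 * pd 1 (fun x => F.b x / H.b x) x) (Metric.ball p r) :=
    h.contDiffOn_conformalFactor.add (hX.contDiffOn.mul hu₁)
  have hconst (x) (hx : x ∈ Metric.ball p r) :
      pd 0 (fun x => 2 / H.b x + x 0 * pd 1 (fun x => F.b x / H.b x) x) x = 0 := by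
    have d₁ := differentiableAt_of_contDiffOn h.contDiffOn_conformalFactor h.isOpen hx
    have d₂ := differentiableAt_of_contDiffOn hu₁ h.isOpen hx
    have dX : DifferentiableAt ℝ (fun x : Plane => x 0) x := by fun_prop
    have e : pd 0 (pd 1 fun x => F.b x / H.b x) x = 0 := by
      rw [pd_comm h.contDiffOn_b_div_b h.isOpen hx]
      exact (pd_congr hu₀ h.isOpen hx 1).trans (pd_const 0)
    rw [pd_add d₁ (dX.fun_mul d₂), pd_mul dX d₂, pd_coordinate, e, (h.pd_b_div_b hx).1]
    simp
  obtain ⟨w, -, hw⟩ := exists_eq_comp_coordinate hsum (i := 1)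
    (Fin.forall_fin_two.2 ⟨fun _ => hconst, fun h => absurd rfl h⟩)
  have hslice := add_single_mem_ball hq 1
  have e₀ : (p + (q 1 - p 1) • EuclideanSpace.single 1 (1 : ℝ)).ofLp 0 = 0 := by simp [hp]
  have e₁ : (p + (q 1 - p 1) • EuclideanSpace.single 1 (1 : ℝ)).ofLp 1 = q 1 := by simp
  have hw' := hw _ hslice
  rw [e₁, e₀, hB _ hslice e₀, zero_mul, add_zero, div_self two_ne_zero] at hw'
  rw [hw q hq, hw']

theorem isJordanBlock (h : IsNullNormalized (Metric.ball p r) H F 0) (hp : p 0 = 0)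
    (hB : ∀ q ∈ Metric.ball p r, q 0 = 0 → H.b q = 2) :
    IsJordanBlock (Metric.ball p r) H.lineElement fun q P => F.eval q P.ofLp := by
  obtain ⟨X, hX, hXeq⟩ := exists_eq_comp_coordinate h.contDiffOn_b_div_b (i := 1)
    (Fin.forall_fin_two.2 ⟨fun _ x hx => by simpa using (h.pd_b_div_b hx).2, fun h => absurd rfl h⟩)
  refine ⟨fun t => -X t, hX.neg, fun q hq => ?_⟩
  have hBq := h.left_b_ne_zero hq
  have hderiv : pd 1 (fun x => F.b x / H.b x) q = deriv X (q 1) := by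
    rw [pd_congr hXeq h.isOpen hq, pd_comp_coordinate h.isOpen hX hq]
  have hfactor : 1 + q 0 * deriv (fun t => -X t) (q 1) = 2 / H.b q := by
    rw [deriv.fun_neg, ← hderiv, ← h.conformalFactor_add_eq_one hp hB hq]
    ring
  rw [hfactor]
  refine ⟨div_ne_zero two_ne_zero hBq, h.lineElement_eq hq, fun P => ?_⟩
  beta_reduce
  rw [← hXeq q hq]
  rw [MomentumForm.eval, h.right_a q hq, h.right_c q hq]
  simp only [smul_eq_mul]
  field_simp
  ring

end IsNullNormalized

end Null

/-! ### Coordinates with isotropic differentials -/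

/-- Functions `x`, `y` with `H(dx) = H(dy) = 0`, `F(dx) = n` and `F(dy) = m`; they are coordinates
wherever `dx ∧ dy ≠ 0`. -/
structure IsNullCoordinates (Ω : Set Plane) (H F : MomentumForm) (n m : ℝ) (x y : Plane → ℝ) :
    Prop where
  smooth_left : ContDiffOn ℝ ∞ x Ω
  smooth_right : ContDiffOn ℝ ∞ y Ω
  null_left : ∀ q ∈ Ω, H.eval q (differential x q) = 0
  null_right : ∀ q ∈ Ω, H.eval q (differential y q) = 0
  eval_left : ∀ q ∈ Ω, F.eval q (differential x q) = n
  eval_right : ∀ q ∈ Ω, F.eval q (differential y q) = m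

section NullCoordinates

variable {Ω : Set Plane} {H F : MomentumForm} {η ζ : Plane → Fin 2 → ℝ} {p : Plane} {n m : ℝ}

lemma IsKillingPair.exists_null_primitive (h : IsKillingPair Ω H F) (hconv : Convex ℝ Ω)
    (hcoframe : IsNullCoframe Ω H η ζ) (hpos : ∀ q ∈ Ω, 0 < n / F.eval q (η q)) :
    ∃ x : Plane → ℝ, ContDiffOn ℝ ∞ x Ω ∧ IsNullCoframe Ω H (differential x) ζ ∧
      ∀ q ∈ Ω, F.eval q (differential x q) = n := by
  have hn (q) (hq : q ∈ Ω) : n ≠ 0 ∧ F.eval q (η q) ≠ 0 := div_ne_zero_iff.1 (hpos q hq).ne'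
  have hscale : ContDiffOn ℝ ∞ (fun q => √(n / F.eval q (η q))) Ω :=
    (contDiffOn_const.div (h.smooth_right.eval hcoframe.smooth_left) fun q hq => (hn q hq).2).sqrt
      fun q hq => (hpos q hq).ne'
  have hθ := hcoframe.smul_left hscale fun q hq => (Real.sqrt_pos.2 (hpos q hq)).ne'
  have hF (q) (hq : q ∈ Ω) : F.eval q (√(n / F.eval q (η q)) • η q) = n := by
    rw [MomentumForm.eval_smul, Real.sq_sqrt (hpos q hq).le, div_mul_cancel₀ _ (hn q hq).2]
  obtain ⟨x, hx, hdx⟩ := exists_primitive h.isOpen hconv hθ.smooth_left fun q hq =>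
    h.pd_symm_of_isotropic hθ.smooth_left hθ.null_left (hn q hq).1 hF hq
  refine ⟨x, hx, ⟨contDiffOn_differential hx h.isOpen, hθ.smooth_right, fun q hq => ?_,
    hθ.null_right, fun q hq => ?_⟩, fun q hq => ?_⟩
  · rw [hdx hq, hθ.null_left q hq]
  · rw [hdx hq]
    exact hθ.wedge_ne q hq
  · rw [hdx hq, hF q hq]

lemma IsKillingPair.exists_isNullCoordinates (h : IsKillingPair Ω H F)
    (hcoframe : IsNullCoframe Ω H η ζ) (hp : p ∈ Ω) (hη : 0 < n / F.eval p (η p))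
    (hζ : 0 < m / F.eval p (ζ p)) :
    ∃ r > 0, Metric.ball p r ⊆ Ω ∧ ∃ x y, IsNullCoordinates (Metric.ball p r) H F n m x y ∧
      wedge (differential x p) (differential y p) ≠ 0 := by
  have hηs := (h.smooth_right.eval hcoframe.smooth_left).continuousOn
  have hζs := (h.smooth_right.eval hcoframe.smooth_right).continuousOn
  obtain ⟨r₀, hr₀, hsub₀, hne⟩ := exists_ball_subset_preimage h.isOpen (hηs.prodMk hζs)
    (isOpen_ne.prod isOpen_ne) hp (show _ ∈ {y : ℝ | y ≠ 0} ×ˢ {y : ℝ | y ≠ 0} from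
      ⟨(div_ne_zero_iff.1 hη.ne').2, (div_ne_zero_iff.1 hζ.ne').2⟩)
  obtain ⟨r, hr, hsub, hpos⟩ := exists_ball_subset_preimage Metric.isOpen_ball
    ((continuousOn_const.div (hηs.mono hsub₀) fun q hq => (hne q hq).1).prodMk
      (continuousOn_const.div (hζs.mono hsub₀) fun q hq => (hne q hq).2))
    (isOpen_Ioi.prod isOpen_Ioi) (Metric.mem_ball_self hr₀)
    (show _ ∈ Ioi (0 : ℝ) ×ˢ Ioi (0 : ℝ) from ⟨hη, hζ⟩)
  have hball := h.mono Metric.isOpen_ball (hsub.trans hsub₀)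
  obtain ⟨x, hx, hxζ, hFx⟩ := hball.exists_null_primitive (convex_ball p r)
    (hcoframe.mono (hsub.trans hsub₀)) fun q hq => (hpos q hq).1
  obtain ⟨y, hy, hyx, hFy⟩ := hball.exists_null_primitive (convex_ball p r) hxζ.symm
    fun q hq => (hpos q hq).2
  exact ⟨r, hr, hsub.trans hsub₀, x, y,
    ⟨hx, hy, hyx.null_right, hyx.null_left, hFx, hFy⟩,
    hyx.symm.wedge_ne p (Metric.mem_ball_self hr)⟩

end NullCoordinates

/-! ### The normal forms -/

section NormalForms

variable {D : Set Plane} {ds ds' F F' : Plane → Plane → ℝ} {s : ℝ}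

lemma IsLiouville.congr (h : IsLiouville s D ds F) (hds : EqOn ds' ds D) (hF : EqOn F' F D) :
    IsLiouville s D ds' F' := by
  obtain ⟨X, Y, hX, hY, h⟩ := h
  exact ⟨X, Y, hX, hY, fun q hq => by simpa only [hds hq, hF hq] using h q hq⟩

lemma IsComplexLiouville.congr (h : IsComplexLiouville D ds F) (hds : EqOn ds' ds D)
    (hF : EqOn F' F D) : IsComplexLiouville D ds' F' := by
  obtain ⟨w, hw, h⟩ := h
  exact ⟨w, hw, fun q hq => by simpa only [hds hq, hF hq] using h q hq⟩

lemma IsJordanBlock.congr (h : IsJordanBlock D ds F) (hds : EqOn ds' ds D) (hF : EqOn F' F D) :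
    IsJordanBlock D ds' F' := by
  obtain ⟨Y, hY, h⟩ := h
  exact ⟨Y, hY, fun q hq => by simpa only [hds hq, hF hq] using h q hq⟩

end NormalForms

section Charts

variable {M : Type*} [TopologicalSpace M] [ChartedSpace Plane M]
  {g : PseudoRiemannianMetric M} {F : CotangentFunction M} {φ φ' : OpenPartialHomeomorph M Plane}

/-- In the chart `φ` the metric `g` and the integral `F` have one of the three normal forms. -/
def HasNormalForm (g : PseudoRiemannianMetric M) (F : CotangentFunction M)
    (φ : OpenPartialHomeomorph M Plane) : Prop :=
  IsLiouville 1 φ.target (g.lineElement φ) (inCoords F φ) ∨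
    (∃ ε : ℝ, (ε = 1 ∨ ε = -1) ∧
      IsLiouville (-1) φ.target (g.lineElement φ) (fun q P => ε * inCoords F φ q P)) ∨
    IsComplexLiouville φ.target (g.lineElement φ) (inCoords F φ) ∨
    (∃ ε : ℝ, (ε = 1 ∨ ε = -1) ∧
      IsJordanBlock φ.target (g.lineElement φ) (fun q P => ε * inCoords F φ q P))

lemma IsQuadraticInMomenta.const_smul (hF : IsQuadraticInMomenta F) (k : ℝ) :
    IsQuadraticInMomenta (k • F) := by
  intro φ hφ
  obtain ⟨a, b, c, ha, hb, hc, h⟩ := hF φ hφ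
  refine ⟨fun q => k * a q, fun q => k * b q, fun q => k * c q, contDiffOn_const.mul ha,
    contDiffOn_const.mul hb, contDiffOn_const.mul hc, fun q hq P => ?_⟩
  change k * inCoords F φ q P = _
  rw [h q hq P]
  ring

lemma PseudoRiemannianMetric.IsIntegral.const_smul (hI : g.IsIntegral F) (k : ℝ) :
    g.IsIntegral (k • F) := by
  intro φ hφ q hq P
  have hposition : fderiv ℝ (fun q' => inCoords (k • F) φ q' P) q =
      k • fderiv ℝ (fun q' => inCoords F φ q' P) q :=
    congrFun (fderiv_const_smul_field (f := fun q' => inCoords F φ q' P) k) q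
  have hmomentum : fderiv ℝ (fun P' => inCoords (k • F) φ q P') P =
      k • fderiv ℝ (fun P' => inCoords F φ q P') P :=
    congrFun (fderiv_const_smul_field (f := fun P' => inCoords F φ q P') k) P
  have h := hI φ hφ q hq P
  simp only [poissonBracket, hposition, hmomentum, Fin.sum_univ_two, smul_eq_mul,
    smul_apply] at h ⊢
  linear_combination k * h

lemma momentumForm_const_smul (k : ℝ) : momentumForm (k • F) φ = k • momentumForm F φ := by
  have hk : inCoords (k • F) φ = fun q P => k * inCoords F φ q P := rfl
  ext q <;> simp only [momentumForm, hk, MomentumForm.smul_a, MomentumForm.smul_b,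
    MomentumForm.smul_c, mul_sub]

lemma eqOn_lineElement (hφ : φ ∈ IsManifold.maximalAtlas (𝓡 2) ∞ M) :
    EqOn (g.lineElement φ) (momentumForm g.hamiltonian φ).lineElement φ.target :=
  fun _ hq => funext (g.lineElement_eq hφ hq)

lemma IsQuadraticInMomenta.eqOn_inCoords (hF : IsQuadraticInMomenta F)
    (hφ : φ ∈ IsManifold.maximalAtlas (𝓡 2) ∞ M) :
    EqOn (inCoords F φ) (fun q P => (momentumForm F φ).eval q P.ofLp) φ.target :=
  fun _ hq => funext (hF.inCoords_eq hφ hq)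

variable {Ω : Set Plane} {p : Plane} {x y : Plane → ℝ}

lemma IsCoordinateChange.isNullNormalized {τ : Plane → Plane} {m : ℝ}
    (h : IsCoordinateChange φ φ' Ω x y τ) (hφ : φ ∈ IsManifold.maximalAtlas (𝓡 2) ∞ M)
    (hΩφ : Ω ⊆ φ.target) (hI : g.IsIntegral F) (hF : IsQuadraticInMomenta F)
    (hxy : IsNullCoordinates Ω (momentumForm g.hamiltonian φ) (momentumForm F φ) 1 m x y) :
    IsNullNormalized φ'.target (momentumForm g.hamiltonian φ') (momentumForm F φ') m := by
  have hH := fun {q : Plane} (hq : q ∈ φ'.target) =>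
    h.momentumForm_eq hφ hΩφ g.isQuadraticInMomenta_hamiltonian hq
  have hF' := fun {q : Plane} (hq : q ∈ φ'.target) => h.momentumForm_eq hφ hΩφ hF hq
  refine ⟨hI.isKillingPair hF h.mem_maximalAtlas, fun q hq => ?_, fun q hq => ?_, fun q hq => ?_,
    fun q hq => ?_⟩
  · exact (hH hq).1.trans (hxy.null_left _ (h.mapsTo hq))
  · exact (hH hq).2.2.trans (hxy.null_right _ (h.mapsTo hq))
  · exact (hF' hq).1.trans (hxy.eval_left _ (h.mapsTo hq))
  · exact (hF' hq).2.2.trans (hxy.eval_right _ (h.mapsTo hq))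

variable [IsManifold (𝓡 2) ∞ M]

lemma IsNullCoordinates.exists_isComplexLiouville
    (hxy : IsNullCoordinates Ω (momentumForm g.hamiltonian φ) (momentumForm F φ) 1 (-1) x y)
    (hw : wedge (differential x p) (differential y p) ≠ 0)
    (hφ : φ ∈ IsManifold.maximalAtlas (𝓡 2) ∞ M) (hΩ : IsOpen Ω) (hΩφ : Ω ⊆ φ.target) (hp : p ∈ Ω)
    (hI : g.IsIntegral F) (hF : IsQuadraticInMomenta F) :
    ∃ φ' ∈ IsManifold.maximalAtlas (𝓡 2) ∞ M, φ.symm p ∈ φ'.source ∧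
      IsComplexLiouville φ'.target (g.lineElement φ') (inCoords F φ') := by
  obtain ⟨φ', τ, h, hp', -⟩ :=
    exists_isCoordinateChange hφ hΩ hΩφ hxy.smooth_left hxy.smooth_right hp hw
  exact ⟨φ', h.mem_maximalAtlas, hp', (h.isNullNormalized hφ hΩφ hI hF hxy).isComplexLiouville.congr
    (eqOn_lineElement h.mem_maximalAtlas) (hF.eqOn_inCoords h.mem_maximalAtlas)⟩

theorem exists_isLiouville_of_eval_differential {s : ℝ} (hs : s ^ 2 = 1) (hx : ContDiffOn ℝ ∞ x Ω)
    (hy : ContDiffOn ℝ ∞ y Ω) (hw : wedge (differential x p) (differential y p) ≠ 0)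
    (hφ : φ ∈ IsManifold.maximalAtlas (𝓡 2) ∞ M) (hΩ : IsOpen Ω) (hΩφ : Ω ⊆ φ.target) (hp : p ∈ Ω)
    (hI : g.IsIntegral F) (hF : IsQuadraticInMomenta F)
    (hHb : ∀ q ∈ Ω,
      (momentumForm g.hamiltonian φ).polar q (differential x q) (differential y q) = 0)
    (hHc : ∀ q ∈ Ω, (momentumForm g.hamiltonian φ).eval q (differential y q) =
      s * (momentumForm g.hamiltonian φ).eval q (differential x q))
    (hFb : ∀ q ∈ Ω, (momentumForm F φ).polar q (differential x q) (differential y q) = 0)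
    (hFc : ∀ q ∈ Ω, (momentumForm F φ).eval q (differential y q) =
      1 + s * (momentumForm F φ).eval q (differential x q)) :
    ∃ φ' ∈ IsManifold.maximalAtlas (𝓡 2) ∞ M, φ.symm p ∈ φ'.source ∧
      IsLiouville s φ'.target (g.lineElement φ') (inCoords F φ') := by
  obtain ⟨φ', τ, h, hp', r, -, hball⟩ := exists_isCoordinateChange hφ hΩ hΩφ hx hy hp hw
  have hH' := fun {q : Plane} (hq : q ∈ φ'.target) =>
    h.momentumForm_eq hφ hΩφ g.isQuadraticInMomenta_hamiltonian hq
  have hF' := fun {q : Plane} (hq : q ∈ φ'.target) => h.momentumForm_eq hφ hΩφ hF hq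
  have hpair := hI.isKillingPair hF h.mem_maximalAtlas
  refine ⟨φ', h.mem_maximalAtlas, hp', .congr ?_ (eqOn_lineElement h.mem_maximalAtlas)
    (hF.eqOn_inCoords h.mem_maximalAtlas)⟩
  rw [hball] at hpair hH' hF' ⊢
  have hτ : MapsTo τ (Metric.ball (pairMap x y p) r) Ω := hball ▸ h.mapsTo
  refine hpair.isLiouville hs (fun q hq => ?_) (fun q hq => ?_) (fun q hq => ?_) (fun q hq => ?_)
  · exact (hH' hq).2.1.trans (hHb _ (hτ hq))
  · rw [(hH' hq).2.2, (hH' hq).1, hHc _ (hτ hq)]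
  · exact (hF' hq).2.1.trans (hFb _ (hτ hq))
  · rw [(hF' hq).2.2, (hF' hq).1, hFc _ (hτ hq)]

end Charts

/-! ### Integrals proportional to a square -/

/-- Coordinates in which `p_x` is isotropic for `H` with `F = p_x²` along it, while `F` vanishes on
the other isotropic line, which is spanned by `(-H.c, H.b)`. -/
structure IsHalfNormalized (Ω : Set Plane) (H F : MomentumForm) : Prop
    extends IsKillingPair Ω H F where
  left_a : ∀ q ∈ Ω, H.a q = 0
  right_a : ∀ q ∈ Ω, F.a q = 1
  common_null : ∀ q ∈ Ω, F.eval q ![-H.c q, H.b q] = 0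

namespace IsHalfNormalized

variable {Ω : Set Plane} {H F : MomentumForm} {p q : Plane}

lemma left_b_ne_zero (h : IsHalfNormalized Ω H F) (hq : q ∈ Ω) : H.b q ≠ 0 :=
  fun h₀ => h.discr_ne q hq (by rw [MomentumForm.discr, h.left_a q hq, h₀]; ring)

lemma of_common_null (h : IsKillingPair Ω H F) (hHa : ∀ q ∈ Ω, H.a q = 0)
    (hFa : ∀ q ∈ Ω, F.a q = 1)
    (hnull : ∀ q ∈ Ω, ∃ P : Fin 2 → ℝ, P 1 ≠ 0 ∧ H.eval q P = 0 ∧ F.eval q P = 0) :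
    IsHalfNormalized Ω H F := by
  refine ⟨h, hHa, hFa, fun q hq => ?_⟩
  obtain ⟨P, hP, hHP, hFP⟩ := hnull q hq
  simp only [MomentumForm.eval, hHa q hq, hFa q hq, smul_eq_mul, Matrix.cons_val_zero,
    Matrix.cons_val_one] at hHP hFP ⊢
  have hline : H.b q * P 0 + H.c q * P 1 = 0 :=
    (mul_eq_zero.1 (by linear_combination hHP)).resolve_left hP
  refine (mul_eq_zero.1 (?_ : P 1 ^ 2 * _ = 0)).resolve_left (pow_ne_zero 2 hP)
  linear_combination H.b q ^ 2 * hFP +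
    (H.c q * P 1 - H.b q * P 0 - F.b q * H.b q * P 1) * hline

lemma ratio_eq (h : IsHalfNormalized Ω H F) (hq : q ∈ Ω) :
    MomentumForm.ratio H F q = (F.b q * H.b q - 2 * H.c q) / H.b q ^ 2 := by
  rw [MomentumForm.ratio, MomentumForm.discr, h.left_a q hq, h.right_a q hq]
  ring

lemma pd_common_null (h : IsHalfNormalized Ω H F) (hq : q ∈ Ω) (i : Fin 2) :
    2 * H.c q * pd i H.c q - (pd i F.b q * (H.b q * H.c q) +
      F.b q * (pd i H.b q * H.c q + H.b q * pd i H.c q)) +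
      (pd i F.c q * H.b q ^ 2 + F.c q * (2 * H.b q * pd i H.b q)) = 0 := by
  have dB := differentiableAt_of_contDiffOn h.smooth_left.b h.isOpen hq
  have dC := differentiableAt_of_contDiffOn h.smooth_left.c h.isOpen hq
  have db := differentiableAt_of_contDiffOn h.smooth_right.b h.isOpen hq
  have dc := differentiableAt_of_contDiffOn h.smooth_right.c h.isOpen hq
  have hnull : EqOn (fun x => H.c x * H.c x + ((-1) * (F.b x * (H.b x * H.c x)) +
      F.c x * (H.b x * H.b x))) (fun _ => 0) Ω := fun x hx => by
    have hx' := h.common_null x hx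
    simp only [MomentumForm.eval, h.right_a x hx, smul_eq_mul, Matrix.cons_val_zero,
      Matrix.cons_val_one] at hx'
    linear_combination hx'
  have hpd := (pd_congr hnull h.isOpen hq i).trans (pd_const 0)
  rw [pd_add (by fun_prop) (by fun_prop), pd_add (by fun_prop) (by fun_prop), pd_mul dC dC,
    pd_const_mul (by fun_prop), pd_mul db (by fun_prop), pd_mul dB dC, pd_mul dc (by fun_prop),
    pd_mul dB dB] at hpd
  linear_combination hpd

lemma pd_div_symm (h : IsHalfNormalized Ω H F) (hq : q ∈ Ω) :
    pd 0 (fun x => 2 / H.b x) q = pd 1 (fun x => (-1) * F.b x / H.b x) q := by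
  have hB := h.left_b_ne_zero hq
  have dB := differentiableAt_of_contDiffOn h.smooth_left.b h.isOpen hq
  have db := differentiableAt_of_contDiffOn h.smooth_right.b h.isOpen hq
  have eA (i) : pd i H.a q = 0 := (pd_congr h.left_a h.isOpen hq i).trans (pd_const 0)
  have ea (i) : pd i F.a q = 0 := (pd_congr h.right_a h.isOpen hq i).trans (pd_const 1)
  have hxxy := (h.commute q hq).xxy
  rw [eA, eA, ea, ea, h.left_a q hq, h.right_a q hq] at hxxy
  rw [pd_div (differentiableAt_const (2 : ℝ)) dB hB, pd_div (db.const_mul (-1)) dB hB,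
    pd_const_mul db, pd_const]
  congr 1
  linear_combination -hxxy

lemma pd_ratio (h : IsHalfNormalized Ω H F) (hq : q ∈ Ω) :
    H.b q * pd 0 (MomentumForm.ratio H F) q + H.c q * pd 1 (MomentumForm.ratio H F) q = 0 := by
  have hB := h.left_b_ne_zero hq
  have dB := differentiableAt_of_contDiffOn h.smooth_left.b h.isOpen hq
  have dC := differentiableAt_of_contDiffOn h.smooth_left.c h.isOpen hq
  have db := differentiableAt_of_contDiffOn h.smooth_right.b h.isOpen hq
  have eA (i) : pd i H.a q = 0 := (pd_congr h.left_a h.isOpen hq i).trans (pd_const 0)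
  have ea (i) : pd i F.a q = 0 := (pd_congr h.right_a h.isOpen hq i).trans (pd_const 1)
  obtain ⟨-, hxxy, hxyy, -⟩ := h.commute q hq
  rw [eA, eA, ea, ea, h.left_a q hq, h.right_a q hq] at hxxy
  rw [h.left_a q hq, h.right_a q hq] at hxyy
  have hnull := h.common_null q hq
  simp only [MomentumForm.eval, h.right_a q hq, smul_eq_mul, Matrix.cons_val_zero,
    Matrix.cons_val_one] at hnull
  have hratio (i : Fin 2) : pd i (MomentumForm.ratio H F) q =
      (pd i F.b q * H.b q ^ 2 - F.b q * H.b q * pd i H.b q - 2 * pd i H.c q * H.b q +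
        4 * H.c q * pd i H.b q) / H.b q ^ 3 := by
    have heq : EqOn (MomentumForm.ratio H F)
        (fun x => (F.b x * H.b x + (-2) * H.c x) / (H.b x * H.b x)) Ω := fun x hx => by
      rw [h.ratio_eq hx]
      ring
    rw [pd_congr heq h.isOpen hq, pd_div (by fun_prop) (by fun_prop) (mul_ne_zero hB hB),
      pd_mul dB dB, pd_add (by fun_prop) (by fun_prop), pd_mul db dB, pd_const_mul dC]
    field_simp
    ring
  rw [hratio, hratio, ← mul_div_assoc, ← mul_div_assoc, ← add_div, div_eq_zero_iff]
  left
  linear_combination (-H.b q ^ 2) * hxyy + 2 * H.b q * H.c q * hxxy -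
    H.b q * h.pd_common_null hq 1 + 4 * pd 1 H.b q * hnull

/-- In the normal form, `dW = (-F.b dx + 2 dt) / H.b` has the primitive `W = y + x Y` and
`ratio H F = -Y`, whence the formula `y = W + x * ratio H F`. -/
lemma exists_isotropic_coordinate (h : IsHalfNormalized Ω H F) (hconv : Convex ℝ Ω) :
    ∃ y : Plane → ℝ, ContDiffOn ℝ ∞ y Ω ∧
      (∀ q ∈ Ω, H.b q * pd 0 y q + H.c q * pd 1 y q = 0) ∧
      ∀ q ∈ Ω, q 0 = 0 → pd 1 y q = 2 / H.b q := by
  have hB (q) (hq : q ∈ Ω) := h.left_b_ne_zero hq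
  obtain ⟨W, hW, hdW⟩ := exists_primitive h.isOpen hconv
    (α := fun q => ![(-1) * F.b q / H.b q, 2 / H.b q])
    (contDiffOn_vec2 ((contDiffOn_const.mul h.smooth_right.b).div h.smooth_left.b hB)
      (contDiffOn_const.div h.smooth_left.b hB))
    fun q hq => Fin.forall_fin_two.2 ⟨Fin.forall_fin_two.2 ⟨rfl, h.pd_div_symm hq⟩,
      Fin.forall_fin_two.2 ⟨(h.pd_div_symm hq).symm, rfl⟩⟩
  have hratio := h.contDiffOn_ratio
  have hX : ContDiff ℝ ∞ fun q : Plane => q 0 := by fun_prop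
  have hpd (q) (hq : q ∈ Ω) (i) : pd i (fun q => W q + q 0 * MomentumForm.ratio H F q) q =
      pd i W q + ((if i = 0 then 1 else 0) * MomentumForm.ratio H F q +
        q 0 * pd i (MomentumForm.ratio H F) q) := by
    have dX : DifferentiableAt ℝ (fun q : Plane => q 0) q := by fun_prop
    have dr := differentiableAt_of_contDiffOn hratio h.isOpen hq
    rw [pd_add (differentiableAt_of_contDiffOn hW h.isOpen hq) (dX.fun_mul dr), pd_mul dX dr,
      pd_coordinate]
  have hW₀ (q) (hq : q ∈ Ω) : pd 0 W q = (-1) * F.b q / H.b q := congrFun (hdW hq) 0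
  have hW₁ (q) (hq : q ∈ Ω) : pd 1 W q = 2 / H.b q := congrFun (hdW hq) 1
  refine ⟨fun q => W q + q 0 * MomentumForm.ratio H F q, hW.add (hX.contDiffOn.mul hratio),
    fun q hq => ?_, fun q hq hq₀ => ?_⟩
  · have hcancel : H.b q * ((-1) * F.b q / H.b q + MomentumForm.ratio H F q) +
        H.c q * (2 / H.b q) = 0 := by
      have := hB q hq
      rw [h.ratio_eq hq]
      field_simp
      ring
    rw [hpd q hq, hpd q hq, hW₀ q hq, hW₁ q hq, if_pos rfl, if_neg one_ne_zero]
    linear_combination hcancel + q 0 * h.pd_ratio hq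
  · rw [hpd q hq, hW₁ q hq, hq₀]
    simp

lemma isNullCoordinates (h : IsHalfNormalized Ω H F) {y : Plane → ℝ} (hy : ContDiffOn ℝ ∞ y Ω)
    (hdy : ∀ q ∈ Ω, H.b q * pd 0 y q + H.c q * pd 1 y q = 0) :
    IsNullCoordinates Ω H F 1 0 (fun q => q 0) y := by
  have hX : ContDiff ℝ ∞ fun q : Plane => q 0 := by fun_prop
  refine ⟨hX.contDiffOn, hy, fun q hq => ?_, fun q hq => ?_, fun q hq => ?_, fun q hq => ?_⟩
  · simp [MomentumForm.eval, differential, pd_coordinate, h.left_a q hq]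
  · simp only [MomentumForm.eval, differential, h.left_a q hq, smul_eq_mul]
    linear_combination pd 1 y q * hdy q hq
  · simp [MomentumForm.eval, differential, pd_coordinate, h.right_a q hq]
  · have hnull := h.common_null q hq
    simp only [MomentumForm.eval, h.right_a q hq, smul_eq_mul, Matrix.cons_val_zero,
      Matrix.cons_val_one] at hnull
    refine (mul_eq_zero.1 (?_ : H.b q ^ 2 * _ = 0)).resolve_left
      (pow_ne_zero 2 (h.left_b_ne_zero hq))
    simp only [MomentumForm.eval, differential, h.right_a q hq, smul_eq_mul]
    linear_combination pd 1 y q ^ 2 * hnull +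
      (H.b q * pd 0 y q - H.c q * pd 1 y q + F.b q * H.b q * pd 1 y q) * hdy q hq

end IsHalfNormalized

section Charts

variable {M : Type*} [TopologicalSpace M] [ChartedSpace Plane M]
  {g : PseudoRiemannianMetric M} {F : CotangentFunction M} {φ φ' : OpenPartialHomeomorph M Plane}
  {Ω : Set Plane} {p : Plane} {x t : Plane → ℝ}

lemma IsCoordinateChange.isHalfNormalized {ζ : Plane → Fin 2 → ℝ} {τ : Plane → Plane}
    (h : IsCoordinateChange φ φ' Ω x t τ) (hφ : φ ∈ IsManifold.maximalAtlas (𝓡 2) ∞ M)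
    (hΩφ : Ω ⊆ φ.target) (hI : g.IsIntegral F) (hF : IsQuadraticInMomenta F)
    (hcoframe : IsNullCoframe Ω (momentumForm g.hamiltonian φ) (differential x) ζ)
    (hFx : ∀ q ∈ Ω, (momentumForm F φ).eval q (differential x q) = 1)
    (hFζ : ∀ q ∈ Ω, (momentumForm F φ).eval q (ζ q) = 0) :
    IsHalfNormalized φ'.target (momentumForm g.hamiltonian φ') (momentumForm F φ') := by
  have hH := g.isQuadraticInMomenta_hamiltonian
  refine .of_common_null (hI.isKillingPair hF h.mem_maximalAtlas)
    (fun q hq => (h.momentumForm_eq hφ hΩφ hH hq).1.trans (hcoframe.null_left _ (h.mapsTo hq)))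
    (fun q hq => (h.momentumForm_eq hφ hΩφ hF hq).1.trans (hFx _ (h.mapsTo hq))) fun q hq => ?_
  have hτ := h.mapsTo hq
  have vanish {G : CotangentFunction M} (hG : IsQuadraticInMomenta G)
      (hGζ : (momentumForm G φ).eval (τ q) (ζ (τ q)) = 0) : (momentumForm G φ').eval q
        ![wedge (ζ (τ q)) (differential t (τ q)), wedge (differential x (τ q)) (ζ (τ q))] = 0 := by
    rw [h.eval_momentumForm hφ hΩφ hG hq]
    simp only [Matrix.cons_val_zero, Matrix.cons_val_one, wedge_smul_add_wedge_smul,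
      MomentumForm.eval_smul, hGζ, mul_zero]
  exact ⟨_, hcoframe.wedge_ne _ hτ, vanish hH (hcoframe.null_right _ hτ), vanish hF (hFζ _ hτ)⟩

variable [IsManifold (𝓡 2) ∞ M]

lemma IsHalfNormalized.exists_isJordanBlock (h : IsHalfNormalized Ω (momentumForm g.hamiltonian φ)
    (momentumForm F φ)) (hconv : Convex ℝ Ω) (hp₀ : p 0 = 0)
    (hφ : φ ∈ IsManifold.maximalAtlas (𝓡 2) ∞ M) (hΩφ : Ω ⊆ φ.target) (hp : p ∈ Ω)
    (hI : g.IsIntegral F) (hF : IsQuadraticInMomenta F) :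
    ∃ φ' ∈ IsManifold.maximalAtlas (𝓡 2) ∞ M, φ.symm p ∈ φ'.source ∧
      IsJordanBlock φ'.target (g.lineElement φ') (inCoords F φ') := by
  obtain ⟨y, hy, hdy, hy₀⟩ := h.exists_isotropic_coordinate hconv
  have hxy := h.isNullCoordinates hy hdy
  have hdx (q : Plane) : differential (fun q : Plane => q 0) q = ![1, 0] :=
    funext (Fin.forall_fin_two.2 ⟨pd_coordinate .., pd_coordinate ..⟩)
  have hw : wedge (differential (fun q : Plane => q 0) p) (differential y p) ≠ 0 := by
    have := h.left_b_ne_zero hp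
    rw [hdx]
    simpa [wedge, differential, hy₀ p hp hp₀] using this
  obtain ⟨φ', τ, hτ, hp', r, -, hball⟩ :=
    exists_isCoordinateChange hφ h.isOpen hΩφ hxy.smooth_left hxy.smooth_right hp hw
  have hnormal := hτ.isNullNormalized hφ hΩφ hI hF hxy
  refine ⟨φ', hτ.mem_maximalAtlas, hp', .congr ?_ (eqOn_lineElement hτ.mem_maximalAtlas)
    (hF.eqOn_inCoords hτ.mem_maximalAtlas)⟩
  have hb (q) (hq : q ∈ φ'.target) (hq₀ : q 0 = 0) :
      (momentumForm g.hamiltonian φ').b q = 2 := by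
    have hτq := hτ.mapsTo hq
    rw [(hτ.momentumForm_eq hφ hΩφ g.isQuadraticInMomenta_hamiltonian hq).2.1, hdx]
    have hdy₁ : differential y (τ q) 1 = 2 / (momentumForm g.hamiltonian φ).b (τ q) :=
      hy₀ _ hτq ((hτ.fst_eq q hq).trans hq₀)
    simp only [MomentumForm.polar, MomentumForm.grad, Matrix.cons_val_zero, Matrix.cons_val_one,
      h.left_a _ hτq, hdy₁, smul_eq_mul, mul_zero, mul_one, zero_mul, zero_add, add_zero]
    exact mul_div_cancel₀ _ (h.left_b_ne_zero hτq)
  rw [hball] at hnormal hb ⊢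
  exact hnormal.isJordanBlock hp₀ hb

lemma exists_isJordanBlock_of_eval_eq_zero {η ζ : Plane → Fin 2 → ℝ}
    (hcoframe : IsNullCoframe Ω (momentumForm g.hamiltonian φ) η ζ)
    (hFη : 0 < (momentumForm F φ).eval p (η p))
    (hFζ : ∀ q ∈ Ω, (momentumForm F φ).eval q (ζ q) = 0)
    (hφ : φ ∈ IsManifold.maximalAtlas (𝓡 2) ∞ M) (hΩ : IsOpen Ω) (hΩφ : Ω ⊆ φ.target) (hp : p ∈ Ω)
    (hI : g.IsIntegral F) (hF : IsQuadraticInMomenta F) :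
    ∃ φ' ∈ IsManifold.maximalAtlas (𝓡 2) ∞ M, φ.symm p ∈ φ'.source ∧
      IsJordanBlock φ'.target (g.lineElement φ') (inCoords F φ') := by
  have hpair := (hI.isKillingPair hF hφ).mono hΩ hΩφ
  obtain ⟨r, hr, hsub, hpos⟩ := exists_ball_subset_preimage hΩ
    (hpair.smooth_right.eval hcoframe.smooth_left).continuousOn isOpen_Ioi hp hFη
  have hp' : p ∈ Metric.ball p r := Metric.mem_ball_self hr
  obtain ⟨x, hx, hxζ, hFx⟩ := (hpair.mono Metric.isOpen_ball hsub).exists_null_primitive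
    (convex_ball p r) (hcoframe.mono hsub) fun q hq => one_div_pos.2 (hpos q hq)
  rw [← differential_sub_const x (x p)] at hxζ hFx
  obtain ⟨i, hi⟩ := exists_wedge_differential_coordinate_ne_zero (q := p)
    (η := differential (fun q => x q - x p) p)
    fun h => hxζ.wedge_ne p hp' (by simp [h, wedge])
  have hcoordinate : ContDiff ℝ ∞ fun q : Plane => q i := by fun_prop
  obtain ⟨ψ, τ, hτ, hpψ, r', -, hball⟩ := exists_isCoordinateChange hφ Metric.isOpen_ball
    (hsub.trans hΩφ) (hx.sub contDiffOn_const) hcoordinate.contDiffOn hp' hi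
  have hhalf := hτ.isHalfNormalized hφ (hsub.trans hΩφ) hI hF hxζ hFx fun q hq => hFζ q (hsub hq)
  have hq := ψ.map_source hpψ
  have hq₀ : ψ (φ.symm p) 0 = 0 := by
    rw [← hτ.fst_eq _ hq, hτ.left_inv (hsub.trans hΩφ) hp' hpψ, sub_self]
  have hconv : Convex ℝ ψ.target := hball ▸ convex_ball _ _
  have hform := hhalf.exists_isJordanBlock hconv hq₀ hτ.mem_maximalAtlas subset_rfl hq hI hF
  rwa [ψ.left_inv hpψ] at hform

end Charts

/-! ### Indefinite metrics -/

section Charts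

variable {M : Type*} [TopologicalSpace M] [ChartedSpace Plane M] [IsManifold (𝓡 2) ∞ M]
  {g : PseudoRiemannianMetric M} {F : CotangentFunction M} {φ : OpenPartialHomeomorph M Plane}
  {Ω : Set Plane} {p : Plane}

lemma IsNullCoordinates.exists_isLiouville {x y : Plane → ℝ}
    (hxy : IsNullCoordinates Ω (momentumForm g.hamiltonian φ) (momentumForm F φ) 1 1 x y)
    (hw : wedge (differential x p) (differential y p) ≠ 0)
    (hφ : φ ∈ IsManifold.maximalAtlas (𝓡 2) ∞ M) (hΩ : IsOpen Ω) (hΩφ : Ω ⊆ φ.target) (hp : p ∈ Ω)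
    (hI : g.IsIntegral F) (hF : IsQuadraticInMomenta F) :
    ∃ φ' ∈ IsManifold.maximalAtlas (𝓡 2) ∞ M, φ.symm p ∈ φ'.source ∧
      IsLiouville (-1) φ'.target (g.lineElement φ') (inCoords F φ') := by
  have smooth (s t : ℝ) : ContDiffOn ℝ ∞ (fun q => s * x q + t * y q) Ω :=
    (contDiffOn_const.mul hxy.smooth_left).add (contDiffOn_const.mul hxy.smooth_right)
  have hd (s t : ℝ) (q) (hq : q ∈ Ω) : differential (fun q => s * x q + t * y q) q =
      s • differential x q + t • differential y q :=
    differential_linear_combination (differentiableAt_of_contDiffOn hxy.smooth_left hΩ hq)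
      (differentiableAt_of_contDiffOn hxy.smooth_right hΩ hq) s t
  refine exists_isLiouville_of_eval_differential (by norm_num) (smooth 2⁻¹ (-2⁻¹))
    (smooth 2⁻¹ 2⁻¹) ?_ hφ hΩ hΩφ hp hI hF (fun q hq => ?_) (fun q hq => ?_) (fun q hq => ?_)
    (fun q hq => ?_)
  · rw [hd _ _ p hp, hd _ _ p hp, wedge_linear_combination]
    exact mul_ne_zero (by norm_num) hw
  · rw [hd _ _ q hq, hd _ _ q hq, MomentumForm.polar_linear_combination, hxy.null_left q hq,
      hxy.null_right q hq]
    ring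
  · rw [hd _ _ q hq, hd _ _ q hq, MomentumForm.eval_smul_add_smul,
      MomentumForm.eval_smul_add_smul, hxy.null_left q hq, hxy.null_right q hq]
    ring
  · rw [hd _ _ q hq, hd _ _ q hq, MomentumForm.polar_linear_combination, hxy.eval_left q hq,
      hxy.eval_right q hq]
    ring
  · rw [hd _ _ q hq, hd _ _ q hq, MomentumForm.eval_smul_add_smul,
      MomentumForm.eval_smul_add_smul, hxy.eval_left q hq, hxy.eval_right q hq]
    ring

lemma exists_sign_mul_pos {x : ℝ} (hx : x ≠ 0) : ∃ ε : ℝ, (ε = 1 ∨ ε = -1) ∧ 0 < ε * x := by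
  rcases lt_or_gt_of_ne hx with h | h
  · exact ⟨-1, .inr rfl, by linarith⟩
  · exact ⟨1, .inl rfl, by linarith⟩

namespace IsNullCoframe

variable {η ζ : Plane → Fin 2 → ℝ}

lemma exists_isLiouville (h : IsNullCoframe Ω (momentumForm g.hamiltonian φ) η ζ)
    (hη : 0 < (momentumForm F φ).eval p (η p)) (hζ : 0 < (momentumForm F φ).eval p (ζ p))
    (hφ : φ ∈ IsManifold.maximalAtlas (𝓡 2) ∞ M) (hΩ : IsOpen Ω) (hΩφ : Ω ⊆ φ.target) (hp : p ∈ Ω)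
    (hI : g.IsIntegral F) (hF : IsQuadraticInMomenta F) :
    ∃ φ' ∈ IsManifold.maximalAtlas (𝓡 2) ∞ M, φ.symm p ∈ φ'.source ∧
      IsLiouville (-1) φ'.target (g.lineElement φ') (inCoords F φ') := by
  obtain ⟨r, hr, hsub, x, y, hxy, hw⟩ := ((hI.isKillingPair hF hφ).mono hΩ
    hΩφ).exists_isNullCoordinates h hp (one_div_pos.2 hη) (one_div_pos.2 hζ)
  exact hxy.exists_isLiouville hw hφ Metric.isOpen_ball (hsub.trans hΩφ)
    (Metric.mem_ball_self hr) hI hF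

lemma exists_isComplexLiouville (h : IsNullCoframe Ω (momentumForm g.hamiltonian φ) η ζ)
    (hη : 0 < (momentumForm F φ).eval p (η p)) (hζ : (momentumForm F φ).eval p (ζ p) < 0)
    (hφ : φ ∈ IsManifold.maximalAtlas (𝓡 2) ∞ M) (hΩ : IsOpen Ω) (hΩφ : Ω ⊆ φ.target) (hp : p ∈ Ω)
    (hI : g.IsIntegral F) (hF : IsQuadraticInMomenta F) :
    ∃ φ' ∈ IsManifold.maximalAtlas (𝓡 2) ∞ M, φ.symm p ∈ φ'.source ∧
      IsComplexLiouville φ'.target (g.lineElement φ') (inCoords F φ') := by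
  obtain ⟨r, hr, hsub, x, y, hxy, hw⟩ := ((hI.isKillingPair hF hφ).mono hΩ
    hΩφ).exists_isNullCoordinates h hp (one_div_pos.2 hη)
    (div_pos_of_neg_of_neg neg_one_lt_zero hζ)
  exact hxy.exists_isComplexLiouville hw hφ Metric.isOpen_ball (hsub.trans hΩφ)
    (Metric.mem_ball_self hr) hI hF

lemma exists_hasNormalForm_of_eval_ne_zero
    (h : IsNullCoframe Ω (momentumForm g.hamiltonian φ) η ζ)
    (hη : (momentumForm F φ).eval p (η p) ≠ 0) (hζ : (momentumForm F φ).eval p (ζ p) ≠ 0)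
    (hφ : φ ∈ IsManifold.maximalAtlas (𝓡 2) ∞ M) (hΩ : IsOpen Ω) (hΩφ : Ω ⊆ φ.target) (hp : p ∈ Ω)
    (hI : g.IsIntegral F) (hF : IsQuadraticInMomenta F) :
    ∃ φ' ∈ IsManifold.maximalAtlas (𝓡 2) ∞ M, φ.symm p ∈ φ'.source ∧ HasNormalForm g F φ' := by
  have liouville {ε : ℝ} (hε : ε = 1 ∨ ε = -1) (hη : 0 < ε * (momentumForm F φ).eval p (η p))
      (hζ : 0 < ε * (momentumForm F φ).eval p (ζ p)) :
      ∃ φ' ∈ IsManifold.maximalAtlas (𝓡 2) ∞ M, φ.symm p ∈ φ'.source ∧ HasNormalForm g F φ' := by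
    rw [← smul_eq_mul, ← MomentumForm.smul_eval, ← momentumForm_const_smul] at hη hζ
    obtain ⟨φ', hφ', hp', hform⟩ :=
      h.exists_isLiouville hη hζ hφ hΩ hΩφ hp (hI.const_smul ε) (hF.const_smul ε)
    exact ⟨φ', hφ', hp', .inr (.inl ⟨ε, hε, hform⟩)⟩
  rcases lt_or_gt_of_ne hη with hη | hη <;> rcases lt_or_gt_of_ne hζ with hζ | hζ
  · exact liouville (.inr rfl) (by linarith) (by linarith)
  · obtain ⟨φ', hφ', hp', hform⟩ :=
      h.symm.exists_isComplexLiouville hζ hη hφ hΩ hΩφ hp hI hF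
    exact ⟨φ', hφ', hp', .inr (.inr (.inl hform))⟩
  · obtain ⟨φ', hφ', hp', hform⟩ := h.exists_isComplexLiouville hη hζ hφ hΩ hΩφ hp hI hF
    exact ⟨φ', hφ', hp', .inr (.inr (.inl hform))⟩
  · exact liouville (.inl rfl) (by linarith) (by linarith)

lemma exists_hasNormalForm_of_eval_eq_zero
    (h : IsNullCoframe Ω (momentumForm g.hamiltonian φ) η ζ)
    (hη : (momentumForm F φ).eval p (η p) ≠ 0)
    (hζ : ∀ q ∈ Ω, (momentumForm F φ).eval q (ζ q) = 0)
    (hφ : φ ∈ IsManifold.maximalAtlas (𝓡 2) ∞ M) (hΩ : IsOpen Ω) (hΩφ : Ω ⊆ φ.target) (hp : p ∈ Ω)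
    (hI : g.IsIntegral F) (hF : IsQuadraticInMomenta F) :
    ∃ φ' ∈ IsManifold.maximalAtlas (𝓡 2) ∞ M, φ.symm p ∈ φ'.source ∧ HasNormalForm g F φ' := by
  obtain ⟨ε, hε, hεη⟩ := exists_sign_mul_pos hη
  rw [← smul_eq_mul, ← MomentumForm.smul_eval, ← momentumForm_const_smul] at hεη
  have hεζ (q) (hq : q ∈ Ω) : (momentumForm (ε • F) φ).eval q (ζ q) = 0 := by
    rw [momentumForm_const_smul, MomentumForm.smul_eval, hζ q hq, smul_zero]
  obtain ⟨φ', hφ', hp', hform⟩ := exists_isJordanBlock_of_eval_eq_zero h hεη hεζ hφ hΩ hΩφ hp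
    (hI.const_smul ε) (hF.const_smul ε)
  exact ⟨φ', hφ', hp', .inr (.inr (.inr ⟨ε, hε, hform⟩))⟩

end IsNullCoframe

lemma exists_hasNormalForm_of_discr_pos (hφ : φ ∈ IsManifold.maximalAtlas (𝓡 2) ∞ M)
    (hΩ : IsOpen Ω) (hΩφ : Ω ⊆ φ.target) (hp : p ∈ Ω) (hI : g.IsIntegral F)
    (hF : IsQuadraticInMomenta F) (hpos : 0 < (momentumForm g.hamiltonian φ).discr p)
    (hne : ∀ O ⊆ φ.target, IsOpen O → O.Nonempty → ¬ ∃ k : ℝ, ∀ q ∈ O, ∀ P : Fin 2 → ℝ,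
      (momentumForm F φ).eval q P = k * (momentumForm g.hamiltonian φ).eval q P) :
    ∃ φ' ∈ IsManifold.maximalAtlas (𝓡 2) ∞ M,
      (∃ q ∈ Ω, φ.symm q ∈ φ'.source) ∧ HasNormalForm g F φ' := by
  have hpair := (hI.isKillingPair hF hφ).mono hΩ hΩφ
  obtain ⟨r, hr, hsub, η₀, ζ₀, h₀⟩ := exists_real_isNullCoframe hpair.smooth_left hΩ hp hpos
  obtain ⟨η, ζ, h, p₁, hp₁, hη⟩ := h₀.exists_eval_ne_zero (hpair.mono Metric.isOpen_ball hsub)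
    (convex_ball p r) (hne _ (hsub.trans hΩφ) Metric.isOpen_ball ⟨p, Metric.mem_ball_self hr⟩)
  obtain ⟨r₁, hr₁, hsub₁, hη₁⟩ := exists_ball_subset_preimage Metric.isOpen_ball
    ((hpair.smooth_right.mono hsub).eval h.smooth_left).continuousOn isOpen_ne hp₁ hη
  have hsubΩ := hsub₁.trans hsub
  have h₁ := h.mono hsub₁
  by_cases hζ : ∀ q ∈ Metric.ball p₁ r₁, (momentumForm F φ).eval q (ζ q) = 0
  · obtain ⟨φ', hφ', hp', hform⟩ := h₁.exists_hasNormalForm_of_eval_eq_zero hη hζ hφ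
      Metric.isOpen_ball (hsubΩ.trans hΩφ) (Metric.mem_ball_self hr₁) hI hF
    exact ⟨φ', hφ', ⟨p₁, hsub hp₁, hp'⟩, hform⟩
  · push Not at hζ
    obtain ⟨q, hq, hζ⟩ := hζ
    obtain ⟨φ', hφ', hp', hform⟩ := h₁.exists_hasNormalForm_of_eval_ne_zero (hη₁ q hq) hζ hφ
      Metric.isOpen_ball (hsubΩ.trans hΩφ) hq hI hF
    exact ⟨φ', hφ', ⟨q, hsubΩ hq, hp'⟩, hform⟩

/-! ### Definite metrics -/

lemma IsKillingPair.exists_re_im_primitive {H F : MomentumForm} (h : IsKillingPair Ω H F)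
    (hconv : Convex ℝ Ω) {θ : Plane → Fin 2 → ℂ} (hθ : ContDiffOn ℝ ∞ θ Ω)
    (hH : ∀ q ∈ Ω, H.eval q (θ q) = 0) (hF : ∀ q ∈ Ω, F.eval q (θ q) = 1) :
    ∃ x y : Plane → ℝ, ContDiffOn ℝ ∞ x Ω ∧ ContDiffOn ℝ ∞ y Ω ∧ ∀ q ∈ Ω,
      differential x q = (fun i => (θ q i).im) ∧ differential y q = fun i => (θ q i).re := by
  have primitive (l : ℂ →L[ℝ] ℝ) : ∃ W : Plane → ℝ, ContDiffOn ℝ ∞ W Ω ∧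
      EqOn (differential W) (fun q i => l (θ q i)) Ω := by
    refine exists_primitive h.isOpen hconv
      (contDiffOn_pi.2 fun i => l.contDiff.comp_contDiffOn (contDiffOn_pi.1 hθ i))
      fun q hq i j => ?_
    have hd (j : Fin 2) : DifferentiableAt ℝ (fun q => θ q j) q :=
      differentiableAt_of_contDiffOn (contDiffOn_pi.1 hθ j) h.isOpen hq
    rw [pd_clm l (hd j), pd_clm l (hd i), h.pd_symm_of_isotropic hθ hH one_ne_zero hF hq]
  obtain ⟨x, hx, hdx⟩ := primitive Complex.imCLM
  obtain ⟨y, hy, hdy⟩ := primitive Complex.reCLM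
  exact ⟨x, y, hx, hy, fun q hq => ⟨hdx hq, hdy hq⟩⟩

lemma wedge_ne_zero_of_discr_neg {H F : MomentumForm} {q : Plane} {P Q : Fin 2 → ℝ}
    (hneg : H.discr q < 0) (hpolar : H.polar q P Q = 0) (heq : H.eval q P = H.eval q Q)
    (hF : F.eval q P ≠ F.eval q Q) : wedge P Q ≠ 0 := by
  intro hw
  have hQ : H.eval q Q = 0 := by
    have := H.polar_sq_sub q P Q
    rw [hpolar, heq, hw] at this
    exact pow_eq_zero_iff two_ne_zero |>.1 (by linear_combination (-1 / 4) * this)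
  apply hF
  rw [MomentumForm.eq_zero_of_eval_eq_zero hneg hQ,
    MomentumForm.eq_zero_of_eval_eq_zero hneg (heq.trans hQ)]

lemma exists_isLiouville_of_isotropic {θ : Plane → Fin 2 → ℂ} (hθ : ContDiffOn ℝ ∞ θ Ω)
    (hHθ : ∀ q ∈ Ω, (momentumForm g.hamiltonian φ).eval q (θ q) = 0)
    (hFθ : ∀ q ∈ Ω, (momentumForm F φ).eval q (θ q) = 1) (hconv : Convex ℝ Ω)
    (hneg : (momentumForm g.hamiltonian φ).discr p < 0)
    (hφ : φ ∈ IsManifold.maximalAtlas (𝓡 2) ∞ M) (hΩ : IsOpen Ω) (hΩφ : Ω ⊆ φ.target) (hp : p ∈ Ω)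
    (hI : g.IsIntegral F) (hF : IsQuadraticInMomenta F) :
    ∃ φ' ∈ IsManifold.maximalAtlas (𝓡 2) ∞ M, φ.symm p ∈ φ'.source ∧
      IsLiouville 1 φ'.target (g.lineElement φ') (inCoords F φ') := by
  obtain ⟨x, y, hx, hy, hd⟩ :=
    ((hI.isKillingPair hF hφ).mono hΩ hΩφ).exists_re_im_primitive hconv hθ hHθ hFθ
  have parts {K : MomentumForm} {n : ℝ} {q : Plane} (hq : q ∈ Ω) (hK : K.eval q (θ q) = n) :
      K.eval q (differential y q) = n + K.eval q (differential x q) ∧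
        K.polar q (differential x q) (differential y q) = 0 := by
    rw [MomentumForm.eval_complex, ← (hd q hq).1, ← (hd q hq).2, Complex.ext_iff] at hK
    exact ⟨by simpa [sub_eq_iff_eq_add] using hK.1, hK.2⟩
  have hHd (q) (hq : q ∈ Ω) := parts (n := 0) hq (by simpa using hHθ q hq)
  have hFd (q) (hq : q ∈ Ω) := parts (n := 1) hq (by simpa using hFθ q hq)
  simp only [zero_add] at hHd
  have hw := wedge_ne_zero_of_discr_neg (F := momentumForm F φ) hneg (hHd p hp).2
    (hHd p hp).1.symm (by rw [(hFd p hp).1]; simp)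
  exact exists_isLiouville_of_eval_differential (one_pow 2) hx hy hw hφ hΩ hΩφ hp hI hF
    (fun q hq => (hHd q hq).2) (fun q hq => by rw [one_mul, (hHd q hq).1])
    (fun q hq => (hFd q hq).2) (fun q hq => by rw [one_mul, (hFd q hq).1])

lemma exists_hasNormalForm_of_discr_neg (hφ : φ ∈ IsManifold.maximalAtlas (𝓡 2) ∞ M)
    (hΩ : IsOpen Ω) (hΩφ : Ω ⊆ φ.target) (hp : p ∈ Ω) (hI : g.IsIntegral F)
    (hF : IsQuadraticInMomenta F) (hneg : (momentumForm g.hamiltonian φ).discr p < 0)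
    (hne : ∀ O ⊆ φ.target, IsOpen O → O.Nonempty → ¬ ∃ k : ℝ, ∀ q ∈ O, ∀ P : Fin 2 → ℝ,
      (momentumForm F φ).eval q P = k * (momentumForm g.hamiltonian φ).eval q P) :
    ∃ φ' ∈ IsManifold.maximalAtlas (𝓡 2) ∞ M,
      (∃ q ∈ Ω, φ.symm q ∈ φ'.source) ∧ HasNormalForm g F φ' := by
  have hpair := (hI.isKillingPair hF hφ).mono hΩ hΩφ
  obtain ⟨r₀, hr₀, hsub₀, hdiscr⟩ := exists_ball_subset_preimage hΩ
    hpair.smooth_left.discr.continuousOn isOpen_Iio hp hneg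
  have hpair₀ := hpair.mono Metric.isOpen_ball hsub₀
  obtain ⟨r, hr, hsub, η₀, ζ₀, h₀⟩ := exists_complex_isNullCoframe hpair₀.smooth_left
    Metric.isOpen_ball (Metric.mem_ball_self hr₀) hneg
  have hsubφ := (hsub.trans hsub₀).trans hΩφ
  obtain ⟨η, ζ, h, p₁, hp₁, hη⟩ := h₀.exists_eval_ne_zero (hpair₀.mono Metric.isOpen_ball hsub)
    (convex_ball p r) (hne _ hsubφ Metric.isOpen_ball ⟨p, Metric.mem_ball_self hr⟩)
  obtain ⟨r₁, hr₁, hsub₁, w, hw, hw₂⟩ := exists_contDiffOn_sqrt Metric.isOpen_ball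
    ((hpair₀.smooth_right.mono hsub).eval h.smooth_left) hp₁ hη
  have hθ := (h.mono hsub₁).smul_left (hw.inv fun q hq => (hw₂ q hq).1)
    fun q hq => inv_ne_zero (hw₂ q hq).1
  have hFθ (q) (hq : q ∈ Metric.ball p₁ r₁) :
      (momentumForm F φ).eval q ((w q)⁻¹ • η q) = 1 := by
    rw [MomentumForm.eval_smul, ← (hw₂ q hq).2, inv_pow,
      inv_mul_cancel₀ (pow_ne_zero 2 (hw₂ q hq).1)]
  obtain ⟨φ', hφ', hp', hform⟩ := exists_isLiouville_of_isotropic hθ.smooth_left hθ.null_left hFθ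
    (convex_ball p₁ r₁) (hdiscr p₁ (hsub hp₁)) hφ Metric.isOpen_ball (hsub₁.trans hsubφ)
    (Metric.mem_ball_self hr₁) hI hF
  exact ⟨φ', hφ', ⟨p₁, hsub₀ (hsub hp₁), hp'⟩, .inl hform⟩

end Charts

/-! ### Unique continuation on the surface -/

section Surface

variable {M : Type*} [TopologicalSpace M] [ChartedSpace Plane M]
  {g : PseudoRiemannianMetric M} {F : CotangentFunction M} {φ : OpenPartialHomeomorph M Plane}
  {q : Plane} {k : ℝ}

lemma isOpen_setOf_exists_hasNormalForm (g : PseudoRiemannianMetric M) (F : CotangentFunction M) :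
    IsOpen {p | ∃ φ ∈ IsManifold.maximalAtlas (𝓡 2) ∞ M, p ∈ φ.source ∧ HasNormalForm g F φ} :=
  isOpen_iff_forall_mem_open.2 fun _ ⟨φ, hφ, hp, hform⟩ =>
    ⟨φ.source, fun _ hq => ⟨φ, hφ, hq, hform⟩, φ.open_source, hp⟩

lemma IsQuadraticInMomenta.eq_smul_hamiltonian_iff (hF : IsQuadraticInMomenta F)
    (hφ : φ ∈ IsManifold.maximalAtlas (𝓡 2) ∞ M) (hq : q ∈ φ.target) :
    F (φ.symm q) = k • g.hamiltonian (φ.symm q) ↔ ∀ P : Fin 2 → ℝ,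
      (momentumForm F φ).eval q P = k * (momentumForm g.hamiltonian φ).eval q P := by
  have hcoords (P : Plane) :
      F (φ.symm q) (covec φ q P) = (k • g.hamiltonian (φ.symm q)) (covec φ q P) ↔
        (momentumForm F φ).eval q P.ofLp =
          k * (momentumForm g.hamiltonian φ).eval q P.ofLp := by
    rw [← hF.inCoords_eq hφ hq, ← g.isQuadraticInMomenta_hamiltonian.inCoords_eq hφ hq]
    rfl
  rw [funext_iff, (covec_surjective hφ hq).forall]
  exact ⟨fun h P => (hcoords (WithLp.toLp 2 P)).1 (h _), fun h P => (hcoords P).2 (h _)⟩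

lemma PseudoRiemannianMetric.IsIntegral.eq_smul_hamiltonian_of_convex (hI : g.IsIntegral F)
    (hF : IsQuadraticInMomenta F) (hφ : φ ∈ IsManifold.maximalAtlas (𝓡 2) ∞ M) {Ω O : Set Plane}
    (hΩ : IsOpen Ω) (hconv : Convex ℝ Ω) (hΩφ : Ω ⊆ φ.target) (hO : IsOpen O) (hOΩ : O ⊆ Ω)
    (hne : O.Nonempty) (h : ∀ q ∈ O, F (φ.symm q) = k • g.hamiltonian (φ.symm q)) :
    ∀ q ∈ Ω, F (φ.symm q) = k • g.hamiltonian (φ.symm q) := by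
  have hpair := (hI.isKillingPair hF hφ).mono hΩ hΩφ
  have hdiff (q : Plane) (P : Fin 2 → ℝ) :
      (momentumForm F φ + (-k) • momentumForm g.hamiltonian φ).eval q P =
        (momentumForm F φ).eval q P - k * (momentumForm g.hamiltonian φ).eval q P := by
    rw [MomentumForm.add_eval, MomentumForm.smul_eval]
    ring
  have hzero := (hpair.add (hpair.self.smul (-k))).eqOn_zero hconv hO hOΩ hne fun q hq P => by
    rw [hdiff, (hF.eq_smul_hamiltonian_iff hφ (hΩφ (hOΩ hq))).1 (h q hq) P, sub_self]
  refine fun q hq => (hF.eq_smul_hamiltonian_iff hφ (hΩφ hq)).2 fun P => sub_eq_zero.1 ?_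
  rw [← hdiff, hzero q hq P]

variable [IsManifold (𝓡 2) ∞ M]

lemma PseudoRiemannianMetric.IsIntegral.isClosed_interior (hI : g.IsIntegral F)
    (hF : IsQuadraticInMomenta F) (k : ℝ) :
    IsClosed (interior {p | F p = k • g.hamiltonian p}) := by
  refine isClosed_of_closure_subset fun p hp => ?_
  set ψ := chartAt Plane p
  have hps : p ∈ ψ.source := mem_chart_source Plane p
  obtain ⟨r, hr, hball⟩ := Metric.isOpen_iff.1 ψ.open_target _ (ψ.map_source hps)
  have hV : IsOpen (ψ.source ∩ ψ ⁻¹' Metric.ball (ψ p) r) :=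
    ψ.isOpen_inter_preimage Metric.isOpen_ball
  have hpV : p ∈ ψ.source ∩ ψ ⁻¹' Metric.ball (ψ p) r := ⟨hps, Metric.mem_ball_self hr⟩
  obtain ⟨z, ⟨hzs, hzb⟩, hz⟩ := mem_closure_iff.1 hp _ hV hpV
  have hball_eq := hI.eq_smul_hamiltonian_of_convex hF (IsManifold.chart_mem_maximalAtlas p)
    Metric.isOpen_ball (convex_ball _ _) hball
    (Metric.isOpen_ball.inter (ψ.symm.isOpen_inter_preimage isOpen_interior)) inter_subset_left
    ⟨ψ z, hzb, ψ.map_source hzs, by rwa [mem_preimage, ψ.left_inv hzs]⟩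
    fun q hq => interior_subset (s := {p | F p = k • g.hamiltonian p}) hq.2.2
  refine mem_interior.2 ⟨_, fun m hm => ?_, hV, hpV⟩
  have hm_eq := hball_eq (ψ m) hm.2
  rwa [ψ.left_inv hm.1] at hm_eq

theorem PseudoRiemannianMetric.IsNontrivial.not_forall_eq_smul_hamiltonian [PreconnectedSpace M]
    (hnontriv : g.IsNontrivial F) (hI : g.IsIntegral F) (hF : IsQuadraticInMomenta F)
    {U : Set M} (hU : IsOpen U) (hne : U.Nonempty) (k : ℝ) :
    ¬ ∀ p ∈ U, F p = k • g.hamiltonian p := by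
  intro h
  have huniv := IsClopen.eq_univ ⟨hI.isClosed_interior hF k, isOpen_interior⟩
    (hne.mono (interior_maximal h hU))
  exact hnontriv k (funext (eq_univ_iff_forall.1 (interior_eq_univ.1 huniv)))

theorem dense_setOf_exists_hasNormalForm [PreconnectedSpace M] (hnontriv : g.IsNontrivial F)
    (hI : g.IsIntegral F) (hF : IsQuadraticInMomenta F) :
    Dense {p | ∃ φ ∈ IsManifold.maximalAtlas (𝓡 2) ∞ M, p ∈ φ.source ∧ HasNormalForm g F φ} := by
  refine dense_iff_inter_open.2 fun V hV ⟨m, hm⟩ => ?_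
  set φ := chartAt Plane m
  have hφ : φ ∈ IsManifold.maximalAtlas (𝓡 2) ∞ M := IsManifold.chart_mem_maximalAtlas m
  have hms : m ∈ φ.source := mem_chart_source _ m
  have hΩ : IsOpen (φ.target ∩ φ.symm ⁻¹' V) := φ.symm.isOpen_inter_preimage hV
  have hmΩ : φ m ∈ φ.target ∩ φ.symm ⁻¹' V :=
    ⟨φ.map_source hms, by rwa [mem_preimage, φ.left_inv hms]⟩
  have hne (O) (hOφ : O ⊆ φ.target) (hO : IsOpen O) (hO' : O.Nonempty) : ¬ ∃ k : ℝ, ∀ q ∈ O,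
      ∀ P, (momentumForm F φ).eval q P = k * (momentumForm g.hamiltonian φ).eval q P := by
    rintro ⟨k, hk⟩
    refine hnontriv.not_forall_eq_smul_hamiltonian hI hF
      (φ.symm.isOpen_image_of_subset_source hO hOφ) (hO'.image _) k ?_
    rintro _ ⟨q, hq, rfl⟩
    exact (hF.eq_smul_hamiltonian_iff hφ (hOφ hq)).2 (hk q hq)
  obtain ⟨φ', hφ', ⟨q, hq, hqs⟩, hform⟩ : ∃ φ' ∈ IsManifold.maximalAtlas (𝓡 2) ∞ M,
      (∃ q ∈ φ.target ∩ φ.symm ⁻¹' V, φ.symm q ∈ φ'.source) ∧ HasNormalForm g F φ' := by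
    rcases lt_or_gt_of_ne ((hI.isKillingPair hF hφ).discr_ne _ hmΩ.1) with hneg | hpos
    · exact exists_hasNormalForm_of_discr_neg hφ hΩ inter_subset_left hmΩ hI hF hneg hne
    · exact exists_hasNormalForm_of_discr_pos hφ hΩ inter_subset_left hmΩ hI hF hpos hne
  exact ⟨φ.symm q, hq.2, φ', hφ', hqs, hform⟩

end Surface

end Dini

theorem theoremB {M : Type*} [TopologicalSpace M] [ChartedSpace Dini.Plane M]
    [IsManifold (𝓡 2) ∞ M] [ConnectedSpace M]
    (g : Dini.PseudoRiemannianMetric M) (F : Dini.CotangentFunction M)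
    (hquad : Dini.IsQuadraticInMomenta F) (hint : g.IsIntegral F) (hnontriv : g.IsNontrivial F) :
    ∃ U : Set M, IsOpen U ∧ Dense U ∧ ∀ p ∈ U,
      ∃ φ ∈ IsManifold.maximalAtlas (𝓡 2) ∞ M, p ∈ φ.source ∧
        (Dini.IsLiouville 1 φ.target (g.lineElement φ) (Dini.inCoords F φ) ∨
          (∃ ε : ℝ, (ε = 1 ∨ ε = -1) ∧
            Dini.IsLiouville (-1) φ.target (g.lineElement φ)
              (fun q P => ε * Dini.inCoords F φ q P)) ∨
          Dini.IsComplexLiouville φ.target (g.lineElement φ) (Dini.inCoords F φ) ∨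
          (∃ ε : ℝ, (ε = 1 ∨ ε = -1) ∧
            Dini.IsJordanBlock φ.target (g.lineElement φ)
              (fun q P => ε * Dini.inCoords F φ q P))) :=
  ⟨_, Dini.isOpen_setOf_exists_hasNormalForm g F,
    Dini.dense_setOf_exists_hasNormalForm hnontriv hint hquad, fun _ hp => hp⟩
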